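/- **Setting.** Let $n,m,d,q$ be positive integers, $\mathbb X\subseteq\mathbb R^n$, $\mathbb U\subseteq\mathbb R^m$, $\mathbb W\subseteq\mathbb R^n$, $\mathbb S\subseteq\mathbb R^q$, let $f:\mathbb X\times\mathbb U\to\mathbb R^n$, $\psi:\mathbb X\times\mathbb U\to\mathbb R^d$ and $\alpha:\mathbb X\times\mathbb S\times\mathbb R^{d\times n}\to\mathbb U$ be Borel measurable, $\theta_*,\vartheta_0\in\mathbb R^{d\times n}$, $\gamma>0$, and put $g(x,u,w)=f(x,u)+\theta_*^\top\psi(x,u)+w$, where $g(\mathbb X\times\mathbb U\times\mathbb W)\subseteq\mathbb X$. On a probability space $(\Omega,\mathcal F,\mathbb P)$ let $W(1),W(2),\dots$ be i.i.d. $\mathbb W$-valued with law $\mu_w$, zero-mean and $\sigma_w^2$-sub-Gaussian, i.e. $\mathbb E[e^{\lambda\zeta^\top W(t)}]\le e^{\lambda^2\sigma_w^2/2}$ for all $\lambda\in\mathbb R$ and unit vectors $\zeta$, and let $S(0),S(1),\dots$ be i.i.d. $\mathbb S$-valued with law $\mu_s$, the two sequences being independent. For $x_0\in\mathbb X$ consider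 the closed loop $X(0)=x_0$, $U(t)=\alpha(X(t),S(t),\hat\theta(t-1))$, $X(t+1)=g(X(t),U(t),W(t+1))$ for $t\geq 0$, where $\hat\theta(-1)=\hat\theta(0)=\vartheta_0$ and, for $t\ge1$, $\hat\theta(t)$ minimises $\sum_{s=1}^t|X(s)-\theta^\top\psi(X(s-1),U(s-1))-f(X(s-1),U(s-1))|^2+\gamma|\theta|_F^2$ over $\theta\in\mathbb R^{d\times n}$. Here $|\cdot|$ is the Euclidean norm of vectors and the induced 2-norm of matrices, and $|\cdot|_F$ is the Frobenius norm. A function $\mathbb R_{\ge0}\to\mathbb R_{\ge0}$ is of class $\mathcal K$ if it is continuous, strictly increasing and zero at zero, and of class $\mathcal K_\infty$ if moreover it is unbounded; $h$ is $k$-sub-exponential if $\ln h(r^k)=o(r)$ as $r\to\infty$; $\eta:\mathbb N_0\to\mathbb R_{\ge0}$ is of class $\mathcal L$ if it is non-increasing with limit $0$. **Assumptions.** (i) There are $\chi_1,\chi_2,\chi_3,\chi_4,\sigma_1,\sigma_2\in\mathcal K_\infty$, with $\chi_1,\chi_3,\sigma_2$ 1-sub-exponential and $\chi_4$ 2-sub-exponential,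 and $c_1\ge0$ such that for all $t\in\mathbb N_0$ every deterministic solution of $x(i+1)=g(x(i),u(i),w(i+1))$ with $x(0)=\xi\in\mathbb X$, $u(i)\in\mathbb U$, $w(i)\in\mathbb W$ satisfies $|x(t)|\le\chi_1(t)+\chi_2(|\xi|)+\chi_3\big(\sum_{i=0}^{t-1}\sigma_1(|u(i)|)\big)+\chi_4\big(\sum_{i=1}^t\sigma_2(|w(i)|)\big)+c_1$. (ii) There is $u_{\max}\ge0$ with $|\alpha(x,s,\vartheta)|\le u_{\max}$ for all $x,s,\vartheta$. (iii) There is a nondecreasing $\chi_5:\mathbb R_{\ge0}\to\mathbb R_{\ge0}$ with $\chi_5(r)=O(r^k)$ as $r\to\infty$ for some $k\in\mathbb N$ and $|\psi(x,u)|\le\chi_5\big(\sqrt{|x|^2+|u|^2}\big)$ for all $x,u$. (iv) There are $\mathcal X_{\rm PE}\subseteq\mathbb X$ and $c_{\rm PE},p_{\rm PE}>0$ such that $(\mu_s\times\mu_w)\big(\{(s,w):|\zeta^\top\psi(x+w,\alpha(x+w,s,\vartheta))|^2\ge c_{\rm PE}\}\big)\ge p_{\rm PE}$ for all $\vartheta\in\mathbb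 R^{d\times n}$, $x\in\mathcal X_{\rm PE}$ and unit $\zeta\in\mathbb R^d$. (v) There are $\mathcal X_{\rm RPI}\subseteq\mathbb X$ and $\bar\vartheta>0$ such that $g(x,\alpha(x,s,\vartheta),w)\in\mathcal X_{\rm RPI}$ whenever $x\in\mathcal X_{\rm RPI}$, $w\in\mathbb W$, $s\in\mathbb S$, $|\vartheta-\theta_*|\le\bar\vartheta$; moreover $g(x,u,0)\in\mathcal X_{\rm PE}$ whenever $x\in\mathcal X_{\rm RPI}$, $u\in\mathbb U$, $|u|\le u_{\max}$. (vi) There are a Borel measurable $V:\mathcal X_{\rm RPI}\to\mathbb R_{\ge0}$, functions $\alpha_1,\alpha_2,\alpha_3\in\mathcal K_\infty$, $\sigma_3\in\mathcal K$ and a constant $\tilde d\ge0$ such that, for all $x\in\mathcal X_{\rm RPI}$ and $|\tilde\vartheta|\le\bar\vartheta$, $\alpha_1(|x|)\le V(x)\le\alpha_2(|x|)$ and $$\int\!\!\int V\big(g(x,\alpha(x,s,\tilde\vartheta+\theta_*),w)\big)\,d\mu_s(s)\,d\mu_w(w)-V(x)\le-\alpha_3(|x|)+\tilde d+\sigma_3(|\tilde\vartheta|),$$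 and $\alpha_3\circ\alpha_2^{-1}$ is bounded below by a convex function of class $\mathcal K_\infty$. **Notation.** For $\delta\in(0,1)$ let $\overline w(0,\delta)=0$, $\overline w(t,\delta)=\sigma_w\sqrt{2n\ln\frac{n\pi^2t^2}{3\delta}}$ for $t\ge1$, and $\overline x(t,\delta,x_0)=\chi_1(t)+\chi_2(|x_0|)+\chi_3(t\sigma_1(u_{\max}))+\chi_4(t\sigma_2(\overline w(t,\delta)))+c_1$, $\overline z(t,\delta,x_0)=\chi_5\big(\sqrt{\overline x(t-1,\delta,x_0)^2+u_{\max}^2}\big)$, $\beta_{\max}(t,\delta,x_0)=\sum_{i=1}^t\overline z(i,\delta,x_0)^2+\gamma$, $$e(t,\delta,x_0)=\frac{\gamma^{1/2}|\theta_*|_F+\sigma_w\sqrt{2n\big(\ln\frac{3n}{\delta}+\frac d2\ln(\beta_{\max}(t,\delta/3,x_0)\gamma^{-1})\big)}}{\sqrt{\frac{c_{\rm PE}p_{\rm PE}}4(t-1)+\gamma}},$$ $T_{\rm contained}(\delta,x_0)=\sup\{T\in\mathbb N: \{x\in\mathbb X:|x|\le\overline x(T,\delta/3,x_0)\}\subseteq\mathcal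 X_{\rm RPI}\}$ (equal to $0$ if this set is empty), $$T_{\text{burn-in}}(\delta,x_0)=\inf\Big\{T\in\mathbb N:\ t\ge\tfrac{2}{(1-\ln2)p_{\rm PE}}\Big(d\ln\Big(1+\tfrac{16\sum_{i=1}^t\overline z(i,\delta/3,x_0)^2}{c_{\rm PE}p_{\rm PE}(t-1)}\Big)+\ln\tfrac{\pi^2(t-T+1)^2}{2\delta}\Big)+1\ \ \forall t\ge T\Big\},$$ $T_{\rm converge}(\delta,x_0)=\max\big(T_{\text{burn-in}}(\delta,x_0),\inf\{T\in\mathbb N:e(t,\delta,x_0)\le\bar\vartheta\ \forall t\ge T\}\big)$. **Theorem.** Under (i)–(vi), for every $\delta\in(0,1)$ there is $c_2\ge0$ such that for every $x_0\in\mathcal X_{\rm RPI}$ with $T_{\rm converge}(\delta/2,x_0)+1\le T_{\rm contained}(\delta/2,x_0)$ there is $\eta\in\mathcal L$ such that $\mathbb P(|X(t)|\le\eta(t)+c_2)\ge1-\delta$ for all $t\in\mathbb N_0$. -/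

import Mathlib

open MeasureTheory ProbabilityTheory Filter Topology
open scoped NNReal ENNReal

noncomputable section

namespace AdaptiveControl

/-! ### Notation: Euclidean spaces, matrix norms, comparison functions -/

/-- `ℝᵏ` with the Euclidean norm. -/
abbrev Vec (k : ℕ) : Type := EuclideanSpace ℝ (Fin k)

/-- `ℝ^{d × n}`. -/
abbrev Mat (d n : ℕ) : Type := Matrix (Fin d) (Fin n) ℝ

/-- The vector `Aᵀ z`. -/
def transMul {d n : ℕ} (A : Mat d n) (z : Vec d) : Vec n := Matrix.toEuclideanLin A.transpose z

/-- The induced 2-norm `|A|` of a matrix. -/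
def opNorm {d n : ℕ} (A : Mat d n) : ℝ≥0 :=
  ‖LinearMap.toContinuousLinearMap (Matrix.toEuclideanLin A)‖₊

/-- The Frobenius norm `|A|_F` of a matrix. -/
def frobNorm {d n : ℕ} (A : Mat d n) : ℝ := √(∑ i, ∑ j, A i j ^ 2)

/-- Class `𝒦`. -/
structure ClassK (a : ℝ≥0 → ℝ≥0) : Prop where
  continuous : Continuous a
  strictMono : StrictMono a
  map_zero : a 0 = 0

/-- Class `𝒦_∞`. -/
structure ClassKInf (a : ℝ≥0 → ℝ≥0) : Prop extends ClassK a where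
  unbounded : Tendsto a atTop atTop

/-- `h` is `k`-order sub-exponential: `ln (h (r ^ k)) = o(r)` as `r → ∞`. -/
def SubExp (k : ℕ) (h : ℝ≥0 → ℝ≥0) : Prop :=
  Tendsto (fun r : ℝ≥0 => Real.log (h (r ^ k)) / (r : ℝ)) atTop (𝓝 0)

/-- `h` is asymptotically polynomially bounded: `h r = O(r ^ k)` as `r → ∞`, for some `k`. -/
def APB (h : ℝ≥0 → ℝ≥0) : Prop :=
  ∃ k : ℕ, (fun r : ℝ≥0 => (h r : ℝ)) =O[atTop] (fun r : ℝ≥0 => (r : ℝ) ^ k)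

/-- Class `ℒ`. -/
def ClassL (η : ℕ → ℝ≥0) : Prop := Antitone η ∧ Tendsto η atTop (𝓝 0)

/-! ### The system and the adaptive controller -/

/-- The data of the plant `x⁺ = f(x,u) + θ*ᵀ ψ(x,u) + w` with state space `𝕏 ⊆ ℝⁿ`, control
space `𝕌 ⊆ ℝᵐ`, process noise space `𝕎 ⊆ ℝⁿ`, and of the adaptive controller: exploratory noise
space `𝕊 ⊆ ℝ^q`, policy `α`, initial estimate `ϑ₀`, regularisation parameter `γ`. -/
structure System (n m d q : ℕ) where
  𝕏 : Set (Vec n)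
  𝕌 : Set (Vec m)
  𝕎 : Set (Vec n)
  𝕊 : Set (Vec q)
  f : 𝕏 → 𝕌 → Vec n
  ψ : 𝕏 → 𝕌 → Vec d
  θstar : Mat d n
  /-- the right-hand side of the dynamics takes its values in `𝕏` -/
  maps_to : ∀ (x : 𝕏) (u : 𝕌) (w : 𝕎), f x u + transMul θstar (ψ x u) + (w : Vec n) ∈ 𝕏
  α : 𝕏 → 𝕊 → Mat d n → 𝕌
  ϑ₀ : Mat d n
  γ : ℝ
  γ_pos : 0 < γ

namespace System

variable {n m d q : ℕ} (M : System n m d q)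

/-- The one-step prediction `g(x,u,0) = f(x,u) + θ*ᵀ ψ(x,u)`. -/
def pred (x : M.𝕏) (u : M.𝕌) : Vec n := M.f x u + transMul M.θstar (M.ψ x u)

/-- `g(x,u,w) = f(x,u) + θ*ᵀ ψ(x,u) + w`. -/
def g (x : M.𝕏) (u : M.𝕌) (w : M.𝕎) : M.𝕏 :=
  ⟨M.f x u + transMul M.θstar (M.ψ x u) + (w : Vec n), M.maps_to x u w⟩

/-- The deterministic solution `φ(t, ξ, u, w)`; here `w i` is the process noise at time `i + 1`. -/
def φ (ξ : M.𝕏) (u : ℕ → M.𝕌) (w : ℕ → M.𝕎) : ℕ → M.𝕏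
  | 0 => ξ
  | t + 1 => M.g (φ ξ u w t) (u t) (w t)

/-- The regularised least squares cost at time `t`, for the data `X(0), …, X(t)` and
`U(0), …, U(t-1)`. -/
def rlsCost (X : ℕ → M.𝕏) (U : ℕ → M.𝕌) (t : ℕ) (θ : Mat d n) : ℝ :=
  ∑ s ∈ Finset.range t,
      ‖(X (s + 1) : Vec n) - transMul θ (M.ψ (X s) (U s)) - M.f (X s) (U s)‖ ^ 2
    + M.γ * frobNorm θ ^ 2

/-- `X`, `U`, `θhat` are the states, controls and parameter estimates generated by the adaptive
control loop from the initial state `x₀` and the noise sequences. Here `W t` is the process noise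
at time `t + 1`. Since the estimates at times `-1` and `0` are both `ϑ₀`, the estimate at time
`t - 1` is `θhat (t - 1)` with truncated subtraction. -/
structure IsClosedLoop {Ω : Type*} (W : ℕ → Ω → M.𝕎) (S : ℕ → Ω → M.𝕊) (x₀ : M.𝕏)
    (X : ℕ → Ω → M.𝕏) (U : ℕ → Ω → M.𝕌) (θhat : ℕ → Ω → Mat d n) : Prop where
  init : ∀ ω, X 0 ω = x₀
  dynamics : ∀ t ω, X (t + 1) ω = M.g (X t ω) (U t ω) (W t ω)
  control : ∀ t ω, U t ω = M.α (X t ω) (S t ω) (θhat (t - 1) ω)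
  estimate_zero : ∀ ω, θhat 0 ω = M.ϑ₀
  estimate : ∀ t, 1 ≤ t → ∀ ω,
    IsMinOn (M.rlsCost (fun s => X s ω) (fun s => U s ω) t) Set.univ (θhat t ω)

/-! ### Standing assumptions -/

/-- `f`, `ψ` and `α` are Borel measurable. -/
structure MeasurableMaps : Prop where
  f : Measurable fun p : M.𝕏 × M.𝕌 => M.f p.1 p.2
  ψ : Measurable fun p : M.𝕏 × M.𝕌 => M.ψ p.1 p.2
  α : Measurable fun p : M.𝕏 × M.𝕊 × (Fin d → Fin n → ℝ) =>
    M.α p.1 p.2.1 (Matrix.of p.2.2)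

/-- The process noise is i.i.d. with law `μw`, zero-mean and `σw²`-sub-Gaussian; the exploratory
noise is i.i.d. with law `μs`; the two sequences are independent of each other. -/
structure NoiseAssumption {Ω : Type*} [MeasurableSpace Ω] (P : Measure Ω)
    (W : ℕ → Ω → M.𝕎) (S : ℕ → Ω → M.𝕊) (μw : Measure M.𝕎) (μs : Measure M.𝕊)
    (σw : ℝ≥0) : Prop where
  measurable_W : ∀ t, Measurable (W t)
  measurable_S : ∀ t, Measurable (S t)
  law_W : ∀ t, P.map (W t) = μw
  law_S : ∀ t, P.map (S t) = μs
  indep_W : iIndepFun W P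
  indep_S : iIndepFun S P
  indep_W_S : IndepFun (fun ω t => W t ω) (fun ω t => S t ω) P
  zero_mean : ∀ t, ∫ ω, (W t ω : Vec n) ∂P = 0
  subGaussian : ∀ t, ∀ ζ : Vec n, ‖ζ‖ = 1 →
    HasSubgaussianMGF (fun ω => inner ℝ ζ (W t ω : Vec n)) (σw ^ 2) P

end System

/-- The growth functions and constants occurring in the standing assumptions. -/
structure Growth where
  χ₁ : ℝ≥0 → ℝ≥0
  χ₂ : ℝ≥0 → ℝ≥0
  χ₃ : ℝ≥0 → ℝ≥0
  χ₄ : ℝ≥0 → ℝ≥0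
  χ₅ : ℝ≥0 → ℝ≥0
  σ₁ : ℝ≥0 → ℝ≥0
  σ₂ : ℝ≥0 → ℝ≥0
  c₁ : ℝ≥0
  umax : ℝ≥0

namespace System

variable {n m d q : ℕ} (M : System n m d q)

/-- Sub-exponential input-to-state bound on reachable states. -/
structure ForwardComplete (B : Growth) : Prop where
  χ₁ : ClassKInf B.χ₁ ∧ SubExp 1 B.χ₁
  χ₂ : ClassKInf B.χ₂
  χ₃ : ClassKInf B.χ₃ ∧ SubExp 1 B.χ₃
  χ₄ : ClassKInf B.χ₄ ∧ SubExp 2 B.χ₄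
  σ₁ : ClassKInf B.σ₁
  σ₂ : ClassKInf B.σ₂ ∧ SubExp 1 B.σ₂
  bound : ∀ (t : ℕ) (ξ : M.𝕏) (u : ℕ → M.𝕌) (w : ℕ → M.𝕎),
    ‖(M.φ ξ u w t : Vec n)‖₊ ≤ B.χ₁ t + B.χ₂ ‖(ξ : Vec n)‖₊
      + B.χ₃ (∑ i ∈ Finset.range t, B.σ₁ ‖(u i : Vec m)‖₊)
      + B.χ₄ (∑ i ∈ Finset.range t, B.σ₂ ‖(w i : Vec n)‖₊) + B.c₁

/-- Constrained controls. -/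
def ConstrainedControls (B : Growth) : Prop :=
  ∀ (x : M.𝕏) (s : M.𝕊) (ϑ : Mat d n), ‖(M.α x s ϑ : Vec m)‖₊ ≤ B.umax

/-- Asymptotically polynomially bounded basis functions, with a nondecreasing bound. -/
structure PolyBasis (B : Growth) : Prop where
  apb : APB B.χ₅
  mono : Monotone B.χ₅
  bound : ∀ (x : M.𝕏) (u : M.𝕌),
    ‖M.ψ x u‖₊ ≤ B.χ₅ (NNReal.sqrt (‖(x : Vec n)‖₊ ^ 2 + ‖(u : Vec m)‖₊ ^ 2))

/-- `(𝒳, cPE, pPE)`-regional excitation. -/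
def RegionallyExcited (μw : Measure M.𝕎) (μs : Measure M.𝕊) (𝒳 : Set (Vec n))
    (cPE pPE : ℝ) : Prop :=
  ∀ (ϑ : Mat d n), ∀ x ∈ 𝒳, ∀ ζ : Vec d, ‖ζ‖ = 1 →
    pPE ≤ (μs.prod μw).real
      {p : M.𝕊 × M.𝕎 | ∃ h : x + (p.2 : Vec n) ∈ M.𝕏,
        cPE ≤ |inner ℝ ζ (M.ψ ⟨x + (p.2 : Vec n), h⟩ (M.α ⟨x + (p.2 : Vec n), h⟩ p.1 ϑ))| ^ 2}

/-- The one-step predicted reachable set `Γ(𝒳)`. -/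
def reach (B : Growth) (𝒳 : Set M.𝕏) : Set (Vec n) :=
  {y | ∃ x ∈ 𝒳, ∃ u : M.𝕌, ‖(u : Vec m)‖₊ ≤ B.umax ∧ y = M.pred x u}

/-- `𝒳` is robustly positive invariant with error constant `ϑbar > 0`. -/
def IsRPI (𝒳 : Set M.𝕏) (ϑbar : ℝ≥0) : Prop :=
  0 < ϑbar ∧ ∀ x ∈ 𝒳, ∀ (w : M.𝕎) (s : M.𝕊) (ϑ : Mat d n),
    opNorm (ϑ - M.θstar) ≤ ϑbar → M.g x (M.α x s ϑ) w ∈ 𝒳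

/-- `V` is a stochastic Lyapunov function on the RPI set `𝒳` with estimation error bound `ϑbar`.
Only the values of `V` on `𝒳` are used. -/
def IsStochLyapunov (μw : Measure M.𝕎) (μs : Measure M.𝕊) (𝒳 : Set M.𝕏) (ϑbar : ℝ≥0)
    (V : M.𝕏 → ℝ≥0) : Prop :=
  Measurable (fun x : 𝒳 => V x) ∧ M.IsRPI 𝒳 ϑbar ∧
  ∃ α₁ α₂ α₃ σ₃ : ℝ≥0 → ℝ≥0, ∃ dtil : ℝ≥0,
    ClassKInf α₁ ∧ ClassKInf α₂ ∧ ClassKInf α₃ ∧ ClassK σ₃ ∧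
    (∀ x ∈ 𝒳, α₁ ‖(x : Vec n)‖₊ ≤ V x ∧ V x ≤ α₂ ‖(x : Vec n)‖₊) ∧
    (∀ x ∈ 𝒳, ∀ ϑtil : Mat d n, opNorm ϑtil ≤ ϑbar →
      Integrable (fun p : M.𝕊 × M.𝕎 =>
        (V (M.g x (M.α x p.1 (ϑtil + M.θstar)) p.2) : ℝ)) (μs.prod μw) ∧
      (∫ p : M.𝕊 × M.𝕎,
        (V (M.g x (M.α x p.1 (ϑtil + M.θstar)) p.2) : ℝ) ∂(μs.prod μw)) - (V x : ℝ)
        ≤ -(α₃ ‖(x : Vec n)‖₊ : ℝ) + dtil + σ₃ (opNorm ϑtil)) ∧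
    ∃ αv : ℝ≥0 → ℝ≥0, ClassKInf αv ∧ ConvexOn ℝ≥0 Set.univ αv ∧
      ∀ r, αv r ≤ α₃ (Function.invFun α₂ r)

/-! ### High-probability bounds and time bounds -/

/-- The process noise bound `w̄(t, δ)` (for noise in `ℝⁿ`). -/
def wbar (n : ℕ) (σw : ℝ≥0) (t : ℕ) (δ : ℝ) : ℝ≥0 :=
  if t = 0 then 0
  else σw * Real.toNNReal (√(2 * n * Real.log (n * Real.pi ^ 2 * (t : ℝ) ^ 2 / (3 * δ))))

/-- The state bound `x̄(t, δ, x₀)`. -/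
def xbar (B : Growth) (σw : ℝ≥0) (t : ℕ) (δ : ℝ) (x₀ : M.𝕏) : ℝ≥0 :=
  B.χ₁ t + B.χ₂ ‖(x₀ : Vec n)‖₊ + B.χ₃ (t * B.σ₁ B.umax)
    + B.χ₄ (t * B.σ₂ (wbar n σw t δ)) + B.c₁

/-- The regressor bound `z̄(t, δ, x₀)`, for `t ≥ 1`. -/
def zbar (B : Growth) (σw : ℝ≥0) (t : ℕ) (δ : ℝ) (x₀ : M.𝕏) : ℝ≥0 :=
  B.χ₅ (NNReal.sqrt (M.xbar B σw (t - 1) δ x₀ ^ 2 + B.umax ^ 2))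

/-- The Gramian upper bound `β_max(t, δ, x₀)`. -/
def βmax (B : Growth) (σw : ℝ≥0) (t : ℕ) (δ : ℝ) (x₀ : M.𝕏) : ℝ :=
  ∑ i ∈ Finset.Icc 1 t, (M.zbar B σw i δ x₀ : ℝ) ^ 2 + M.γ

/-- The estimation error bound `e(t, δ, x₀)`, for `t ≥ 1`. -/
def errBound (B : Growth) (σw : ℝ≥0) (cPE pPE : ℝ) (t : ℕ) (δ : ℝ) (x₀ : M.𝕏) : ℝ :=
  1 / √(cPE * pPE / 4 * ((t : ℝ) - 1) + M.γ) *
    (√M.γ * frobNorm M.θstar +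
      σw * √(2 * n * (Real.log (3 * n / δ)
        + (d : ℝ) / 2 * Real.log (M.βmax B σw t (δ / 3) x₀ * M.γ⁻¹))))

/-- The contained time bound; the supremum is taken in `ℕ ∪ {∞}`, and is `0` if the set of times
is empty. -/
def Tcontained (B : Growth) (σw : ℝ≥0) (𝒳 : Set M.𝕏) (δ : ℝ) (x₀ : M.𝕏) : ℕ∞ :=
  ⨆ T ∈ {T : ℕ | 1 ≤ T ∧
    ∀ x : M.𝕏, ‖(x : Vec n)‖₊ ≤ M.xbar B σw T (δ / 3) x₀ → x ∈ 𝒳}, (T : ℕ∞)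

/-- The burn-in time bound; the infimum is taken in `ℕ ∪ {∞}`. -/
def Tburnin (B : Growth) (σw : ℝ≥0) (cPE pPE : ℝ) (δ : ℝ) (x₀ : M.𝕏) : ℕ∞ :=
  ⨅ T ∈ {T : ℕ | 1 ≤ T ∧ ∀ t : ℕ, T ≤ t →
    2 / ((1 - Real.log 2) * pPE) *
        (d * Real.log (1 + 16 * (∑ i ∈ Finset.Icc 1 t, (M.zbar B σw i (δ / 3) x₀ : ℝ) ^ 2)
              / (cPE * pPE * ((t : ℝ) - 1)))
          + Real.log (Real.pi ^ 2 * ((t : ℝ) - T + 1) ^ 2 / (2 * δ))) + 1 ≤ (t : ℝ)}, (T : ℕ∞)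

/-- The convergence time bound; the infimum is taken in `ℕ ∪ {∞}`. -/
def Tconverge (B : Growth) (σw : ℝ≥0) (cPE pPE : ℝ) (ϑbar : ℝ≥0) (δ : ℝ) (x₀ : M.𝕏) : ℕ∞ :=
  max (M.Tburnin B σw cPE pPE δ x₀)
    (⨅ T ∈ {T : ℕ | 1 ≤ T ∧ ∀ t : ℕ, T ≤ t →
      M.errBound B σw cPE pPE t δ x₀ ≤ ϑbar}, (T : ℕ∞))

end System

end AdaptiveControl

end

namespace AdaptiveControl

/-! ### Probabilistic tools -/

/-! The loop is circular: small estimation errors keep the state in the invariant set, states in the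
invariant set are excited, and excitation keeps the errors small. The circle is cut by the events
`cert … r`, decreasing in `r`, which say that the noise obeys its bound and that all relevant
estimates from time `Tc` on are accurate. On `cert … r` the state `X r` lies in the invariant set,
deterministically (`cert_mem`): up to time `Tc + 1` by the a priori growth bound and the containment
hypothesis, later by robust invariance.

Outside three events of probability at most one third of the budget each, every `cert … r` holds
(`measure_not_cert`). (1) The noise exceeds `wbar` at some time: sub-Gaussian tails and a
Basel-weighted union bound. (2) The noise sum, weighted by the inverse Gram matrix, is too large at
some time: `√(γ^d / det G) * exp (selfNorm / (2 σ²))` is a supermartingale, to which Ville's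
inequality applies. (3) A trajectory certified up to time `k` has too little energy in some
direction: in a fixed direction, a weight halved at each excited time has expectation at most `exp
(-p k / 2)` on certified trajectories, and a Chernoff bound passes to all directions through a net
of the sphere. Off these events an induction on `r` closes: certification gives excitation, hence a
lower bound on the Gram matrix, hence `errBound`, which is at most `ϑbar` from `Tc` on. The
sub-exponential growth assumptions make the logarithms in the burn-in condition and the error bound
`o(t)`, so both times are finite.

Finally let `v t` be the expectation of the Lyapunov function at `X t` restricted to `cert … t`.
Convexity of the lower bound of `α₃ ∘ α₂⁻¹` turns the drift into `v (t + 1) ≤ (1 - a) v t + D` for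
`t ≥ Tc + 1`, with `a` and `D` independent of the initial state. So `v t ≤ D / a + 1` eventually,
and Markov's inequality bounds the state by a constant depending on `δ` but not on `x₀`. At the
finitely many earlier times the growth bound serves as `η`. Half of `δ` pays for certification and
half for Markov. -/

/-- The Gaussian integral `∫ exp (-(g - μ)² / (2 v)) dg = √(2 π v)`. -/
theorem lintegral_exp_neg_sq_div (μ : ℝ) {v : ℝ} (hv : 0 < v) :
    ∫⁻ g : ℝ, ENNReal.ofReal (Real.exp (-(g - μ) ^ 2 / (2 * v)))
      = ENNReal.ofReal √(2 * Real.pi * v) := by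
  have h := lintegral_gaussianPDFReal_eq_one μ (v := v.toNNReal) (by simpa using hv)
  have hs : 0 < √(2 * Real.pi * v) := by positivity
  have h2 : ∀ g : ℝ, ENNReal.ofReal (Real.exp (-(g - μ) ^ 2 / (2 * v)))
      = ENNReal.ofReal √(2 * Real.pi * v)
        * ENNReal.ofReal (gaussianPDFReal μ v.toNNReal g) := by
    intro g
    rw [← ENNReal.ofReal_mul hs.le, gaussianPDFReal, Real.coe_toNNReal _ hv.le, ← mul_assoc,
      mul_inv_cancel₀ hs.ne', one_mul]
  simp_rw [h2]
  rw [lintegral_const_mul _ (measurable_gaussianPDFReal _ _).ennreal_ofReal, h, mul_one]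

/-- One step of the method of mixtures: the exponential quadratic functional of a sub-Gaussian
variable is dominated by its Gaussian value. -/
theorem lintegral_exp_quadratic_le {Ω : Type*} [MeasurableSpace Ω] {P : Measure Ω}
    [IsProbabilityMeasure P] {Y : Ω → ℝ} {σ : ℝ≥0} (hσ : σ ≠ 0) (hY : Measurable Y)
    (h : HasSubgaussianMGF Y (σ ^ 2) P) (m : ℝ) {u : ℝ} (hu : 0 ≤ u) :
    ∫⁻ ω, ENNReal.ofReal (Real.exp ((2 * Y ω * m + Y ω ^ 2 * u - m ^ 2)
        / (2 * (σ : ℝ) ^ 2 * (1 + u)))) ∂P ≤ ENNReal.ofReal √(1 + u) := by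
  have hσ' : (0 : ℝ) < σ := by positivity
  obtain ⟨s, hs⟩ : ∃ s : ℝ, s = σ := ⟨_, rfl⟩
  rw [← hs] at hσ' ⊢
  have h1u : 0 < 1 + u := by linarith
  -- With these choices the exponent is `a Y + β² Y² / (2 s²)` plus a constant; the quadratic part
  -- is linearised as a Gaussian average of `exp (β g Y / s)`, so that the bound on the moment
  -- generating function applies.
  set β := √(u / (1 + u)) with hβ
  have hβ2 : β ^ 2 = u / (1 + u) := Real.sq_sqrt (by positivity)
  set a := m / (s ^ 2 * (1 + u)) with ha
  set F : ℝ → Ω → ℝ≥0∞ := fun g ω => ENNReal.ofReal (Real.exp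
    (-g ^ 2 / 2 + (a + β / s * g) * Y ω - m ^ 2 / (2 * s ^ 2 * (1 + u)))) with hF
  have hpi : ENNReal.ofReal √(2 * Real.pi) ≠ 0 := by
    simp only [ne_eq, ENNReal.ofReal_eq_zero, not_le]; positivity
  have hkey : ∀ ω, ENNReal.ofReal √(2 * Real.pi) * ENNReal.ofReal (Real.exp
      ((2 * Y ω * m + Y ω ^ 2 * u - m ^ 2) / (2 * s ^ 2 * (1 + u)))) = ∫⁻ g, F g ω := by
    intro ω
    have := lintegral_exp_neg_sq_div (β / s * Y ω) one_pos
    rw [mul_one (2 * Real.pi)] at this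
    rw [← this, ← lintegral_mul_const _ (by fun_prop)]
    refine lintegral_congr fun g => ?_
    rw [hF, ← ENNReal.ofReal_mul (Real.exp_pos _).le, ← Real.exp_add]
    congr 2
    have e1 : -(g - β / s * Y ω) ^ 2 / (2 * 1)
        = -g ^ 2 / 2 + β / s * g * Y ω - β ^ 2 / s ^ 2 * Y ω ^ 2 / 2 := by
      field_simp; ring
    rw [e1, hβ2, ha]
    field_simp
    ring
  have hmeas : Measurable (Function.uncurry F) := by
    refine ENNReal.measurable_ofReal.comp (Real.measurable_exp.comp ?_)
    have h2 : Measurable fun p : ℝ × Ω => Y p.2 := hY.comp measurable_snd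
    have h1 : Measurable fun p : ℝ × Ω => p.1 := measurable_fst
    fun_prop
  have hswap : ENNReal.ofReal √(2 * Real.pi) * ∫⁻ ω, ENNReal.ofReal (Real.exp
      ((2 * Y ω * m + Y ω ^ 2 * u - m ^ 2) / (2 * s ^ 2 * (1 + u)))) ∂P
      = ∫⁻ g, ∫⁻ ω, F g ω ∂P := by
    rw [← lintegral_const_mul _ (by fun_prop)]
    simp_rw [hkey]
    exact lintegral_lintegral_swap (hmeas.comp measurable_swap).aemeasurable
  -- After the sub-Gaussian bound the exponent is a perfect square in `g`, of variance `1 + u`; its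
  -- integral over `g` produces the factor `√(1 + u)`.
  have hin : ∀ g, ∫⁻ ω, F g ω ∂P ≤ ENNReal.ofReal (Real.exp
      (-(g - m / s * β) ^ 2 / (2 * (1 + u)))) := by
    intro g
    have hfac : ∀ ω, F g ω = ENNReal.ofReal (Real.exp
        (-g ^ 2 / 2 - m ^ 2 / (2 * s ^ 2 * (1 + u))))
        * ENNReal.ofReal (Real.exp ((a + β / s * g) * Y ω)) := by
      intro ω
      rw [← ENNReal.ofReal_mul (Real.exp_pos _).le, ← Real.exp_add]
      simp only [hF]
      congr 2
      ring
    simp_rw [hfac]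
    rw [lintegral_const_mul _ (by fun_prop),
      ← ofReal_integral_eq_lintegral_ofReal (h.integrable_exp_mul _)
        (ae_of_all _ fun _ => (Real.exp_pos _).le),
      ← ENNReal.ofReal_mul (Real.exp_pos _).le]
    refine ENNReal.ofReal_le_ofReal ?_
    have hm := h.mgf_le (a + β / s * g)
    rw [mgf] at hm
    refine (mul_le_mul_of_nonneg_left hm (Real.exp_pos _).le).trans (le_of_eq ?_)
    rw [← Real.exp_add]
    congr 1
    have hsq : (((σ ^ 2 : ℝ≥0) : ℝ)) = s ^ 2 := by push_cast; rw [hs]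
    rw [hsq]
    have e2 : s ^ 2 * (a + β / s * g) ^ 2 / 2
        = s ^ 2 * a ^ 2 / 2 + s * a * β * g + β ^ 2 * g ^ 2 / 2 := by
      field_simp; ring
    have e3 : -(g - m / s * β) ^ 2 / (2 * (1 + u))
        = (-g ^ 2 + 2 * g * m / s * β - m ^ 2 / s ^ 2 * β ^ 2) / (2 * (1 + u)) := by
      field_simp; ring
    rw [e2, e3, hβ2, ha]
    field_simp
    ring
  have hfin : ENNReal.ofReal √(2 * Real.pi) * ∫⁻ ω, ENNReal.ofReal (Real.exp
      ((2 * Y ω * m + Y ω ^ 2 * u - m ^ 2) / (2 * s ^ 2 * (1 + u)))) ∂P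
      ≤ ENNReal.ofReal √(2 * Real.pi) * ENNReal.ofReal √(1 + u) := by
    rw [hswap]
    refine (lintegral_mono hin).trans (le_of_eq ?_)
    rw [lintegral_exp_neg_sq_div _ h1u, ← ENNReal.ofReal_mul (Real.sqrt_nonneg _),
      ← Real.sqrt_mul (by positivity)]
  exact (ENNReal.mul_le_mul_iff_right hpi ENNReal.ofReal_ne_top).1 hfin

/-- Ville's maximal inequality for nonnegative supermartingales. -/
theorem ville_inequality {Ω : Type*} {m0 : MeasurableSpace Ω} {P : Measure Ω}
    {ℱ : ℕ → MeasurableSpace Ω} (hmono : Monotone ℱ) (hle : ∀ t, ℱ t ≤ m0)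
    {M : ℕ → Ω → ℝ≥0∞} (hM : ∀ t, Measurable[ℱ t] (M t))
    (hstep : ∀ t, ∀ A, MeasurableSet[ℱ t] A → ∫⁻ ω in A, M (t + 1) ω ∂P ≤ ∫⁻ ω in A, M t ω ∂P)
    (c : ℝ≥0∞) : c * P {ω | ∃ t, c ≤ M t ω} ≤ ∫⁻ ω, M 0 ω ∂P := by
  set H : ℕ → Set Ω := fun k => {ω | ∃ t ≤ k, c ≤ M t ω} with hH
  have hsing : ∀ t, MeasurableSet[ℱ t] {ω | c ≤ M t ω} := fun t =>
    hM t measurableSet_Ici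
  have hHm : ∀ k, MeasurableSet[ℱ k] (H k) := by
    intro k
    have : H k = ⋃ t ∈ Set.Iic k, {ω | c ≤ M t ω} := by
      ext ω; simp [hH]
    rw [this]
    exact MeasurableSet.biUnion (Set.to_countable _) fun t ht => hmono ht _ (hsing t)
  have hHm' : ∀ k, MeasurableSet (H k) := fun k => hle k _ (hHm k)
  -- The left side is a lower bound for the expectation of the process stopped at its first passage
  -- above `c`.
  have hmain : ∀ k, c * P (H k) + ∫⁻ ω in (H k)ᶜ, M k ω ∂P ≤ ∫⁻ ω, M 0 ω ∂P := by
    intro k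
    induction k with
    | zero =>
      rw [← lintegral_add_compl (μ := P) (M 0) (hHm' 0)]
      refine add_le_add ?_ le_rfl
      rw [← setLIntegral_const]
      exact setLIntegral_mono' (hHm' 0) fun ω hω => by
        obtain ⟨t, ht, h⟩ := hω
        simpa [Nat.le_zero.1 ht] using h
    | succ k ih =>
      refine le_trans ?_ ih
      have hsub : H k ⊆ H (k + 1) := fun ω ⟨t, ht, h⟩ => ⟨t, ht.trans k.le_succ, h⟩
      set N := H (k + 1) \ H k with hN
      have hNm : MeasurableSet N := (hHm' _).diff (hHm' _)
      have hU : (H k)ᶜ = N ∪ (H (k + 1))ᶜ := by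
        ext ω
        simp only [hN, Set.mem_compl_iff, Set.mem_union, Set.mem_sdiff]
        constructor
        · intro h; by_cases h2 : ω ∈ H (k + 1) <;> simp [h, h2]
        · rintro (⟨_, h⟩ | h)
          · exact h
          · exact fun h2 => h (hsub h2)
      have hdisj : Disjoint N (H (k + 1))ᶜ :=
        Set.disjoint_left.2 fun ω h h2 => h2 h.1
      have hPH : P (H (k + 1)) = P (H k) + P N := by
        rw [← measure_union Set.disjoint_sdiff_right hNm, Set.union_sdiff_cancel hsub]
      rw [hPH, mul_add, add_assoc]
      gcongr
      refine le_trans ?_ (hstep k _ (hHm k).compl)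
      rw [hU, lintegral_union (hHm' _).compl hdisj]
      gcongr
      rw [← setLIntegral_const]
      refine setLIntegral_mono' hNm fun ω hω => ?_
      obtain ⟨⟨t, ht, h⟩, h2⟩ := hω
      rcases Nat.lt_or_ge k t with h3 | h3
      · have : t = k + 1 := by omega
        exact this ▸ h
      · exact absurd ⟨t, h3, h⟩ h2
  have hUn : {ω | ∃ t, c ≤ M t ω} = ⋃ k, H k := by
    ext ω
    simp only [hH, Set.mem_ofPred_eq, Set.mem_iUnion]
    exact ⟨fun ⟨t, h⟩ => ⟨t, t, le_rfl, h⟩, fun ⟨_, t, _, h⟩ => ⟨t, h⟩⟩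
  have hHmono : Monotone H := fun i j hij ω ⟨t, ht, h⟩ => ⟨t, ht.trans hij, h⟩
  rw [hUn, hHmono.measure_iUnion, ENNReal.mul_iSup]
  exact iSup_le fun k => le_self_add.trans (hmain k)

/-- Integrating a function of two independent variables. -/
theorem lintegral_indepFun {Ω A Z : Type*} [MeasurableSpace Ω] [MeasurableSpace A]
    [MeasurableSpace Z] {P : Measure Ω} [IsProbabilityMeasure P] {a : Ω → A} {z : Ω → Z}
    (ha : Measurable a) (hz : Measurable z) (h : IndepFun a z P) {H : A × Z → ℝ≥0∞}
    (hH : Measurable H) :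
    ∫⁻ ω, H (a ω, z ω) ∂P = ∫⁻ ω, ∫⁻ y, H (a ω, y) ∂(P.map z) ∂P := by
  have := Measure.isProbabilityMeasure_map (μ := P) hz.aemeasurable
  have := Measure.isProbabilityMeasure_map (μ := P) ha.aemeasurable
  have h1 := (indepFun_iff_map_prod_eq_prod_map_map ha.aemeasurable hz.aemeasurable).1 h
  rw [← lintegral_map (f := H) (g := fun ω => (a ω, z ω)) hH (ha.prodMk hz), h1,
    lintegral_prod _ hH.aemeasurable, lintegral_map _ ha]
  exact hH.lintegral_prod_right'

theorem comap_prodMk_eq_generateFrom {Ω γ γ' : Type*} [MeasurableSpace γ] [MeasurableSpace γ']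
    (C : Ω → γ) (D : Ω → γ') :
    MeasurableSpace.comap (fun ω => (C ω, D ω)) inferInstance = MeasurableSpace.generateFrom
      {u | ∃ s t, MeasurableSet s ∧ MeasurableSet t ∧ C ⁻¹' s ∩ D ⁻¹' t = u} := by
  rw [← generateFrom_prod, MeasurableSpace.comap_generateFrom]
  congr 1
  ext u
  simp only [Set.mem_image, Set.mem_image2, Set.mem_ofPred_eq]
  constructor
  · rintro ⟨_, ⟨s, hs, t, ht, rfl⟩, rfl⟩
    exact ⟨s, t, hs, ht, rfl⟩
  · rintro ⟨s, t, hs, ht, rfl⟩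
    exact ⟨s ×ˢ t, ⟨s, hs, t, ht, rfl⟩, rfl⟩

theorem isPiSystem_preimage_inter {Ω γ γ' : Type*} [MeasurableSpace γ] [MeasurableSpace γ']
    (C : Ω → γ) (D : Ω → γ') :
    IsPiSystem {u | ∃ s t, MeasurableSet s ∧ MeasurableSet t ∧ C ⁻¹' s ∩ D ⁻¹' t = u} := by
  rintro _ ⟨s, t, hs, ht, rfl⟩ _ ⟨s', t', hs', ht', rfl⟩ _
  refine ⟨s ∩ s', t ∩ t', hs.inter hs', ht.inter ht', ?_⟩
  ext ω; simp only [Set.mem_inter_iff, Set.mem_preimage]; tauto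

/-- If `(A, A')` is independent of `(B, B')`, and in each pair the components are independent, then
`(A, B)` is independent of `(A', B')`. -/
theorem IndepFun.prodMk_swap {Ω α α' β β' : Type*} [MeasurableSpace Ω] [MeasurableSpace α]
    [MeasurableSpace α'] [MeasurableSpace β] [MeasurableSpace β'] {P : Measure Ω}
    [IsProbabilityMeasure P] {A : Ω → α} {A' : Ω → α'} {B : Ω → β} {B' : Ω → β'}
    (hA : Measurable A) (hA' : Measurable A') (hB : Measurable B) (hB' : Measurable B')
    (h : IndepFun (fun ω => (A ω, A' ω)) (fun ω => (B ω, B' ω)) P)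
    (hAA : IndepFun A A' P) (hBB : IndepFun B B' P) :
    IndepFun (fun ω => (A ω, B ω)) (fun ω => (A' ω, B' ω)) P := by
  -- The joint law of the four variables factorises on rectangles, which form a generating π-system.
  have key : ∀ s t s' t', MeasurableSet s → MeasurableSet t → MeasurableSet s' →
      MeasurableSet t' →
      P (A ⁻¹' s ∩ A' ⁻¹' s' ∩ (B ⁻¹' t ∩ B' ⁻¹' t'))
        = P (A ⁻¹' s) * P (A' ⁻¹' s') * (P (B ⁻¹' t) * P (B' ⁻¹' t')) := by
    intro s t s' t' hs ht hs' ht'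
    have := h.measure_inter_preimage_eq_mul _ _ (hs.prod hs') (ht.prod ht')
    rw [← hAA.measure_inter_preimage_eq_mul _ _ hs hs',
      ← hBB.measure_inter_preimage_eq_mul _ _ ht ht']
    exact this
  refine IndepSets.indep (hA.prodMk hB).comap_le (hA'.prodMk hB').comap_le
    (isPiSystem_preimage_inter A B) (isPiSystem_preimage_inter A' B')
    (comap_prodMk_eq_generateFrom A B) (comap_prodMk_eq_generateFrom A' B') ?_
  rw [IndepSets_iff]
  rintro _ _ ⟨s, t, hs, ht, rfl⟩ ⟨s', t', hs', ht', rfl⟩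
  have h1 := key s t s' t' hs ht hs' ht'
  have h2 := key s t Set.univ Set.univ hs ht .univ .univ
  have h3 := key Set.univ Set.univ s' t' .univ .univ hs' ht'
  simp only [Set.preimage_univ, Set.inter_univ, Set.univ_inter, measure_univ, mul_one,
    one_mul] at h2 h3
  rw [h2, h3, show A ⁻¹' s ∩ B ⁻¹' t ∩ (A' ⁻¹' s' ∩ B' ⁻¹' t')
    = A ⁻¹' s ∩ A' ⁻¹' s' ∩ (B ⁻¹' t ∩ B' ⁻¹' t') by
      ext ω; simp only [Set.mem_inter_iff]; tauto, h1]
  ring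

/-! ### A net of the unit sphere -/

/-- A net of the unit sphere, with the volumetric bound on its cardinality. -/
theorem exists_sphere_net {d : ℕ} (hd : 0 < d) {R : ℝ} (hR : 0 ≤ R) :
    ∃ N : Finset (Vec d), (N.card : ℝ) ≤ (1 + R) ^ d ∧ (∀ z ∈ N, ‖z‖ = 1) ∧
      ∀ ζ : Vec d, ‖ζ‖ = 1 → ∃ z ∈ N, R * ‖ζ - z‖ ≤ 2 := by
  rcases hR.eq_or_lt with rfl | hR
  · refine ⟨{EuclideanSpace.single ⟨0, hd⟩ 1}, by simp, by simp, ?_⟩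
    intro ζ _
    exact ⟨_, Finset.mem_singleton_self _, by simp⟩
  -- Balls of radius `1 / R` about `2 / R`-separated unit vectors are disjoint and lie in a ball of
  -- radius `1 + 1 / R`; the ratio of the radii is `1 + R`.
  set δ : ℝ := 1 / R with hδ
  have hδ0 : 0 < δ := by positivity
  let μ : Measure (Vec d) := volume
  have hcard : ∀ s : Finset (Vec d), (∀ c ∈ s, ‖c‖ = 1) →
      (∀ c ∈ s, ∀ c' ∈ s, c ≠ c' → 2 * δ ≤ ‖c - c'‖) → (s.card : ℝ) ≤ (1 + R) ^ d := by
    intro s hs h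
    set A := ⋃ c ∈ s, Metric.ball (c : Vec d) δ with hA
    have D : Set.Pairwise (s : Set (Vec d)) (Function.onFun Disjoint fun c => Metric.ball c δ) := by
      rintro c hc c' hc' hcc
      apply Metric.ball_disjoint_ball
      rw [dist_eq_norm]
      linarith [h c hc c' hc' hcc]
    have hρ : 0 < δ + 1 := by linarith
    have A_subset : A ⊆ Metric.ball (0 : Vec d) (δ + 1) := by
      refine Set.iUnion₂_subset fun x hx => ?_
      apply Metric.ball_subset_ball'
      rw [dist_zero_right, hs x hx]
    have I : (s.card : ℝ≥0∞) * ENNReal.ofReal (δ ^ Module.finrank ℝ (Vec d)) * μ (Metric.ball 0 1)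
        ≤ ENNReal.ofReal ((δ + 1) ^ Module.finrank ℝ (Vec d)) * μ (Metric.ball 0 1) :=
      calc
        _ = μ A := by
          rw [hA, measure_biUnion_finset D fun c _ => measurableSet_ball]
          simp only [μ.addHaar_ball_of_pos _ hδ0]
          simp only [Finset.sum_const, nsmul_eq_mul, mul_assoc]
        _ ≤ μ (Metric.ball (0 : Vec d) (δ + 1)) := measure_mono A_subset
        _ = _ := by simp only [μ.addHaar_ball_of_pos _ hρ]
    have J := (ENNReal.mul_le_mul_iff_left (Metric.measure_ball_pos _ _ zero_lt_one).ne'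
      measure_ball_lt_top.ne).1 I
    have K := ENNReal.toReal_le_of_le_ofReal (pow_nonneg hρ.le _) J
    rw [ENNReal.toReal_mul, ENNReal.toReal_natCast, ENNReal.toReal_ofReal (by positivity),
      finrank_euclideanSpace_fin] at K
    have e : δ + 1 = δ * (1 + R) := by rw [hδ]; field_simp
    rw [e, mul_pow, mul_comm] at K
    exact le_of_mul_le_mul_left K (by positivity)
  -- A separated set of maximal cardinality is a net: a unit vector far from all its points could be
  -- added.
  obtain ⟨N, ⟨hN1, hN2⟩, hmax⟩ : ∃ N : Finset (Vec d), ((∀ c ∈ N, ‖c‖ = 1) ∧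
      (∀ c ∈ N, ∀ c' ∈ N, c ≠ c' → 2 * δ ≤ ‖c - c'‖)) ∧
      ∀ N' : Finset (Vec d), (∀ c ∈ N', ‖c‖ = 1) →
      (∀ c ∈ N', ∀ c' ∈ N', c ≠ c' → 2 * δ ≤ ‖c - c'‖) → N'.card ≤ N.card := by
    set S : Set ℕ := {k | ∃ N : Finset (Vec d), ((∀ c ∈ N, ‖c‖ = 1) ∧
      (∀ c ∈ N, ∀ c' ∈ N, c ≠ c' → 2 * δ ≤ ‖c - c'‖)) ∧ N.card = k} with hS
    have hne : S.Nonempty := ⟨0, ∅, by simp⟩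
    have hbdd : BddAbove S := by
      refine ⟨⌊(1 + R) ^ d⌋₊, ?_⟩
      rintro k ⟨N, ⟨h1, h2⟩, rfl⟩
      exact Nat.le_floor (hcard N h1 h2)
    obtain ⟨N, hN, hk⟩ := Nat.sSup_mem hne hbdd
    exact ⟨N, hN, fun N' h1 h2 => hk ▸ le_csSup hbdd ⟨N', ⟨h1, h2⟩, rfl⟩⟩
  refine ⟨N, hcard N hN1 hN2, hN1, ?_⟩
  intro ζ hζ
  by_contra! hcon
  have hfar : ∀ z ∈ N, 2 * δ < ‖ζ - z‖ := by
    intro z hz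
    have := hcon z hz
    rw [hδ, mul_one_div, div_lt_iff₀ hR]
    linarith
  have hnot : ζ ∉ N := fun h => by
    have := hfar ζ h
    simp at this
    linarith
  classical
  have := hmax (insert ζ N) (by simpa [hζ] using hN1) (by
    intro c hc c' hc' hne
    rw [Finset.mem_insert] at hc hc'
    rcases hc with rfl | hc <;> rcases hc' with rfl | hc'
    · exact absurd rfl hne
    · exact (hfar _ hc').le
    · rw [norm_sub_rev]; exact (hfar _ hc).le
    · exact hN2 c hc c' hc' hne)
  rw [Finset.card_insert_of_notMem hnot] at this
  omega

/-! ### Regularised least squares -/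

section LeastSquares

open Matrix

variable {d n : ℕ}

/-- The regularised Gram matrix `γ I + ∑_{s < t} ψ_s ψ_sᵀ`. -/
def gram (γ : ℝ) (ψ : ℕ → Fin d → ℝ) (t : ℕ) : Mat d d :=
  γ • (1 : Mat d d) + ∑ s ∈ Finset.range t, vecMulVec (ψ s) (ψ s)

/-- The sum `∑_{s < t} η_s ψ_s`. -/
def noiseSum (ψ : ℕ → Fin d → ℝ) (η : ℕ → ℝ) (t : ℕ) : Fin d → ℝ :=
  ∑ s ∈ Finset.range t, η s • ψ s

/-- The squared norm of `noiseSum` weighted by the inverse Gram matrix. -/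
noncomputable def selfNorm (γ : ℝ) (ψ : ℕ → Fin d → ℝ) (η : ℕ → ℝ) (t : ℕ) : ℝ :=
  noiseSum ψ η t ⬝ᵥ ((gram γ ψ t)⁻¹ *ᵥ noiseSum ψ η t)

theorem gram_succ (γ : ℝ) (ψ : ℕ → Fin d → ℝ) (t : ℕ) :
    gram γ ψ (t + 1) = gram γ ψ t + vecMulVec (ψ t) (ψ t) := by
  rw [gram, gram, Finset.sum_range_succ, add_assoc]

theorem noiseSum_succ (ψ : ℕ → Fin d → ℝ) (η : ℕ → ℝ) (t : ℕ) :
    noiseSum ψ η (t + 1) = noiseSum ψ η t + η t • ψ t := by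
  rw [noiseSum, noiseSum, Finset.sum_range_succ]

theorem vecMulVec_self_mulVec (a v : Fin d → ℝ) : vecMulVec a a *ᵥ v = (a ⬝ᵥ v) • a := by
  rw [vecMulVec_mulVec, op_smul_eq_smul]

theorem gram_mulVec (γ : ℝ) (ψ : ℕ → Fin d → ℝ) (t : ℕ) (v : Fin d → ℝ) :
    gram γ ψ t *ᵥ v = γ • v + ∑ s ∈ Finset.range t, (ψ s ⬝ᵥ v) • ψ s := by
  rw [gram, add_mulVec, sum_mulVec, smul_mulVec, one_mulVec]
  simp_rw [vecMulVec_self_mulVec]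

theorem dotProduct_gram_mulVec (γ : ℝ) (ψ : ℕ → Fin d → ℝ) (t : ℕ) (v w : Fin d → ℝ) :
    v ⬝ᵥ (gram γ ψ t *ᵥ w)
      = γ * (v ⬝ᵥ w) + ∑ s ∈ Finset.range t, (ψ s ⬝ᵥ v) * (ψ s ⬝ᵥ w) := by
  rw [gram_mulVec, dotProduct_add, dotProduct_smul, dotProduct_sum, smul_eq_mul]
  congr 1
  refine Finset.sum_congr rfl fun s _ => ?_
  rw [dotProduct_smul, smul_eq_mul, dotProduct_comm v, mul_comm]

theorem dotProduct_gram_comm (γ : ℝ) (ψ : ℕ → Fin d → ℝ) (t : ℕ) (v w : Fin d → ℝ) :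
    v ⬝ᵥ (gram γ ψ t *ᵥ w) = w ⬝ᵥ (gram γ ψ t *ᵥ v) := by
  rw [dotProduct_gram_mulVec, dotProduct_gram_mulVec, dotProduct_comm v w]
  simp_rw [mul_comm]

theorem gram_isHermitian (γ : ℝ) (ψ : ℕ → Fin d → ℝ) (t : ℕ) : (gram γ ψ t).IsHermitian := by
  ext i j
  simp [gram, Matrix.sum_apply, vecMulVec_apply, Matrix.one_apply, mul_comm, eq_comm]

theorem dotProduct_self_nonneg' (v : Fin d → ℝ) : 0 ≤ v ⬝ᵥ v :=
  Finset.sum_nonneg fun _ _ => mul_self_nonneg _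

theorem le_dotProduct_gram (γ : ℝ) (ψ : ℕ → Fin d → ℝ) (t : ℕ) (v : Fin d → ℝ) :
    γ * (v ⬝ᵥ v) ≤ v ⬝ᵥ (gram γ ψ t *ᵥ v) := by
  rw [dotProduct_gram_mulVec]
  exact le_add_of_nonneg_right (Finset.sum_nonneg fun _ _ => mul_self_nonneg _)

theorem gram_posDef {γ : ℝ} (hγ : 0 < γ) (ψ : ℕ → Fin d → ℝ) (t : ℕ) : (gram γ ψ t).PosDef := by
  refine PosDef.of_dotProduct_mulVec_pos (gram_isHermitian γ ψ t) fun x hx => ?_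
  rw [star_trivial]
  refine lt_of_lt_of_le (mul_pos hγ ?_) (le_dotProduct_gram γ ψ t x)
  exact lt_of_le_of_ne (dotProduct_self_nonneg' x)
    fun h => hx (dotProduct_self_eq_zero.1 h.symm)

theorem gram_det_pos {γ : ℝ} (hγ : 0 < γ) (ψ : ℕ → Fin d → ℝ) (t : ℕ) :
    0 < (gram γ ψ t).det := (gram_posDef hγ ψ t).det_pos

theorem gram_mulVec_inv {γ : ℝ} (hγ : 0 < γ) (ψ : ℕ → Fin d → ℝ) (t : ℕ) (v : Fin d → ℝ) :
    gram γ ψ t *ᵥ ((gram γ ψ t)⁻¹ *ᵥ v) = v := by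
  rw [mulVec_mulVec, mul_nonsing_inv _ (gram_det_pos hγ ψ t).ne'.isUnit, one_mulVec]

theorem eq_gram_inv_mulVec {γ : ℝ} (hγ : 0 < γ) (ψ : ℕ → Fin d → ℝ) (t : ℕ) {v w : Fin d → ℝ}
    (h : gram γ ψ t *ᵥ v = w) : v = (gram γ ψ t)⁻¹ *ᵥ w := by
  rw [← h, mulVec_mulVec, nonsing_inv_mul _ (gram_det_pos hγ ψ t).ne'.isUnit, one_mulVec]

theorem gram_inv_comm {γ : ℝ} (hγ : 0 < γ) (ψ : ℕ → Fin d → ℝ) (t : ℕ) (v w : Fin d → ℝ) :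
    v ⬝ᵥ ((gram γ ψ t)⁻¹ *ᵥ w) = w ⬝ᵥ ((gram γ ψ t)⁻¹ *ᵥ v) := by
  have := dotProduct_gram_comm γ ψ t ((gram γ ψ t)⁻¹ *ᵥ w) ((gram γ ψ t)⁻¹ *ᵥ v)
  rw [gram_mulVec_inv hγ, gram_mulVec_inv hγ] at this
  rw [dotProduct_comm, this, dotProduct_comm]

theorem gram_inv_nonneg {γ : ℝ} (hγ : 0 < γ) (ψ : ℕ → Fin d → ℝ) (t : ℕ) (v : Fin d → ℝ) :
    0 ≤ v ⬝ᵥ ((gram γ ψ t)⁻¹ *ᵥ v) := by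
  have := le_dotProduct_gram γ ψ t ((gram γ ψ t)⁻¹ *ᵥ v)
  rw [gram_mulVec_inv hγ, dotProduct_comm _ v] at this
  exact (mul_nonneg hγ.le (dotProduct_self_nonneg' _)).trans this

theorem det_gram_zero (γ : ℝ) (ψ : ℕ → Fin d → ℝ) : (gram γ ψ 0).det = γ ^ d := by
  simp [gram]

/-- The matrix determinant lemma. The factor `1 + u` cancels the Gaussian value `√(1 + u)` of
`lintegral_exp_quadratic_le`, which is why the mixture can be built one step at a time. -/
theorem det_gram_succ {γ : ℝ} (hγ : 0 < γ) (ψ : ℕ → Fin d → ℝ) (t : ℕ) :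
    (gram γ ψ (t + 1)).det
      = (gram γ ψ t).det * (1 + ψ t ⬝ᵥ ((gram γ ψ t)⁻¹ *ᵥ ψ t)) := by
  rw [gram_succ, vecMulVec_eq Unit,
    det_add_replicateCol_mul_replicateRow (gram_det_pos hγ ψ t).ne'.isUnit]
  congr 1
  rw [dotProduct_mulVec]
  simp [Matrix.det_unique, Matrix.mul_apply, dotProduct, vecMul]

theorem selfNorm_zero (γ : ℝ) (ψ : ℕ → Fin d → ℝ) (η : ℕ → ℝ) : selfNorm γ ψ η 0 = 0 := by
  simp [selfNorm, noiseSum]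

/-- A rank-one update in the manner of Sherman and Morrison. The increment is exactly the quadratic
functional estimated in `lintegral_exp_quadratic_le`. -/
theorem selfNorm_succ {γ : ℝ} (hγ : 0 < γ) (ψ : ℕ → Fin d → ℝ) (η : ℕ → ℝ) (t : ℕ)
    {u m : ℝ} (hu : u = ψ t ⬝ᵥ ((gram γ ψ t)⁻¹ *ᵥ ψ t))
    (hm : m = ψ t ⬝ᵥ ((gram γ ψ t)⁻¹ *ᵥ noiseSum ψ η t)) :
    selfNorm γ ψ η (t + 1)
      = selfNorm γ ψ η t + (2 * η t * m + η t ^ 2 * u - m ^ 2) / (1 + u) := by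
  have hu0 : 0 ≤ u := hu ▸ gram_inv_nonneg hγ ψ t (ψ t)
  have hu1 : (1 + u) ≠ 0 := by positivity
  set h := (gram γ ψ t)⁻¹ *ᵥ noiseSum ψ η t with hh
  set k := (gram γ ψ t)⁻¹ *ᵥ ψ t with hk
  -- The solution of the updated system is sought as `h + c • k`; the coefficient of `ψ t` must
  -- satisfy `m + c (1 + u) = η t`.
  set c := (η t - m) / (1 + u) with hc
  have hsol : gram γ ψ (t + 1) *ᵥ (h + c • k) = noiseSum ψ η (t + 1) := by
    rw [gram_succ, add_mulVec, vecMulVec_self_mulVec, mulVec_add, mulVec_smul, hh, hk,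
      gram_mulVec_inv hγ, gram_mulVec_inv hγ, ← hh, ← hk, dotProduct_add, dotProduct_smul,
      ← hm, ← hu, noiseSum_succ, add_assoc, ← add_smul]
    congr 2
    rw [hc, smul_eq_mul]
    field_simp
    ring
  have hk2 : noiseSum ψ η t ⬝ᵥ k = m := by rw [hk, gram_inv_comm hγ, ← hh, hm]
  rw [selfNorm, ← eq_gram_inv_mulVec hγ ψ (t + 1) hsol, noiseSum_succ, add_dotProduct,
    dotProduct_add, dotProduct_add, smul_dotProduct, smul_dotProduct, dotProduct_smul,
    dotProduct_smul, hk2, ← hm, ← hu, selfNorm, ← hh, hc]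
  simp only [smul_eq_mul]
  field_simp
  ring

/-- The determinant is the product of `d` eigenvalues, each the Rayleigh quotient of a unit vector
and hence at most `γ` plus the total squared norm of the regressors. -/
theorem det_gram_le {γ : ℝ} (hγ : 0 < γ) (ψ : ℕ → Fin d → ℝ) (t : ℕ) :
    (gram γ ψ t).det ≤ (∑ s ∈ Finset.range t, ψ s ⬝ᵥ ψ s + γ) ^ d := by
  have hG := gram_isHermitian γ ψ t
  rw [hG.det_eq_prod_eigenvalues]
  simp only [RCLike.ofReal_real_eq_id, id_eq]
  refine (Finset.prod_le_prod (g := fun _ => ∑ s ∈ Finset.range t, ψ s ⬝ᵥ ψ s + γ)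
    (fun i _ => ((gram_posDef hγ ψ t).eigenvalues_pos i).le) fun i _ => ?_).trans_eq (by simp)
  set v : Fin d → ℝ := (hG.eigenvectorBasis i).ofLp with hv
  have hvv : v ⬝ᵥ v = 1 := by
    have h1 := hG.eigenvectorBasis.orthonormal.1 i
    rw [EuclideanSpace.norm_eq, Real.sqrt_eq_one] at h1
    simpa [dotProduct, sq] using h1
  have h2 : v ⬝ᵥ (gram γ ψ t *ᵥ v) = hG.eigenvalues i := by
    rw [hv, hG.mulVec_eigenvectorBasis i, dotProduct_smul, ← hv, hvv, smul_eq_mul, mul_one]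
  rw [← h2, dotProduct_gram_mulVec, hvv, mul_one, add_comm]
  gcongr with s
  have := Finset.sum_mul_sq_le_sq_mul_sq Finset.univ (ψ s) v
  have e : ∑ i, v i ^ 2 = 1 := by rw [← hvv]; simp [dotProduct, sq]
  rw [e, mul_one] at this
  simpa [dotProduct, sq] using this

/-- The quadratic form is nonnegative along the line `v + x • w`, so its discriminant is not
positive. -/
theorem cauchy_schwarz_gram {γ : ℝ} (hγ : 0 < γ) (ψ : ℕ → Fin d → ℝ) (t : ℕ)
    (v w : Fin d → ℝ) :
    (v ⬝ᵥ (gram γ ψ t *ᵥ w)) ^ 2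
      ≤ (v ⬝ᵥ (gram γ ψ t *ᵥ v)) * (w ⬝ᵥ (gram γ ψ t *ᵥ w)) := by
  have h : ∀ x : ℝ, 0 ≤ (w ⬝ᵥ (gram γ ψ t *ᵥ w)) * (x * x)
      + (2 * (v ⬝ᵥ (gram γ ψ t *ᵥ w))) * x + v ⬝ᵥ (gram γ ψ t *ᵥ v) := by
    intro x
    have h0 := (mul_nonneg hγ.le (dotProduct_self_nonneg' _)).trans
      (le_dotProduct_gram γ ψ t (v + x • w))
    rw [mulVec_add, mulVec_smul, add_dotProduct, dotProduct_add, dotProduct_add, smul_dotProduct,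
      smul_dotProduct, dotProduct_smul, dotProduct_smul, dotProduct_gram_comm γ ψ t w v] at h0
    simp only [smul_eq_mul] at h0
    linarith
  have := discrim_le_zero h
  rw [discrim] at this
  nlinarith

/-- The deterministic part of the least squares error bound. -/
theorem frobNorm_error_le {γ : ℝ} (hγ : 0 < γ) (ψ : ℕ → Fin d → ℝ) (η : ℕ → Fin n → ℝ) (t : ℕ)
    (θ θ' : Mat d n)
    (hθ : ∀ j, gram γ ψ t *ᵥ (fun i => θ i j)
      = ∑ s ∈ Finset.range t, (ψ s ⬝ᵥ (fun i => θ' i j) + η s j) • ψ s)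
    {l : ℝ} (hl : 0 ≤ l)
    (hmin : ∀ v : Fin d → ℝ, l * (v ⬝ᵥ v) ≤ v ⬝ᵥ (gram γ ψ t *ᵥ v)) :
    √l * frobNorm (θ - θ')
      ≤ √γ * frobNorm θ' + √(∑ j, selfNorm γ ψ (fun s => η s j) t) := by
  set Δ : Fin n → Fin d → ℝ := fun j i => θ i j - θ' i j with hΔ
  set Q : Fin n → ℝ := fun j => selfNorm γ ψ (fun s => η s j) t with hQ
  have hQ0 : ∀ j, 0 ≤ Q j := fun j => gram_inv_nonneg hγ ψ t _
  set E : Fin n → ℝ := fun j => Δ j ⬝ᵥ (gram γ ψ t *ᵥ Δ j) with hE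
  have hE0 : ∀ j, 0 ≤ E j := fun j => (mul_nonneg hγ.le (dotProduct_self_nonneg' _)).trans
    (le_dotProduct_gram γ ψ t (Δ j))
  set T : Fin n → ℝ := fun j => (fun i => θ' i j) ⬝ᵥ (fun i => θ' i j) with hT
  have hT0 : ∀ j, 0 ≤ T j := fun j => dotProduct_self_nonneg' _
  have hnormal : ∀ j, gram γ ψ t *ᵥ Δ j
      = noiseSum ψ (fun s => η s j) t - γ • (fun i => θ' i j) := by
    intro j
    have : Δ j = (fun i => θ i j) - (fun i => θ' i j) := rfl
    rw [this, mulVec_sub, hθ, gram_mulVec, noiseSum]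
    simp_rw [add_smul]
    rw [Finset.sum_add_distrib]
    abel
  -- Pair the error equation with `Δ j`. The noise term is bounded by Cauchy–Schwarz in the Gram
  -- inner product, the regularisation bias by `γ |Δ j|² ≤ E j`.
  have hEj : ∀ j, E j ≤ √(E j) * √(Q j) + √γ * (√(E j) * √(T j)) := by
    intro j
    have h1 : E j = Δ j ⬝ᵥ noiseSum ψ (fun s => η s j) t - γ * (Δ j ⬝ᵥ fun i => θ' i j) := by
      simp only [hE]
      rw [hnormal, dotProduct_sub, dotProduct_smul, smul_eq_mul]
    have h2 : Δ j ⬝ᵥ noiseSum ψ (fun s => η s j) t ≤ √(E j) * √(Q j) := by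
      rw [← Real.sqrt_mul (hE0 j)]
      refine Real.le_sqrt_of_sq_le ?_
      have := cauchy_schwarz_gram hγ ψ t (Δ j) ((gram γ ψ t)⁻¹ *ᵥ noiseSum ψ (fun s => η s j) t)
      rw [gram_mulVec_inv hγ] at this
      rw [dotProduct_comm (_ *ᵥ _) (noiseSum _ _ _)] at this
      exact this
    have h3 : -(γ * (Δ j ⬝ᵥ fun i => θ' i j)) ≤ √γ * (√(E j) * √(T j)) := by
      have hcs : (Δ j ⬝ᵥ fun i => θ' i j) ^ 2 ≤ (Δ j ⬝ᵥ Δ j) * T j := by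
        have := Finset.sum_mul_sq_le_sq_mul_sq Finset.univ (Δ j) (fun i => θ' i j)
        simpa [dotProduct, sq, hT] using this
      have hγE : γ * (Δ j ⬝ᵥ Δ j) ≤ E j := le_dotProduct_gram γ ψ t (Δ j)
      rw [← Real.sqrt_mul (hE0 j), ← Real.sqrt_mul hγ.le]
      refine Real.le_sqrt_of_sq_le ?_
      have : (-(γ * (Δ j ⬝ᵥ fun i => θ' i j))) ^ 2 = γ * (γ * (Δ j ⬝ᵥ fun i => θ' i j) ^ 2) := by
        ring
      rw [this]
      refine mul_le_mul_of_nonneg_left ?_ hγ.le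
      calc γ * (Δ j ⬝ᵥ fun i => θ' i j) ^ 2 ≤ γ * ((Δ j ⬝ᵥ Δ j) * T j) :=
            mul_le_mul_of_nonneg_left hcs hγ.le
        _ = γ * (Δ j ⬝ᵥ Δ j) * T j := by ring
        _ ≤ E j * T j := mul_le_mul_of_nonneg_right hγE (hT0 j)
    linarith
  have hcsum : ∀ F : Fin n → ℝ, (∀ j, 0 ≤ F j) →
      ∑ j, √(E j) * √(F j) ≤ √(∑ j, E j) * √(∑ j, F j) := fun F hF =>
    Real.sum_sqrt_mul_sqrt_le Finset.univ hE0 hF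
  have hsum : ∑ j, E j ≤ √(∑ j, E j) * (√(∑ j, Q j) + √γ * √(∑ j, T j)) := by
    calc ∑ j, E j ≤ ∑ j, (√(E j) * √(Q j) + √γ * (√(E j) * √(T j))) :=
          Finset.sum_le_sum fun j _ => hEj j
      _ = ∑ j, √(E j) * √(Q j) + √γ * ∑ j, √(E j) * √(T j) := by
          rw [Finset.sum_add_distrib, Finset.mul_sum]
      _ ≤ √(∑ j, E j) * √(∑ j, Q j) + √γ * (√(∑ j, E j) * √(∑ j, T j)) :=
          add_le_add (hcsum Q hQ0) (mul_le_mul_of_nonneg_left (hcsum T hT0) (Real.sqrt_nonneg _))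
      _ = _ := by ring
  have hET : 0 ≤ ∑ j, E j := Finset.sum_nonneg fun j _ => hE0 j
  have hfinal : √(∑ j, E j) ≤ √(∑ j, Q j) + √γ * √(∑ j, T j) := by
    rcases (Real.sqrt_nonneg (∑ j, E j)).eq_or_lt with h0 | h0
    · rw [← h0]; positivity
    · refine le_of_mul_le_mul_left ?_ h0
      rwa [Real.mul_self_sqrt hET]
  have hfT : frobNorm θ' = √(∑ j, T j) := by
    rw [frobNorm, Finset.sum_comm]
    simp [hT, dotProduct, sq]
  have hfΔ : frobNorm (θ - θ') = √(∑ j, Δ j ⬝ᵥ Δ j) := by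
    rw [frobNorm, Finset.sum_comm]
    simp [hΔ, dotProduct, sq]
  rw [hfT, hfΔ, ← Real.sqrt_mul hl, add_comm]
  refine (Real.sqrt_le_sqrt ?_).trans hfinal
  rw [Finset.mul_sum]
  exact Finset.sum_le_sum fun j _ => hmin (Δ j)

theorem opNorm_le_frobNorm (A : Mat d n) : (opNorm A : ℝ) ≤ frobNorm A := by
  rw [opNorm, coe_nnnorm]
  refine ContinuousLinearMap.opNorm_le_bound _ (Real.sqrt_nonneg _) fun x => ?_
  have hF : 0 ≤ ∑ i, ∑ j, A i j ^ 2 :=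
    Finset.sum_nonneg fun _ _ => Finset.sum_nonneg fun _ _ => sq_nonneg _
  rw [LinearMap.coe_toContinuousLinearMap', frobNorm, EuclideanSpace.norm_eq,
    EuclideanSpace.norm_eq x]
  refine le_trans ?_ (Real.sqrt_mul hF _).le
  rw [Finset.sum_mul]
  refine Real.sqrt_le_sqrt (Finset.sum_le_sum fun i _ => ?_)
  simp only [Real.norm_eq_abs, sq_abs]
  have := Finset.sum_mul_sq_le_sq_mul_sq Finset.univ (A i) x
  simpa [Matrix.toEuclideanLin, Matrix.mulVec, dotProduct] using this

theorem transMul_apply (A : Mat d n) (z : Vec d) (j : Fin n) :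
    transMul A z j = (z : Fin d → ℝ) ⬝ᵥ fun i => A i j := by
  simp [transMul, Matrix.toEuclideanLin, Matrix.mulVec, dotProduct, mul_comm]

theorem rlsCost_eq {m q : ℕ} (M : System n m d q) (X : ℕ → M.𝕏) (U : ℕ → M.𝕌) (t : ℕ)
    (θ : Mat d n) :
    M.rlsCost X U t θ = ∑ s ∈ Finset.range t, ∑ j, ((X (s + 1) : Vec n) j - M.f (X s) (U s) j
      - (M.ψ (X s) (U s) : Fin d → ℝ) ⬝ᵥ fun i => θ i j) ^ 2 + M.γ * ∑ i, ∑ j, θ i j ^ 2 := by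
  have hF : 0 ≤ ∑ i, ∑ j, θ i j ^ 2 :=
    Finset.sum_nonneg fun _ _ => Finset.sum_nonneg fun _ _ => sq_nonneg _
  rw [System.rlsCost, frobNorm]
  refine congrArg₂ (· + ·) ?_ (congrArg (M.γ * ·) (Real.sq_sqrt hF))
  refine Finset.sum_congr rfl fun s _ => ?_
  rw [EuclideanSpace.real_norm_sq_eq]
  refine Finset.sum_congr rfl fun j _ => ?_
  simp only [PiLp.sub_apply, transMul_apply]
  ring

/-- The normal equations of regularised least squares. -/
theorem normal_equations {m q : ℕ} (M : System n m d q) (X : ℕ → M.𝕏) (U : ℕ → M.𝕌) (t : ℕ)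
    (θ : Mat d n) (h : IsMinOn (M.rlsCost X U t) Set.univ θ) (j : Fin n) :
    gram M.γ (fun s => (M.ψ (X s) (U s) : Fin d → ℝ)) t *ᵥ (fun i => θ i j)
      = ∑ s ∈ Finset.range t, ((X (s + 1) : Vec n) j - M.f (X s) (U s) j) •
        (M.ψ (X s) (U s) : Fin d → ℝ) := by
  set p : ℕ → Fin d → ℝ := fun s => (M.ψ (X s) (U s) : Fin d → ℝ) with hp
  set y : ℕ → Fin n → ℝ := fun s j => (X (s + 1) : Vec n) j - M.f (X s) (U s) j with hy
  -- First-order optimality: along `θ + ε • E` the cost changes by `C ε² - 2 A ε`, and nonnegativity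
  -- for all `ε` forces `A = 0`.
  have hstat : ∀ E : Mat d n, ∑ s ∈ Finset.range t, ∑ j,
      (y s j - p s ⬝ᵥ fun i => θ i j) * (p s ⬝ᵥ fun i => E i j)
      - M.γ * ∑ i, ∑ j, θ i j * E i j = 0 := by
    intro E
    set A := ∑ s ∈ Finset.range t, ∑ j,
      (y s j - p s ⬝ᵥ fun i => θ i j) * (p s ⬝ᵥ fun i => E i j)
      - M.γ * ∑ i, ∑ j, θ i j * E i j with hA
    set C := ∑ s ∈ Finset.range t, ∑ j, (p s ⬝ᵥ fun i => E i j) ^ 2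
      + M.γ * ∑ i, ∑ j, E i j ^ 2 with hC
    have hexp : ∀ ε : ℝ, M.rlsCost X U t (θ + ε • E)
        = M.rlsCost X U t θ - 2 * ε * A + ε ^ 2 * C := by
      intro ε
      rw [rlsCost_eq, rlsCost_eq, hA, hC]
      have e1 : ∀ s j, (y s j - p s ⬝ᵥ fun i => (θ + ε • E) i j) ^ 2
          = (y s j - p s ⬝ᵥ fun i => θ i j) ^ 2
            - 2 * ε * ((y s j - p s ⬝ᵥ fun i => θ i j) * (p s ⬝ᵥ fun i => E i j))
            + ε ^ 2 * (p s ⬝ᵥ fun i => E i j) ^ 2 := by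
        intro s j
        have : (p s ⬝ᵥ fun i => (θ + ε • E) i j)
            = (p s ⬝ᵥ fun i => θ i j) + ε * (p s ⬝ᵥ fun i => E i j) := by
          rw [← smul_eq_mul, ← dotProduct_smul, ← dotProduct_add]
          rfl
        rw [this]; ring
      have e2 : ∀ i j, (θ + ε • E) i j ^ 2
          = θ i j ^ 2 + 2 * ε * (θ i j * E i j) + ε ^ 2 * E i j ^ 2 := by
        intro i j
        rw [Matrix.add_apply, Matrix.smul_apply, smul_eq_mul]; ring
      simp only [hy, hp] at e1
      simp only [e1, e2, Finset.sum_add_distrib, Finset.sum_sub_distrib, ← Finset.mul_sum, hy, hp]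
      ring
    have hmin : ∀ ε : ℝ, 0 ≤ C * (ε * ε) + (-2 * A) * ε + 0 := by
      intro ε
      have := h (Set.mem_univ (θ + ε • E))
      simp only [Set.mem_ofPred_eq, hexp] at this
      linarith
    have := discrim_le_zero hmin
    rw [discrim] at this
    nlinarith [sq_nonneg A]
  refine dotProduct_eq _ _ fun v => ?_
  -- A perturbation supported in column `j` isolates the equation of that column.
  have h1 := hstat (Matrix.of fun i k => if k = j then v i else 0)
  have e1 : ∀ s k, (p s ⬝ᵥ fun i => (Matrix.of fun i k => if k = j then v i else 0 : Mat d n) i k)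
      = if k = j then p s ⬝ᵥ v else 0 := by
    intro s k
    split_ifs with hk <;> simp [hk, dotProduct]
  simp only [e1] at h1
  simp only [Matrix.of_apply, mul_ite, mul_zero, Finset.sum_ite_eq', Finset.mem_univ,
    if_true] at h1
  rw [dotProduct_comm, dotProduct_gram_mulVec, sum_dotProduct]
  simp only [smul_dotProduct, smul_eq_mul]
  have e3 : (v ⬝ᵥ fun i => θ i j) = ∑ i, θ i j * v i := by simp [dotProduct, mul_comm]
  simp only [sub_mul, Finset.sum_sub_distrib] at h1
  rw [e3]
  simp only [hp, hy, sub_mul, Finset.sum_sub_distrib] at h1 ⊢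
  have e4 : ∀ s, ((M.ψ (X s) (U s) : Fin d → ℝ) ⬝ᵥ v)
      * ((M.ψ (X s) (U s) : Fin d → ℝ) ⬝ᵥ fun i => θ i j)
      = ((M.ψ (X s) (U s) : Fin d → ℝ) ⬝ᵥ fun i => θ i j)
        * ((M.ψ (X s) (U s) : Fin d → ℝ) ⬝ᵥ v) := fun s => mul_comm _ _
  simp only [e4]
  linarith

end LeastSquares

/-! ### Sub-exponential sequences and finiteness of the convergence time -/

/-- A sequence that is eventually dominated by `exp (ε t)`, for every `ε > 0`. -/
def SubExpSeq (a : ℕ → ℝ) : Prop := ∀ ε > 0, ∀ᶠ t : ℕ in atTop, a t ≤ Real.exp (ε * t)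

namespace SubExpSeq

theorem mono {a b : ℕ → ℝ} (hb : SubExpSeq b) (h : ∀ᶠ t in atTop, a t ≤ b t) : SubExpSeq a :=
  fun ε hε => by filter_upwards [hb ε hε, h] with t h1 h2 using h2.trans h1

theorem const (c : ℝ) : SubExpSeq fun _ => c := fun _ hε =>
  (Real.tendsto_exp_atTop.comp
    (tendsto_natCast_atTop_atTop.const_mul_atTop hε)).eventually_ge_atTop c

theorem natCast : SubExpSeq fun t => (t : ℝ) := fun ε hε => by
  have h := (Real.isLittleO_pow_exp_atTop (n := 1)).comp_tendsto
    ((tendsto_natCast_atTop_atTop (R := ℝ)).const_mul_atTop hε)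
  -- The little-o constant is taken to be `ε` itself, so that it cancels against the factor in `ε *
  -- t`.
  filter_upwards [h.bound hε] with t ht
  simp only [Function.comp, pow_one, Real.norm_eq_abs, Real.abs_exp] at ht
  have h2 := (le_abs_self _).trans ht
  exact le_of_mul_le_mul_left h2 hε

theorem mul {a b : ℕ → ℝ} (ha : SubExpSeq a) (hb : SubExpSeq b) (hb0 : ∀ t, 0 ≤ b t) :
    SubExpSeq fun t => a t * b t := fun ε hε => by
  filter_upwards [ha (ε / 2) (by positivity), hb (ε / 2) (by positivity)] with t h1 h2
  calc a t * b t ≤ Real.exp (ε / 2 * t) * Real.exp (ε / 2 * t) :=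
        mul_le_mul h1 h2 (hb0 t) (Real.exp_pos _).le
    _ = Real.exp (ε * t) := by rw [← Real.exp_add]; ring_nf

theorem add {a b : ℕ → ℝ} (ha : SubExpSeq a) (hb : SubExpSeq b) :
    SubExpSeq fun t => a t + b t := fun ε hε => by
  filter_upwards [ha (ε / 2) (by positivity), hb (ε / 2) (by positivity),
    const 2 (ε / 2) (by positivity)] with t h1 h2 h3
  calc a t + b t ≤ 2 * Real.exp (ε / 2 * t) := by linarith
    _ ≤ Real.exp (ε / 2 * t) * Real.exp (ε / 2 * t) :=
        mul_le_mul_of_nonneg_right h3 (Real.exp_pos _).le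
    _ = Real.exp (ε * t) := by rw [← Real.exp_add]; ring_nf

theorem pow {a : ℕ → ℝ} (ha : SubExpSeq a) (ha0 : ∀ t, 0 ≤ a t) (k : ℕ) :
    SubExpSeq fun t => a t ^ k := by
  induction k with
  | zero => simpa using const 1
  | succ k ih => simpa only [pow_succ] using ih.mul ha ha0

theorem log_isLittleO {a : ℕ → ℝ} (ha : SubExpSeq a) (ha1 : ∀ᶠ t in atTop, 1 ≤ a t) :
    (fun t => Real.log (a t)) =o[atTop] fun t : ℕ => (t : ℝ) := by
  refine Asymptotics.isLittleO_iff.2 fun ε hε => ?_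
  filter_upwards [ha ε hε, ha1] with t h1 h2
  rw [Real.norm_of_nonneg (Real.log_nonneg h2), Real.norm_natCast]
  exact (Real.log_le_iff_le_exp (by linarith)).2 h1

end SubExpSeq

theorem SubExp.eventually_le_exp {k : ℕ} {h : ℝ≥0 → ℝ≥0} (hh : SubExp k h) {ε : ℝ} (hε : 0 < ε) :
    ∀ᶠ r : ℝ≥0 in atTop, (h (r ^ k) : ℝ) ≤ Real.exp (ε * r) := by
  filter_upwards [hh.eventually (ge_mem_nhds hε : ∀ᶠ x in 𝓝 (0 : ℝ), x ≤ ε),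
    eventually_gt_atTop 0] with r h1 h2
  have h2' : (0 : ℝ) < r := h2
  rw [div_le_iff₀ h2'] at h1
  rcases (h (r ^ k)).2.eq_or_lt with h0 | h0
  · have : ((h (r ^ k) : ℝ≥0) : ℝ) = 0 := h0.symm
    rw [this]; positivity
  · exact (Real.log_le_iff_le_exp h0).1 h1

theorem tendsto_natCast_nnreal : Tendsto (fun t : ℕ => (t : ℝ≥0)) atTop atTop :=
  tendsto_natCast_atTop_atTop

theorem SubExp.subExpSeq_linear {h : ℝ≥0 → ℝ≥0} (hh : SubExp 1 h) (hm : Monotone h) (c : ℝ≥0) :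
    SubExpSeq fun t => (h (t * c) : ℝ) := by
  intro ε hε
  -- `c + 1` replaces `c` so that the argument tends to infinity even when `c = 0`; monotonicity of
  -- `h` allows it.
  have hc : 0 < c + 1 := by positivity
  have ht : Tendsto (fun t : ℕ => (t : ℝ≥0) * (c + 1)) atTop atTop :=
    tendsto_natCast_nnreal.atTop_mul_const hc
  have hc' : (0 : ℝ) < c + 1 := by positivity
  filter_upwards [ht.eventually (hh.eventually_le_exp (ε := ε / (c + 1)) (by positivity))]
    with t h1
  have h2 : (h (t * c) : ℝ) ≤ h ((t * (c + 1)) ^ 1) := by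
    refine NNReal.coe_le_coe.2 (hm ?_)
    rw [pow_one]
    gcongr
    exact le_self_add
  refine (h2.trans h1).trans_eq ?_
  congr 1
  push_cast
  field_simp

/-! ### Growth of the a priori bounds and finiteness of the time bounds. -/

section Bounds

variable {n m d q : ℕ} (M : System n m d q)

theorem wbar_mono (hn : 0 < n) (σw : ℝ≥0) {δ : ℝ} (hδ : 0 < δ) :
    Monotone fun t => System.wbar n σw t δ := by
  intro s t hst
  simp only [System.wbar]
  by_cases hs : s = 0
  · simp [hs]
  · have ht : t ≠ 0 := by omega
    rw [if_neg hs, if_neg ht]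
    have hs' : (0 : ℝ) < s := by exact_mod_cast Nat.pos_of_ne_zero hs
    have hst' : (s : ℝ) ≤ t := by exact_mod_cast hst
    have hn' : (0 : ℝ) < n := by exact_mod_cast hn
    gcongr

theorem xbar_mono (hn : 0 < n) {B : Growth} (hB : M.ForwardComplete B) (σw : ℝ≥0) {δ : ℝ}
    (hδ : 0 < δ) (x₀ : M.𝕏) : Monotone fun t => M.xbar B σw t δ x₀ := by
  intro s t hst
  have h1 := hB.χ₁.1.strictMono.monotone
  have h3 := hB.χ₃.1.strictMono.monotone
  have h4 := hB.χ₄.1.strictMono.monotone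
  have h6 := hB.σ₂.1.strictMono.monotone
  have hst' : (s : ℝ≥0) ≤ t := by exact_mod_cast hst
  have hw : System.wbar n σw s δ ≤ System.wbar n σw t δ := wbar_mono hn σw hδ hst
  simp only [System.xbar]
  refine add_le_add (add_le_add (add_le_add (add_le_add (h1 hst') le_rfl) (h3 ?_)) (h4 ?_)) le_rfl
  · gcongr
  · exact mul_le_mul hst' (h6 hw) zero_le zero_le

/-- The bound grows like `√(log t)`. Comparing it with `log t` is what matters: a 1-sub-exponential
`σ₂` satisfies `σ₂ r ≤ exp r` eventually, so `σ₂ (log t) ≤ t`. -/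
theorem eventually_wbar_le_log (σw : ℝ≥0) {δ : ℝ} (hδ : 0 < δ) (hn : 0 < n) :
    ∀ᶠ t : ℕ in atTop, (System.wbar n σw t δ : ℝ) ≤ Real.log t := by
  set C := Real.log (n * Real.pi ^ 2 / (3 * δ)) with hC
  set K := (σw : ℝ) ^ 2 * (2 * n * (|C| + 2)) with hK
  have hlog := (Real.tendsto_log_atTop.comp (tendsto_natCast_atTop_atTop (R := ℝ)))
  filter_upwards [hlog.eventually_ge_atTop 1, hlog.eventually_ge_atTop K, eventually_ge_atTop 1]
    with t h1 h2 h3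
  simp only [Function.comp] at h1 h2
  have ht : (0 : ℝ) < t := by exact_mod_cast h3
  have hn' : (0 : ℝ) < n := by exact_mod_cast hn
  rw [System.wbar, if_neg (by omega), NNReal.coe_mul, Real.coe_toNNReal _ (Real.sqrt_nonneg _)]
  have e1 : Real.log (n * Real.pi ^ 2 * (t : ℝ) ^ 2 / (3 * δ)) = C + 2 * Real.log t := by
    have : n * Real.pi ^ 2 * (t : ℝ) ^ 2 / (3 * δ)
        = n * Real.pi ^ 2 / (3 * δ) * (t : ℝ) ^ 2 := by ring
    rw [this, Real.log_mul (by positivity) (by positivity), Real.log_pow]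
    norm_num
    rfl
  rw [e1, ← Real.sqrt_sq (NNReal.coe_nonneg σw), ← Real.sqrt_mul (sq_nonneg _)]
  refine Real.sqrt_le_iff.2 ⟨by linarith, ?_⟩
  have h4 : C + 2 * Real.log t ≤ (|C| + 2) * Real.log t := by
    have := le_abs_self C
    nlinarith [abs_nonneg C]
  calc (σw : ℝ) ^ 2 * (2 * n * (C + 2 * Real.log t))
      ≤ (σw : ℝ) ^ 2 * (2 * n * ((|C| + 2) * Real.log t)) := by gcongr
    _ = K * Real.log t := by rw [hK]; ring
    _ ≤ Real.log t * Real.log t := by gcongr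
    _ = Real.log t ^ 2 := by ring

/-- The noise term is the delicate one: `t * σ₂ (wbar t)` is eventually at most `t²`, which is where
2-sub-exponentiality of `χ₄` enters. -/
theorem subExpSeq_xbar (hn : 0 < n) {B : Growth} (hB : M.ForwardComplete B) (σw : ℝ≥0) {δ : ℝ}
    (hδ : 0 < δ) (x₀ : M.𝕏) : SubExpSeq fun t => (M.xbar B σw t δ x₀ : ℝ) := by
  have h1 : SubExpSeq fun t => (B.χ₁ t : ℝ) := by
    simpa using hB.χ₁.2.subExpSeq_linear hB.χ₁.1.strictMono.monotone 1
  have h3 := hB.χ₃.2.subExpSeq_linear hB.χ₃.1.strictMono.monotone (B.σ₁ B.umax)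
  have h4 : SubExpSeq fun t => (B.χ₄ (t * B.σ₂ (System.wbar n σw t δ)) : ℝ) := by
    have hsq : SubExpSeq fun t => (B.χ₄ ((t : ℝ≥0) ^ 2) : ℝ) := fun ε hε => by
      simpa using tendsto_natCast_nnreal.eventually (hB.χ₄.2.eventually_le_exp hε)
    refine hsq.mono ?_
    have hlog : Tendsto (fun t : ℕ => (Real.log t).toNNReal) atTop atTop :=
      tendsto_real_toNNReal_atTop.comp
        (Real.tendsto_log_atTop.comp (tendsto_natCast_atTop_atTop (R := ℝ)))
    filter_upwards [eventually_wbar_le_log σw hδ hn, eventually_ge_atTop 1,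
      hlog.eventually (hB.σ₂.2.eventually_le_exp one_pos)] with t hw ht hσ
    have ht' : (1 : ℝ) ≤ t := by exact_mod_cast ht
    have hl : 0 ≤ Real.log t := Real.log_nonneg ht'
    refine NNReal.coe_le_coe.2 (hB.χ₄.1.strictMono.monotone ?_)
    rw [sq]
    refine mul_le_mul_right ?_ _
    rw [pow_one, one_mul, Real.coe_toNNReal _ hl, Real.exp_log (by linarith)] at hσ
    refine le_trans (hB.σ₂.1.strictMono.monotone ?_) (by exact_mod_cast hσ)
    exact NNReal.le_toNNReal_of_coe_le hw
  simp only [System.xbar, NNReal.coe_add]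
  exact (((h1.add (SubExpSeq.const _)).add h3).add h4).add (SubExpSeq.const _)

/-- Beyond some `r₀` the asymptotic bound applies; below it, monotonicity gives `h r₀`. Using `1 +
r` keeps the polynomial at least one. -/
theorem APB.exists_bound {h : ℝ≥0 → ℝ≥0} (hh : APB h) (hm : Monotone h) :
    ∃ (K : ℝ) (k : ℕ), 0 ≤ K ∧ ∀ r : ℝ≥0, (h r : ℝ) ≤ K * (1 + r) ^ k := by
  obtain ⟨k, hk⟩ := hh
  obtain ⟨C, hC⟩ := hk.bound
  obtain ⟨r₀, hr₀⟩ := eventually_atTop.1 hC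
  refine ⟨|C| + h r₀, k, by positivity, fun r => ?_⟩
  have h1 : (1 : ℝ) ≤ (1 + r) ^ k := one_le_pow₀ (by simp)
  have hr : (0 : ℝ) ≤ r := r.2
  rcases le_total r₀ r with hle | hle
  · have h2 := hr₀ r hle
    rw [Real.norm_of_nonneg (by positivity), Real.norm_of_nonneg (by positivity)] at h2
    have h3 : (r : ℝ) ^ k ≤ (1 + r) ^ k := by gcongr; linarith
    calc (h r : ℝ) ≤ C * (r : ℝ) ^ k := h2
      _ ≤ |C| * (r : ℝ) ^ k := by gcongr; exact le_abs_self C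
      _ ≤ (|C| + h r₀) * (1 + r) ^ k := by gcongr; simp
  · have h2 : (h r : ℝ) ≤ h r₀ := by exact_mod_cast hm hle
    calc (h r : ℝ) ≤ h r₀ * 1 := by simpa using h2
      _ ≤ (|C| + h r₀) * (1 + r) ^ k := by gcongr; simp

/-- The sum of the squared regressor bounds. -/
noncomputable def zsum (B : Growth) (σw : ℝ≥0) (t : ℕ) (δ : ℝ) (x₀ : M.𝕏) : ℝ :=
  ∑ i ∈ Finset.Icc 1 t, (M.zbar B σw i δ x₀ : ℝ) ^ 2

theorem zsum_nonneg (B : Growth) (σw : ℝ≥0) (t : ℕ) (δ : ℝ) (x₀ : M.𝕏) :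
    0 ≤ zsum M B σw t δ x₀ := Finset.sum_nonneg fun _ _ => sq_nonneg _

/-- Since `xbar` is monotone in time, each of the `t` summands is at most a fixed polynomial in
`xbar t`. -/
theorem subExpSeq_zsum (hn : 0 < n) {B : Growth} (hB : M.ForwardComplete B)
    (hψ : M.PolyBasis B) (σw : ℝ≥0) {δ : ℝ} (hδ : 0 < δ) (x₀ : M.𝕏) :
    SubExpSeq fun t => zsum M B σw t δ x₀ := by
  obtain ⟨K, k, hK, hb⟩ := hψ.apb.exists_bound hψ.mono
  have hx := subExpSeq_xbar M hn hB σw hδ x₀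
  have h1 := (((hx.add (SubExpSeq.const (1 + B.umax))).pow (fun t => by positivity) k).pow
    (fun t => by positivity) 2)
  refine ((SubExpSeq.natCast.mul h1 fun t => by positivity).mul (SubExpSeq.const (K ^ 2))
    fun _ => by positivity).mono (Eventually.of_forall fun t => ?_)
  have hz : ∀ i ∈ Finset.Icc 1 t, (M.zbar B σw i δ x₀ : ℝ) ^ 2
      ≤ ((M.xbar B σw t δ x₀ + (1 + B.umax)) ^ k : ℝ) ^ 2 * K ^ 2 := by
    intro i hi
    rw [Finset.mem_Icc] at hi
    rw [← mul_pow, mul_comm]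
    have hxm : M.xbar B σw (i - 1) δ x₀ ≤ M.xbar B σw t δ x₀ :=
      xbar_mono M hn hB σw hδ x₀ (by omega)
    have hxm' : (M.xbar B σw (i - 1) δ x₀ : ℝ) ≤ M.xbar B σw t δ x₀ := by exact_mod_cast hxm
    gcongr
    refine (hb _).trans (mul_le_mul_of_nonneg_left (pow_le_pow_left₀ (by positivity) ?_ _) hK)
    have : (NNReal.sqrt (M.xbar B σw (i - 1) δ x₀ ^ 2 + B.umax ^ 2) : ℝ)
        ≤ M.xbar B σw (i - 1) δ x₀ + B.umax := by
      rw [Real.coe_sqrt]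
      refine Real.sqrt_le_iff.2 ⟨by positivity, ?_⟩
      push_cast
      have := mul_nonneg (NNReal.coe_nonneg (M.xbar B σw (i - 1) δ x₀)) (NNReal.coe_nonneg B.umax)
      linarith [add_sq (M.xbar B σw (i - 1) δ x₀ : ℝ) B.umax]
    linarith
  refine (Finset.sum_le_sum hz).trans_eq ?_
  simp [mul_assoc]

theorem log_zsum_isLittleO (hn : 0 < n) {B : Growth} (hB : M.ForwardComplete B)
    (hψ : M.PolyBasis B) (σw : ℝ≥0) {δ : ℝ} (hδ : 0 < δ) (x₀ : M.𝕏) {c : ℝ} (hc : 0 ≤ c) :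
    (fun t => Real.log (1 + c * zsum M B σw t δ x₀)) =o[atTop] fun t : ℕ => (t : ℝ) := by
  refine SubExpSeq.log_isLittleO ((SubExpSeq.const 1).add
    ((SubExpSeq.const c).mul (subExpSeq_zsum M hn hB hψ σw hδ x₀) fun t => zsum_nonneg ..)) ?_
  exact Eventually.of_forall fun t => by
    have := mul_nonneg hc (zsum_nonneg M B σw t δ x₀)
    linarith

/-- Ensures that the infimum defining `Tburnin` is not infinite: both logarithms are `o(t)`. -/
theorem exists_burnin (hn : 0 < n) {B : Growth} (hB : M.ForwardComplete B)
    (hψ : M.PolyBasis B) (σw : ℝ≥0) {cPE pPE : ℝ} (hc : 0 < cPE) (hp : 0 < pPE) {δ : ℝ}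
    (hδ : 0 < δ) (x₀ : M.𝕏) :
    ∃ T : ℕ, 1 ≤ T ∧ ∀ t : ℕ, T ≤ t →
      2 / ((1 - Real.log 2) * pPE) *
        (d * Real.log (1 + 16 * (∑ i ∈ Finset.Icc 1 t, (M.zbar B σw i (δ / 3) x₀ : ℝ) ^ 2)
              / (cPE * pPE * ((t : ℝ) - 1)))
          + Real.log (Real.pi ^ 2 * ((t : ℝ) - T + 1) ^ 2 / (2 * δ))) + 1 ≤ (t : ℝ) := by
  have hlog2 : 0 < 1 - Real.log 2 := by linarith [Real.log_two_lt_d9]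
  have hc0 : 0 < 2 / ((1 - Real.log 2) * pPE) := by positivity
  set κ := 2 / ((1 - Real.log 2) * pPE) with hκ
  have hz := log_zsum_isLittleO M hn hB hψ σw (δ := δ / 3) (by positivity) x₀
    (c := 16 / (cPE * pPE)) (by positivity)
  have hq : (fun t : ℕ => Real.log (1 + Real.pi ^ 2 / (2 * δ) * (t : ℝ) ^ 2))
      =o[atTop] fun t : ℕ => (t : ℝ) := by
    refine SubExpSeq.log_isLittleO ((SubExpSeq.const 1).add ((SubExpSeq.const _).mul
      (SubExpSeq.natCast.pow (fun t => by positivity) 2) fun t => by positivity)) ?_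
    exact Eventually.of_forall fun t => by
      have : 0 ≤ Real.pi ^ 2 / (2 * δ) * (t : ℝ) ^ 2 := by positivity
      linarith
  have hone : (fun _ : ℕ => (1 : ℝ)) =o[atTop] fun t : ℕ => (t : ℝ) :=
    (Asymptotics.isLittleO_const_left.2 (Or.inr
      (tendsto_norm_atTop_atTop.comp tendsto_natCast_atTop_atTop)))
  have htot := (((hz.const_mul_left (d : ℝ)).add hq).const_mul_left κ).add hone
  obtain ⟨T₀, hT₀⟩ := eventually_atTop.1 (htot.bound one_pos)
  -- From time 2 on, `t - 1 ≥ 1` can be dropped from the denominator; and `t - T + 1 ≤ t` frees the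
  -- estimate from `T`, so `T` may be chosen last.
  refine ⟨max T₀ 2, by omega, fun t ht => ?_⟩
  have h1 := hT₀ t (le_trans (le_max_left _ _) ht)
  have ht2 : (2 : ℝ) ≤ t := by exact_mod_cast le_trans (le_max_right T₀ 2) ht
  have hT2 : (1 : ℝ) ≤ ((max T₀ 2 : ℕ) : ℝ) := by
    exact_mod_cast (le_trans (by norm_num) (le_max_right T₀ 2))
  have hTt : ((max T₀ 2 : ℕ) : ℝ) ≤ t := by exact_mod_cast ht
  rw [one_mul, Real.norm_natCast] at h1
  refine le_trans ?_ ((le_abs_self _).trans h1)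
  have hZ := zsum_nonneg M B σw t (δ / 3) x₀
  rw [← zsum]
  gcongr
  · have : 0 ≤ 16 * zsum M B σw t (δ / 3) x₀ / (cPE * pPE * ((t : ℝ) - 1)) := by
      have : 0 ≤ (t : ℝ) - 1 := by linarith
      positivity
    linarith
  · have h2 : cPE * pPE ≤ cPE * pPE * ((t : ℝ) - 1) :=
      le_mul_of_one_le_right (by positivity) (by linarith)
    rw [div_mul_eq_mul_div]
    gcongr
  · have h3 : ((t : ℝ) - (max T₀ 2 : ℕ) + 1) ^ 2 ≤ (t : ℝ) ^ 2 := by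
      gcongr
      · linarith
    calc Real.pi ^ 2 * ((t : ℝ) - (max T₀ 2 : ℕ) + 1) ^ 2 / (2 * δ)
        ≤ Real.pi ^ 2 * (t : ℝ) ^ 2 / (2 * δ) := by gcongr
      _ ≤ 1 + Real.pi ^ 2 / (2 * δ) * (t : ℝ) ^ 2 := by
        rw [div_mul_eq_mul_div]; linarith

theorem exists_errBound_le (hn : 0 < n) {B : Growth} (hB : M.ForwardComplete B)
    (hψ : M.PolyBasis B) (σw : ℝ≥0) {cPE pPE : ℝ} (hc : 0 < cPE) (hp : 0 < pPE) {ϑbar : ℝ≥0}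
    (hϑ : 0 < ϑbar) {δ : ℝ} (hδ : 0 < δ) (x₀ : M.𝕏) :
    ∃ T : ℕ, 1 ≤ T ∧ ∀ t : ℕ, T ≤ t → M.errBound B σw cPE pPE t δ x₀ ≤ ϑbar := by
  have hϑ' : (0 : ℝ) < ϑbar := hϑ
  have hγ := M.γ_pos
  have hz := log_zsum_isLittleO M hn hB hψ σw (δ := δ / 3) (by positivity) x₀
    (c := M.γ⁻¹) (by positivity)
  have hconst : ∀ c : ℝ, (fun _ : ℕ => c) =o[atTop] fun t : ℕ => (t : ℝ) := fun c =>
    (Asymptotics.isLittleO_const_left.2 (Or.inr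
      (tendsto_norm_atTop_atTop.comp tendsto_natCast_atTop_atTop)))
  have h1 := (((hconst (Real.log (3 * n / δ))).add
    (hz.const_mul_left ((d : ℝ) / 2))).const_mul_left ((σw : ℝ) ^ 2 * (2 * n)))
  have h2 := hconst ((√M.γ * frobNorm M.θstar) ^ 2)
  -- Chosen so that each of the two terms of the numerator is at most `ϑbar / 2` times `√(cPE * pPE
  -- / 8 * t)`, a lower bound for the denominator once `t ≥ 2`.
  set κ := (ϑbar : ℝ) ^ 2 / 4 * (cPE * pPE / 8) with hκ
  have hκ0 : 0 < κ := by positivity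
  obtain ⟨T₀, hT₀⟩ := eventually_atTop.1 ((h1.bound hκ0).and (h2.bound hκ0))
  refine ⟨max T₀ 2, by omega, fun t ht => ?_⟩
  obtain ⟨h1, h2⟩ := hT₀ t (le_trans (le_max_left _ _) ht)
  have ht2 : (2 : ℝ) ≤ t := by exact_mod_cast le_trans (le_max_right T₀ 2) ht
  rw [Real.norm_natCast] at h1 h2
  have h1 := (le_abs_self _).trans h1
  have h2 := (le_abs_self _).trans h2
  have hden : cPE * pPE / 8 * t ≤ cPE * pPE / 4 * ((t : ℝ) - 1) + M.γ := by
    nlinarith [mul_pos hc hp]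
  have hβ : M.βmax B σw t (δ / 3) x₀ * M.γ⁻¹ = 1 + M.γ⁻¹ * zsum M B σw t (δ / 3) x₀ := by
    rw [System.βmax, ← zsum]
    field_simp
    ring
  have hhalf : √(κ * t) = ϑbar / 2 * √(cPE * pPE / 8 * t) := by
    have : κ * t = (ϑbar / 2 : ℝ) ^ 2 * (cPE * pPE / 8 * t) := by rw [hκ]; ring
    rw [this, Real.sqrt_mul (sq_nonneg _), Real.sqrt_sq (by positivity)]
  have hA : √M.γ * frobNorm M.θstar ≤ ϑbar / 2 * √(cPE * pPE / 8 * t) := by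
    rw [← hhalf]
    exact Real.le_sqrt_of_sq_le h2
  have hBd : σw * √(2 * n * (Real.log (3 * n / δ)
        + (d : ℝ) / 2 * Real.log (M.βmax B σw t (δ / 3) x₀ * M.γ⁻¹)))
      ≤ ϑbar / 2 * √(cPE * pPE / 8 * t) := by
    rw [← hhalf, hβ, ← Real.sqrt_sq (NNReal.coe_nonneg σw), ← Real.sqrt_mul (sq_nonneg _)]
    refine Real.sqrt_le_sqrt (le_trans (le_of_eq ?_) h1)
    ring
  have hpos : 0 < cPE * pPE / 8 * t := by positivity
  rw [System.errBound, one_div, inv_mul_le_iff₀ (Real.sqrt_pos.2 (hpos.trans_le hden))]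
  calc _ ≤ ϑbar * √(cPE * pPE / 8 * t) := by linarith
    _ ≤ √(cPE * pPE / 4 * ((t : ℝ) - 1) + M.γ) * ϑbar := by
      rw [mul_comm]; gcongr

/-- An infimum of natural numbers in `ℕ∞` over a nonempty set is attained. -/
theorem exists_iInf_eq {S : Set ℕ} (hS : S.Nonempty) :
    ∃ T ∈ S, (⨅ T ∈ S, (T : ℕ∞)) = T := by
  refine ⟨sInf S, Nat.sInf_mem hS, le_antisymm (iInf₂_le _ (Nat.sInf_mem hS)) ?_⟩
  exact le_iInf₂ fun T hT => by exact_mod_cast Nat.sInf_le hT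

/-- The times supplied by the hypothesis of the theorem: a burn-in time `Tb`, and a time `Tc ≥ Tb`
after which the error bound is small and up to which the state is contained. -/
theorem exists_times (hn : 0 < n) {B : Growth} (hB : M.ForwardComplete B)
    (hψ : M.PolyBasis B) (σw : ℝ≥0) {cPE pPE : ℝ} (hc : 0 < cPE) (hp : 0 < pPE) {ϑbar : ℝ≥0}
    (hϑ : 0 < ϑbar) {δ : ℝ} (hδ : 0 < δ) (x₀ : M.𝕏) (𝒳 : Set M.𝕏)
    (h : M.Tconverge B σw cPE pPE ϑbar δ x₀ + 1 ≤ M.Tcontained B σw 𝒳 δ x₀) :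
    ∃ Tb Tc : ℕ, 1 ≤ Tb ∧ Tb ≤ Tc ∧
      (∀ t : ℕ, Tb ≤ t → 2 / ((1 - Real.log 2) * pPE) *
        (d * Real.log (1 + 16 * zsum M B σw t (δ / 3) x₀ / (cPE * pPE * ((t : ℝ) - 1)))
          + Real.log (Real.pi ^ 2 * ((t : ℝ) - Tb + 1) ^ 2 / (2 * δ))) + 1 ≤ (t : ℝ)) ∧
      (∀ t : ℕ, Tc ≤ t → M.errBound B σw cPE pPE t δ x₀ ≤ ϑbar) ∧
      ∀ x : M.𝕏, ‖(x : Vec n)‖₊ ≤ M.xbar B σw (Tc + 1) (δ / 3) x₀ → x ∈ 𝒳 := by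
  obtain ⟨Tb, hTb, hTbe⟩ := exists_iInf_eq (exists_burnin M hn hB hψ σw hc hp hδ x₀)
  obtain ⟨Te, hTe, hTee⟩ := exists_iInf_eq (exists_errBound_le M hn hB hψ σw hc hp hϑ hδ x₀)
  have hconv : M.Tconverge B σw cPE pPE ϑbar δ x₀ = ((max Tb Te : ℕ) : ℕ∞) := by
    have e : ((max Tb Te : ℕ) : ℕ∞) = max (Tb : ℕ∞) (Te : ℕ∞) :=
      (Nat.mono_cast (α := ℕ∞)).map_max
    rw [System.Tconverge, System.Tburnin, e]
    exact congrArg₂ max hTbe hTee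
  rw [hconv, System.Tcontained] at h
  -- The supremum may be infinite and not attained, so only some contained time past the finite
  -- convergence time is extracted.
  have : ∃ T : ℕ, (1 ≤ T ∧ ∀ x : M.𝕏, ‖(x : Vec n)‖₊ ≤ M.xbar B σw T (δ / 3) x₀ → x ∈ 𝒳) ∧
      max Tb Te + 1 ≤ T := by
    by_contra! hcon
    have h2 : (⨆ T ∈ {T : ℕ | 1 ≤ T ∧
        ∀ x : M.𝕏, ‖(x : Vec n)‖₊ ≤ M.xbar B σw T (δ / 3) x₀ → x ∈ 𝒳}, (T : ℕ∞))
        ≤ ((max Tb Te : ℕ) : ℕ∞) := by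
      refine iSup₂_le fun T hT => ?_
      have := hcon T hT
      exact_mod_cast Nat.lt_succ_iff.1 this
    have h3 := h.trans h2
    have h4 : max Tb Te + 1 ≤ max Tb Te := by exact_mod_cast h3
    omega
  obtain ⟨T, ⟨-, hT⟩, hle⟩ := this
  refine ⟨Tb, max Tb Te, hTb.1, le_max_left _ _, hTb.2,
    fun t ht => hTe.2 t ((le_max_right _ _).trans ht), fun x hx => hT x (hx.trans ?_)⟩
  exact xbar_mono M hn hB σw (by positivity) x₀ hle

end Bounds

/-! ### Adaptedness of the closed loop -/

section Measurability

variable {Ω : Type*} {n m d q : ℕ}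

/-- By Cramer's rule the entries are quotients of polynomials in the entries of `G`. -/
theorem measurable_matrix_inv_entry {mΩ : MeasurableSpace Ω} {G : Ω → Mat d d}
    (hG : ∀ i j, Measurable fun ω => G ω i j) (i j : Fin d) :
    Measurable fun ω => (G ω)⁻¹ i j := by
  have hdet : ∀ {H : Ω → Mat d d}, (∀ i j, Measurable fun ω => H ω i j) →
      Measurable fun ω => (H ω).det := by
    intro H hH
    simp only [Matrix.det_apply]
    exact Finset.measurable_fun_sum _ fun σ _ =>
      (Finset.measurable_fun_prod _ fun i _ => hH _ _).const_smul _
  simp only [Matrix.inv_def, Ring.inverse_eq_inv, Matrix.smul_apply, smul_eq_mul,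
    Matrix.adjugate_apply]
  refine (hdet hG).inv.mul (hdet fun k l => ?_)
  by_cases hk : k = j
  · subst hk; simp
  · simpa [Matrix.updateRow_apply, hk] using hG k l

theorem measurable_gram_entry {mΩ : MeasurableSpace Ω} (γ : ℝ) {ψ : ℕ → Ω → Fin d → ℝ} (t : ℕ)
    (hψ : ∀ s < t, Measurable (ψ s)) (i j : Fin d) :
    Measurable fun ω => gram γ (fun s => ψ s ω) t i j := by
  simp only [gram, Matrix.add_apply, Matrix.sum_apply, Matrix.vecMulVec_apply]
  refine measurable_const.add (Finset.measurable_fun_sum _ fun s hs => ?_)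
  have := hψ s (Finset.mem_range.1 hs)
  exact ((measurable_pi_apply i).comp this).mul ((measurable_pi_apply j).comp this)

theorem measurable_gram_inv_mulVec {mΩ : MeasurableSpace Ω} (γ : ℝ) {ψ : ℕ → Ω → Fin d → ℝ}
    (t : ℕ) (hψ : ∀ s < t, Measurable (ψ s)) {v : Ω → Fin d → ℝ} (hv : Measurable v) :
    Measurable fun ω => Matrix.mulVec (gram γ (fun s => ψ s ω) t)⁻¹ (v ω) := by
  refine measurable_pi_lambda _ fun i => ?_
  simp only [Matrix.mulVec, dotProduct]
  exact Finset.measurable_fun_sum _ fun j _ =>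
    (measurable_matrix_inv_entry (measurable_gram_entry γ t hψ) i j).mul
      ((measurable_pi_apply j).comp hv)

theorem measurable_dotProduct {mΩ : MeasurableSpace Ω} {v w : Ω → Fin d → ℝ} (hv : Measurable v)
    (hw : Measurable w) : Measurable fun ω => v ω ⬝ᵥ w ω := by
  simp only [dotProduct]
  exact Finset.measurable_fun_sum _ fun j _ =>
    ((measurable_pi_apply j).comp hv).mul ((measurable_pi_apply j).comp hw)

theorem measurable_gram_det {mΩ : MeasurableSpace Ω} (γ : ℝ) {ψ : ℕ → Ω → Fin d → ℝ}
    (t : ℕ) (hψ : ∀ s < t, Measurable (ψ s)) :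
    Measurable fun ω => (gram γ (fun s => ψ s ω) t).det := by
  simp only [Matrix.det_apply]
  exact Finset.measurable_fun_sum _ fun σ _ =>
    (Finset.measurable_fun_prod _ fun i _ => measurable_gram_entry γ t hψ _ _).const_smul _

theorem measurable_noiseSum {mΩ : MeasurableSpace Ω} {ψ : ℕ → Ω → Fin d → ℝ} {η : ℕ → Ω → ℝ}
    (t : ℕ) (hψ : ∀ s < t, Measurable (ψ s)) (hη : ∀ s < t, Measurable (η s)) :
    Measurable fun ω => noiseSum (fun s => ψ s ω) (fun s => η s ω) t := by
  simp only [noiseSum]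
  refine Finset.measurable_fun_sum _ fun s hs => ?_
  exact (hη s (Finset.mem_range.1 hs)).smul (hψ s (Finset.mem_range.1 hs))

theorem measurable_selfNorm {mΩ : MeasurableSpace Ω} (γ : ℝ) {ψ : ℕ → Ω → Fin d → ℝ}
    {η : ℕ → Ω → ℝ} (t : ℕ) (hψ : ∀ s < t, Measurable (ψ s)) (hη : ∀ s < t, Measurable (η s)) :
    Measurable fun ω => selfNorm γ (fun s => ψ s ω) (fun s => η s ω) t :=
  measurable_dotProduct (measurable_noiseSum t hψ hη)
    (measurable_gram_inv_mulVec γ t hψ (measurable_noiseSum t hψ hη))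

theorem measurable_ofLp_comp {mΩ : MeasurableSpace Ω} {k : ℕ} {v : Ω → Vec k}
    (hv : Measurable v) : Measurable fun ω => (v ω).ofLp :=
  (WithLp.measurable_ofLp _ _).comp hv

theorem measurable_transMul (A : Mat d n) : Measurable (transMul A) :=
  (LinearMap.continuous_of_finiteDimensional (Matrix.toEuclideanLin A.transpose)).measurable

theorem measurable_opNorm_sub {mΩ : MeasurableSpace Ω} {θ : Ω → Mat d n}
    (hθ : ∀ i j, Measurable fun ω => θ ω i j) (A : Mat d n) :
    Measurable fun ω => opNorm (θ ω - A) := by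
  let F : (Fin d → Fin n → ℝ) →ₗ[ℝ] (Vec n →L[ℝ] Vec d) :=
    LinearMap.toContinuousLinearMap.toLinearMap ∘ₗ Matrix.toEuclideanLin.toLinearMap ∘ₗ
      (Matrix.ofLinearEquiv ℝ).toLinearMap
  have hF : Continuous F := F.continuous_of_finiteDimensional
  have h : Measurable fun ω => (fun i j => θ ω i j - A i j : Fin d → Fin n → ℝ) :=
    measurable_pi_lambda _ fun i => measurable_pi_lambda _ fun j => (hθ i j).sub_const _
  exact (continuous_nnnorm.comp hF).measurable.comp h

variable {M : System n m d q}

theorem System.MeasurableMaps.pred (hM : M.MeasurableMaps) :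
    Measurable fun p : M.𝕏 × M.𝕌 => M.pred p.1 p.2 :=
  hM.f.add ((measurable_transMul _).comp hM.ψ)

theorem System.MeasurableMaps.g (hM : M.MeasurableMaps) :
    Measurable fun p : (M.𝕏 × M.𝕌) × M.𝕎 => M.g p.1.1 p.1.2 p.2 :=
  Measurable.subtype_mk
    ((hM.pred.comp measurable_fst).add (measurable_subtype_coe.comp measurable_snd))

theorem System.MeasurableMaps.α_comp (hM : M.MeasurableMaps) {mΩ : MeasurableSpace Ω}
    {x : Ω → M.𝕏} {s : Ω → M.𝕊} {θ : Ω → Mat d n} (hx : Measurable x) (hs : Measurable s)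
    (hθ : ∀ i j, Measurable fun ω => θ ω i j) :
    Measurable fun ω => M.α (x ω) (s ω) (θ ω) :=
  hM.α.comp (hx.prodMk (hs.prodMk
    (measurable_pi_lambda _ fun i => measurable_pi_lambda _ fun j => hθ i j)))

end Measurability

/-! ### The past of the two noise sequences and integration of fresh noise. -/

section Past

variable {Ω : Type*} {n m d q : ℕ} {M : System n m d q} (W : ℕ → Ω → M.𝕎) (S : ℕ → Ω → M.𝕊)

/-- The `σ`-algebra generated by the first `a` process noises and the first `b` exploratory
noises. -/
abbrev past (a b : ℕ) : MeasurableSpace Ω :=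
  MeasurableSpace.comap (fun ω => (fun i : Fin a => W i ω, fun j : Fin b => S j ω)) inferInstance

theorem measurable_W_past {a b i : ℕ} (h : i < a) : Measurable[past W S a b] (W i) :=
  ((measurable_pi_apply (⟨i, h⟩ : Fin a)).comp measurable_fst).comp
    (comap_measurable (fun ω => (fun i : Fin a => W i ω, fun j : Fin b => S j ω)))

theorem measurable_S_past {a b j : ℕ} (h : j < b) : Measurable[past W S a b] (S j) :=
  ((measurable_pi_apply (⟨j, h⟩ : Fin b)).comp measurable_snd).comp
    (comap_measurable (fun ω => (fun i : Fin a => W i ω, fun j : Fin b => S j ω)))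

theorem past_mono {a b a' b' : ℕ} (ha : a ≤ a') (hb : b ≤ b') :
    past W S a b ≤ past W S a' b' := by
  refine Measurable.comap_le ?_
  exact (@measurable_pi_lambda _ _ _ (past W S a' b') _ _ fun i =>
    measurable_W_past W S (i.2.trans_le ha)).prodMk
    (@measurable_pi_lambda _ _ _ (past W S a' b') _ _ fun i =>
    measurable_S_past W S (i.2.trans_le hb))

theorem past_le {mΩ : MeasurableSpace Ω} (hW : ∀ t, Measurable (W t)) (hS : ∀ t, Measurable (S t))
    (a b : ℕ) : past W S a b ≤ mΩ :=
  Measurable.comap_le ((measurable_pi_lambda _ fun _ => hW _).prodMk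
    (measurable_pi_lambda _ fun _ => hS _))

variable {W S}

theorem indepFun_fin_of_iIndepFun {β : Type*} [MeasurableSpace β] {mΩ : MeasurableSpace Ω}
    {P : Measure Ω} {Y : ℕ → Ω → β} (h : iIndepFun Y P) (hY : ∀ t, Measurable (Y t)) (a : ℕ) :
    IndepFun (fun ω => fun i : Fin a => Y i ω) (Y a) P := by
  have h1 := h.indepFun_finset (Finset.range a) {a} (by simp) hY
  have m1 : Measurable fun (v : Finset.range a → β) (i : Fin a) =>
      v ⟨i, Finset.mem_range.2 i.2⟩ := measurable_pi_lambda _ fun i => measurable_pi_apply _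
  have m2 : Measurable fun v : ({a} : Finset ℕ) → β => v ⟨a, Finset.mem_singleton_self a⟩ :=
    measurable_pi_apply _
  exact h1.comp m1 m2

theorem measurable_restrict_fin {β : Type*} [MeasurableSpace β] (a : ℕ) :
    Measurable fun v : ℕ → β => (fun i : Fin a => v i, v a) :=
  (measurable_pi_lambda _ fun i : Fin a => measurable_pi_apply (i : ℕ)).prodMk
    (measurable_pi_apply a)

variable {mΩ : MeasurableSpace Ω} {P : Measure Ω} [IsProbabilityMeasure P]
  {μw : Measure M.𝕎} {μs : Measure M.𝕊} {σw : ℝ≥0}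

/-- The two indices are separate because two pairings of fresh noise occur: the drift at time `t`
uses `(W t, S t)`, while the regressor at time `k + 1` uses `(W k, S (k + 1))`. -/
theorem System.NoiseAssumption.indep_past (h : M.NoiseAssumption P W S μw μs σw) (a b : ℕ) :
    IndepFun (fun ω => (fun i : Fin a => W i ω, fun j : Fin b => S j ω))
      (fun ω => (W a ω, S b ω)) P := by
  have hW := h.measurable_W
  have hS := h.measurable_S
  refine IndepFun.prodMk_swap (measurable_pi_lambda _ fun _ => hW _) (hW a)
    (measurable_pi_lambda _ fun _ => hS _) (hS b) ?_ (indepFun_fin_of_iIndepFun h.indep_W hW a)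
    (indepFun_fin_of_iIndepFun h.indep_S hS b)
  exact h.indep_W_S.comp (measurable_restrict_fin a) (measurable_restrict_fin b)

theorem System.NoiseAssumption.law_pair (h : M.NoiseAssumption P W S μw μs σw) (a b : ℕ) :
    P.map (fun ω => (S b ω, W a ω)) = μs.prod μw := by
  have m1 : Measurable fun v : ℕ → M.𝕎 => v a := measurable_pi_apply a
  have m2 : Measurable fun v : ℕ → M.𝕊 => v b := measurable_pi_apply b
  have h1 : IndepFun (S b) (W a) P := (h.indep_W_S.comp m1 m2).symm
  rw [(indepFun_iff_map_prod_eq_prod_map_map (h.measurable_S b).aemeasurable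
    (h.measurable_W a).aemeasurable).1 h1, h.law_S, h.law_W]

/-- Fresh noises are integrated out. -/
theorem System.NoiseAssumption.lintegral_past (h : M.NoiseAssumption P W S μw μs σw) {a b : ℕ}
    {A : Type*} [MeasurableSpace A] {Y : Ω → A} (hY : Measurable[past W S a b] Y)
    {H : A × (M.𝕊 × M.𝕎) → ℝ≥0∞} (hH : Measurable H) :
    ∫⁻ ω, H (Y ω, (S b ω, W a ω)) ∂P = ∫⁻ ω, ∫⁻ z, H (Y ω, z) ∂(μs.prod μw) ∂P := by
  have hYP : Measurable Y := hY.mono (past_le W S h.measurable_W h.measurable_S a b) le_rfl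
  have hi : IndepFun Y (fun ω => (S b ω, W a ω)) P := by
    have h1 := (h.indep_past a b).comp measurable_id measurable_swap
    exact indep_of_indep_of_le_left h1 hY.comap_le
  rw [lintegral_indepFun hYP ((h.measurable_S b).prodMk (h.measurable_W a)) hi hH, h.law_pair]

end Past

/-! ### States, controls and estimates as functions of the past noises. -/

section Adapted

variable {Ω : Type*} {n m d q : ℕ} {M : System n m d q} {W : ℕ → Ω → M.𝕎} {S : ℕ → Ω → M.𝕊}
  {x₀ : M.𝕏} {X : ℕ → Ω → M.𝕏} {U : ℕ → Ω → M.𝕌} {θhat : ℕ → Ω → Mat d n}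

/-- The regressors along a trajectory. -/
def regressor (X : ℕ → Ω → M.𝕏) (U : ℕ → Ω → M.𝕌) (s : ℕ) (ω : Ω) : Fin d → ℝ :=
  (M.ψ (X s ω) (U s ω)).ofLp

/-- The Gram matrix is invertible, so the minimiser is unique and explicit; its measurability need
not be assumed. -/
theorem estimate_eq (hcl : M.IsClosedLoop W S x₀ X U θhat) {t : ℕ} (ht : 1 ≤ t) (ω : Ω)
    (i : Fin d) (j : Fin n) :
    θhat t ω i j = Matrix.mulVec (gram M.γ (fun s => regressor X U s ω) t)⁻¹
      (noiseSum (fun s => regressor X U s ω)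
        (fun s => (X (s + 1) ω : Vec n) j - M.f (X s ω) (U s ω) j) t) i :=
  congrFun (eq_gram_inv_mulVec M.γ_pos _ _
    (normal_equations M _ _ t _ (hcl.estimate t ht ω) j)) i

/-- `U t` needs one more exploratory noise than `X t`, hence the index `t + 1`. The estimate at time
`t` uses regressors before `t` only, so it does not see `S t`. -/
theorem System.IsClosedLoop.adapted (hcl : M.IsClosedLoop W S x₀ X U θhat)
    (hM : M.MeasurableMaps) (t : ℕ) :
    Measurable[past W S t t] (X t) ∧ Measurable[past W S t (t + 1)] (U t) ∧
      ∀ i j, Measurable[past W S t t] fun ω => θhat t ω i j := by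
  induction t using Nat.strong_induction_on with
  | _ t ih =>
    have hX : Measurable[past W S t t] (X t) := by
      cases t with
      | zero =>
        have : X 0 = fun _ => x₀ := funext hcl.init
        rw [this]; exact measurable_const
      | succ s =>
        have : X (s + 1) = fun ω => M.g (X s ω) (U s ω) (W s ω) := funext (hcl.dynamics s)
        rw [this]
        obtain ⟨h1, h2, -⟩ := ih s (Nat.lt_succ_self s)
        exact hM.g.comp (((h1.mono (past_mono W S (by omega) (by omega)) le_rfl).prodMk
          (h2.mono (past_mono W S (by omega) (by omega)) le_rfl)).prodMk
          (measurable_W_past W S (Nat.lt_succ_self s)))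
    have hreg : ∀ s < t, Measurable[past W S t t] fun ω => (X s ω, U s ω) := fun s hs =>
      ((ih s hs).1.mono (past_mono W S (by omega) (by omega)) le_rfl).prodMk
        ((ih s hs).2.1.mono (past_mono W S (by omega) (by omega)) le_rfl)
    have hX' : ∀ s ≤ t, Measurable[past W S t t] (X s) := fun s hs => by
      rcases hs.eq_or_lt with rfl | hs
      · exact hX
      · exact (ih s hs).1.mono (past_mono W S (by omega) (by omega)) le_rfl
    have hθ : ∀ i j, Measurable[past W S t t] fun ω => θhat t ω i j := by
      intro i j
      rcases Nat.eq_zero_or_pos t with rfl | ht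
      · have : (fun ω => θhat 0 ω i j) = fun _ => M.ϑ₀ i j :=
          funext fun ω => by rw [hcl.estimate_zero]
        rw [this]; exact measurable_const
      · have hψ : ∀ s < t, Measurable[past W S t t] (regressor X U s) := fun s hs =>
          measurable_ofLp_comp (hM.ψ.comp (hreg s hs))
        have hy : ∀ s < t, Measurable[past W S t t]
            fun ω => (X (s + 1) ω : Vec n) j - M.f (X s ω) (U s ω) j := fun s hs =>
          (((measurable_pi_apply j).comp (measurable_ofLp_comp
            (measurable_subtype_coe.comp (hX' (s + 1) hs)))).sub
            ((measurable_pi_apply j).comp (measurable_ofLp_comp (hM.f.comp (hreg s hs)))))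
        simp only [estimate_eq hcl ht]
        exact (measurable_pi_apply i).comp
          (measurable_gram_inv_mulVec M.γ t hψ (measurable_noiseSum t hψ hy))
    refine ⟨hX, ?_, hθ⟩
    have : U t = fun ω => M.α (X t ω) (S t ω) (θhat (t - 1) ω) := funext (hcl.control t)
    rw [this]
    refine hM.α_comp (hX.mono (past_mono W S le_rfl (by omega)) le_rfl)
      (measurable_S_past W S (Nat.lt_succ_self t)) fun i j => ?_
    rcases Nat.eq_zero_or_pos t with rfl | ht
    · exact (hθ i j).mono (past_mono W S le_rfl (by omega)) le_rfl
    · exact ((ih (t - 1) (by omega)).2.2 i j).mono (past_mono W S (by omega) (by omega)) le_rfl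

end Adapted

/-! ### High-probability bounds on the noise -/

/-- A union bound with the summable weights `6 / (π² (t + 1)²)`. -/
theorem measure_exists_le_of_basel {Ω : Type*} [MeasurableSpace Ω] {P : Measure Ω}
    {A : ℕ → Set Ω} {δ : ℝ} (hδ : 0 ≤ δ)
    (h : ∀ t : ℕ, P (A t) ≤ ENNReal.ofReal (6 * δ / (Real.pi ^ 2 * ((t : ℝ) + 1) ^ 2))) :
    P (⋃ t, A t) ≤ ENNReal.ofReal δ := by
  have hs : HasSum (fun t : ℕ => 6 * δ / (Real.pi ^ 2 * ((t : ℝ) + 1) ^ 2)) δ := by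
    have h1 := (hasSum_nat_add_iff' 1).2 hasSum_zeta_two
    have h2 := h1.mul_left (6 * δ / Real.pi ^ 2)
    have e : 6 * δ / Real.pi ^ 2 * (Real.pi ^ 2 / 6 - ∑ i ∈ Finset.range 1, 1 / (i : ℝ) ^ 2)
        = δ := by
      have := Real.pi_ne_zero
      simp
      field_simp
    rw [e] at h2
    refine h2.congr_fun fun t => ?_
    have := Real.pi_ne_zero
    have : ((t : ℝ) + 1) ≠ 0 := by positivity
    push_cast
    field_simp
  calc P (⋃ t, A t) ≤ ∑' t, P (A t) := measure_iUnion_le _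
    _ ≤ ∑' t : ℕ, ENNReal.ofReal (6 * δ / (Real.pi ^ 2 * ((t : ℝ) + 1) ^ 2)) :=
        ENNReal.tsum_le_tsum h
    _ = ENNReal.ofReal δ := by
        rw [← ENNReal.ofReal_tsum_of_nonneg (fun t => by positivity) hs.summable, hs.tsum_eq]

theorem measure_abs_gt_le_of_subgaussian {Ω : Type*} [MeasurableSpace Ω] {P : Measure Ω}
    [IsProbabilityMeasure P] {Y : Ω → ℝ} {σ : ℝ≥0} (h : HasSubgaussianMGF Y (σ ^ 2) P) {l : ℝ}
    (hl : 0 ≤ l) :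
    P {ω | σ * √(2 * l) < |Y ω|} ≤ ENNReal.ofReal (2 * Real.exp (-l)) := by
  -- The tail exponent divides by `σ²`. When `σ = 0` the variable vanishes almost surely.
  rcases eq_or_ne σ 0 with rfl | hσ
  · have h0 : Y =ᵐ[P] 0 := by
      refine HasSubgaussianMGF.ae_eq_zero_of_hasSubgaussianMGF_zero ?_
      simpa using h
    have : P {ω | ((0 : ℝ≥0) : ℝ) * √(2 * l) < |Y ω|} = 0 := by
      refine measure_mono_null (fun ω hω => ?_) (ae_iff.1 h0)
      simpa using hω
    rw [this]; exact zero_le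
  · have hσ' : (0 : ℝ) < σ := by positivity
    have hε : 0 ≤ σ * √(2 * l) := by positivity
    have e : -(σ * √(2 * l)) ^ 2 / (2 * ((σ ^ 2 : ℝ≥0) : ℝ)) = -l := by
      rw [mul_pow, Real.sq_sqrt (by positivity)]
      push_cast
      field_simp
    have h1 := h.measure_ge_le hε
    have h2 := h.neg.measure_ge_le hε
    rw [e] at h1 h2
    have hsub : {ω | σ * √(2 * l) < |Y ω|} ⊆ {ω | σ * √(2 * l) ≤ Y ω} ∪
        {ω | σ * √(2 * l) ≤ (-Y) ω} := by
      intro ω hω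
      rcases lt_abs.1 (show σ * √(2 * l) < |Y ω| from hω) with h | h
      · exact Or.inl h.le
      · exact Or.inr h.le
    refine (measure_mono hsub).trans ((measure_union_le _ _).trans ?_)
    rw [two_mul (Real.exp _), ENNReal.ofReal_add (Real.exp_pos _).le (Real.exp_pos _).le]
    exact add_le_add
      ((ENNReal.le_ofReal_iff_toReal_le (measure_ne_top _ _) (Real.exp_pos _).le).2 h1)
      ((ENNReal.le_ofReal_iff_toReal_le (measure_ne_top _ _) (Real.exp_pos _).le).2 h2)

section Noise

variable {Ω : Type*} {mΩ : MeasurableSpace Ω} {P : Measure Ω}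
  {n m d q : ℕ} {M : System n m d q} {W : ℕ → Ω → M.𝕎} {S : ℕ → Ω → M.𝕊}
  {μw : Measure M.𝕎} {μs : Measure M.𝕊} {σw : ℝ≥0}

theorem System.NoiseAssumption.subGaussian_coord (h : M.NoiseAssumption P W S μw μs σw) (t : ℕ)
    (j : Fin n) : HasSubgaussianMGF (fun ω => (W t ω : Vec n) j) (σw ^ 2) P := by
  have := h.subGaussian t (EuclideanSpace.single j 1) (by simp)
  simpa [EuclideanSpace.inner_single_left] using this

theorem System.NoiseAssumption.measurable_coord (h : M.NoiseAssumption P W S μw μs σw) (t : ℕ)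
    (j : Fin n) : Measurable fun ω => (W t ω : Vec n) j :=
  (measurable_pi_apply j).comp
    (measurable_ofLp_comp (measurable_subtype_coe.comp (h.measurable_W t)))

variable [IsProbabilityMeasure P]

theorem System.NoiseAssumption.lintegral_prod_law (h : M.NoiseAssumption P W S μw μs σw)
    {H : M.𝕊 × M.𝕎 → ℝ≥0∞} (hH : Measurable H) :
    ∫⁻ z, H z ∂(μs.prod μw) = ∫⁻ ω, H (S 0 ω, W 0 ω) ∂P := by
  rw [← h.law_pair 0 0, lintegral_map hH ((h.measurable_S 0).prodMk (h.measurable_W 0))]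

theorem System.NoiseAssumption.isProbabilityMeasure_prod
    (h : M.NoiseAssumption P W S μw μs σw) : IsProbabilityMeasure (μs.prod μw) := by
  rw [← h.law_pair 0 0]
  exact Measure.isProbabilityMeasure_map
    ((h.measurable_S 0).prodMk (h.measurable_W 0)).aemeasurable

/-- With probability `1 - δ`, the process noise is bounded by `w̄` at all times. -/
theorem System.NoiseAssumption.measure_noise_gt (h : M.NoiseAssumption P W S μw μs σw)
    (hn : 0 < n) {δ : ℝ} (hδ : 0 < δ) (hδ1 : δ ≤ 1) :
    P {ω | ∃ t, System.wbar n σw (t + 1) δ < ‖(W t ω : Vec n)‖₊} ≤ ENNReal.ofReal δ := by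
  have hset : {ω | ∃ t, System.wbar n σw (t + 1) δ < ‖(W t ω : Vec n)‖₊}
      = ⋃ t, {ω | System.wbar n σw (t + 1) δ < ‖(W t ω : Vec n)‖₊} := by
    ext ω; simp
  rw [hset]
  refine measure_exists_le_of_basel hδ.le fun t => ?_
  have hn' : (1 : ℝ) ≤ n := by exact_mod_cast hn
  set l := Real.log (n * Real.pi ^ 2 * ((t + 1 : ℕ) : ℝ) ^ 2 / (3 * δ)) with hl
  have ht1 : (1 : ℝ) ≤ ((t + 1 : ℕ) : ℝ) := by exact_mod_cast Nat.le_add_left 1 t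
  have harg : 1 ≤ n * Real.pi ^ 2 * ((t + 1 : ℕ) : ℝ) ^ 2 / (3 * δ) := by
    rw [le_div_iff₀ (by positivity)]
    have hpi : (3 : ℝ) ≤ Real.pi ^ 2 := by nlinarith [Real.pi_gt_three]
    have h2 : (1 : ℝ) ≤ ((t + 1 : ℕ) : ℝ) ^ 2 := one_le_pow₀ ht1
    calc 1 * (3 * δ) ≤ 1 * 3 * 1 := by linarith
      _ ≤ n * Real.pi ^ 2 * ((t + 1 : ℕ) : ℝ) ^ 2 := by gcongr
  have hl0 : 0 ≤ l := Real.log_nonneg harg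
  have hw : (System.wbar n σw (t + 1) δ : ℝ) = σw * √(2 * n * l) := by
    rw [System.wbar, if_neg (Nat.succ_ne_zero t), NNReal.coe_mul,
      Real.coe_toNNReal _ (Real.sqrt_nonneg _)]
  -- If every coordinate is at most `σw √(2 l)`, the norm is at most `σw √(2 n l)`; the factor `n`
  -- inside the logarithm of `wbar` pays for the union over coordinates.
  have hsub : {ω | System.wbar n σw (t + 1) δ < ‖(W t ω : Vec n)‖₊}
      ⊆ ⋃ j, {ω | σw * √(2 * l) < |(W t ω : Vec n) j|} := by
    intro ω hω
    by_contra hcon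
    simp only [Set.mem_iUnion, Set.mem_ofPred_eq, not_exists, not_lt] at hcon
    refine absurd (show System.wbar n σw (t + 1) δ < ‖(W t ω : Vec n)‖₊ from hω) (not_lt.2 ?_)
    rw [← NNReal.coe_le_coe, hw, coe_nnnorm, EuclideanSpace.norm_eq]
    refine Real.sqrt_le_iff.2 ⟨by positivity, ?_⟩
    calc ∑ j, ‖(W t ω : Vec n) j‖ ^ 2 ≤ ∑ j : Fin n, (σw * √(2 * l)) ^ 2 := by
          refine Finset.sum_le_sum fun j _ => ?_
          exact pow_le_pow_left₀ (norm_nonneg _) (hcon j) 2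
      _ = (σw * √(2 * n * l)) ^ 2 := by
          rw [Finset.sum_const, Finset.card_univ, Fintype.card_fin, nsmul_eq_mul, mul_pow, mul_pow,
            Real.sq_sqrt (by positivity), Real.sq_sqrt (by positivity)]
          ring
  refine (measure_mono hsub).trans ((measure_iUnion_fintype_le _ _).trans ?_)
  refine (Finset.sum_le_sum fun j _ =>
    measure_abs_gt_le_of_subgaussian (h.subGaussian_coord t j) hl0).trans_eq ?_
  rw [Finset.sum_const, Finset.card_univ, Fintype.card_fin, nsmul_eq_mul,
    ← ENNReal.ofReal_natCast, ← ENNReal.ofReal_mul (by positivity), Real.exp_neg, hl,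
    Real.exp_log (by positivity)]
  congr 1
  push_cast
  field_simp
  ring

variable {x₀ : M.𝕏} {X : ℕ → Ω → M.𝕏} {U : ℕ → Ω → M.𝕌} {θhat : ℕ → Ω → Mat d n}

theorem System.IsClosedLoop.measurable_regressor (hcl : M.IsClosedLoop W S x₀ X U θhat)
    (hM : M.MeasurableMaps) (s : ℕ) : Measurable[past W S s (s + 1)] (regressor X U s) := by
  obtain ⟨h1, h2, -⟩ := hcl.adapted hM s
  exact measurable_ofLp_comp
    (hM.ψ.comp ((h1.mono (past_mono W S le_rfl (Nat.le_succ s)) le_rfl).prodMk h2))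

set_option maxHeartbeats 800000 in
/-- The self-normalised bound for one coordinate of the process noise. -/
theorem System.IsClosedLoop.measure_selfNorm_gt (hcl : M.IsClosedLoop W S x₀ X U θhat)
    (hM : M.MeasurableMaps) (h : M.NoiseAssumption P W S μw μs σw) (j : Fin n) {δ : ℝ}
    (hδ : 0 < δ) :
    P {ω | ∃ t, 2 * (σw : ℝ) ^ 2 * (Real.log (1 / δ) + 1 / 2 *
        Real.log ((gram M.γ (fun s => regressor X U s ω) t).det / M.γ ^ d))
      < selfNorm M.γ (fun s => regressor X U s ω) (fun s => (W s ω : Vec n) j) t}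
      ≤ ENNReal.ofReal δ := by
  have hγ := M.γ_pos
  rcases eq_or_ne σw 0 with rfl | hσ
  · have h0 : ∀ᵐ ω ∂P, ∀ s, (W s ω : Vec n) j = 0 := ae_all_iff.2 fun s =>
      HasSubgaussianMGF.ae_eq_zero_of_hasSubgaussianMGF_zero
        (by simpa using h.subGaussian_coord s j)
    refine le_trans (le_of_eq ?_) zero_le
    refine measure_mono_null (fun ω hω => ?_) (ae_iff.1 h0)
    intro hall
    obtain ⟨t, ht⟩ := hω
    simp [selfNorm, noiseSum, hall] at ht
  have hσ' : (0 : ℝ) < σw := by positivity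
  set ψ : Ω → ℕ → Fin d → ℝ := fun ω s => regressor X U s ω with hψ
  set η : Ω → ℕ → ℝ := fun ω s => (W s ω : Vec n) j with hη
  have hψm : ∀ t, ∀ s < t, Measurable[past W S t (t + 1)] (regressor X U s) := fun t s hs =>
    (hcl.measurable_regressor hM s).mono (past_mono W S hs.le (by omega)) le_rfl
  have hηm : ∀ t, ∀ s < t, Measurable[past W S t (t + 1)] fun ω => (W s ω : Vec n) j :=
    fun t s hs => (measurable_pi_apply j).comp
      (measurable_ofLp_comp (measurable_subtype_coe.comp (measurable_W_past W S hs)))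
  -- The method-of-mixtures supermartingale, normalised to `L 0 = 1` since the initial Gram
  -- determinant is `γ ^ d`.
  set L : ℕ → Ω → ℝ≥0∞ := fun t ω => ENNReal.ofReal (√(M.γ ^ d / (gram M.γ (ψ ω) t).det)
    * Real.exp (selfNorm M.γ (ψ ω) (η ω) t / (2 * (σw : ℝ) ^ 2))) with hL
  have hLm : ∀ t, Measurable[past W S t (t + 1)] (L t) := fun t =>
    ENNReal.measurable_ofReal.comp
      (((measurable_gram_det M.γ t (hψm t)).const_div _).sqrt.mul
        (((measurable_selfNorm M.γ t (hψm t) (hηm t)).div_const _).exp))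
  set u : ℕ → Ω → ℝ := fun t ω =>
    ψ ω t ⬝ᵥ (Matrix.mulVec (gram M.γ (ψ ω) t)⁻¹ (ψ ω t)) with hu
  set v : ℕ → Ω → ℝ := fun t ω =>
    ψ ω t ⬝ᵥ (Matrix.mulVec (gram M.γ (ψ ω) t)⁻¹ (noiseSum (ψ ω) (η ω) t)) with hv
  have hum : ∀ t, Measurable[past W S t (t + 1)] (u t) := fun t =>
    measurable_dotProduct (hcl.measurable_regressor hM t)
      (measurable_gram_inv_mulVec M.γ t (hψm t) (hcl.measurable_regressor hM t))
  have hvm : ∀ t, Measurable[past W S t (t + 1)] (v t) := fun t =>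
    measurable_dotProduct (hcl.measurable_regressor hM t)
      (measurable_gram_inv_mulVec M.γ t (hψm t) (measurable_noiseSum t (hψm t) (hηm t)))
  have hu0 : ∀ t ω, 0 ≤ u t ω := fun t ω => gram_inv_nonneg hγ _ _ _
  have hrec : ∀ t ω, L (t + 1) ω = L t ω * ENNReal.ofReal ((√(1 + u t ω))⁻¹ * Real.exp
      ((2 * η ω t * v t ω + η ω t ^ 2 * u t ω - v t ω ^ 2)
        / (2 * (σw : ℝ) ^ 2 * (1 + u t ω)))) := by
    intro t ω
    have hdet := gram_det_pos hγ (ψ ω) t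
    have h1u : 0 < 1 + u t ω := by linarith [hu0 t ω]
    simp only [hL]
    rw [← ENNReal.ofReal_mul (by positivity), det_gram_succ hγ,
      selfNorm_succ hγ (ψ ω) (η ω) t (u := u t ω) (m := v t ω) rfl rfl, add_div, Real.exp_add]
    have e1 : √(M.γ ^ d / ((gram M.γ (ψ ω) t).det * (1 + u t ω)))
        = √(M.γ ^ d / (gram M.γ (ψ ω) t).det) * (√(1 + u t ω))⁻¹ := by
      rw [← Real.sqrt_inv, ← Real.sqrt_mul (by positivity)]
      congr 1
      field_simp
    have e2 : (2 * η ω t * v t ω + η ω t ^ 2 * u t ω - v t ω ^ 2) / (1 + u t ω) / (2 * (σw : ℝ) ^ 2)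
        = (2 * η ω t * v t ω + η ω t ^ 2 * u t ω - v t ω ^ 2)
          / (2 * (σw : ℝ) ^ 2 * (1 + u t ω)) := by
      rw [div_div]; ring_nf
    have e3 : (ψ ω t ⬝ᵥ Matrix.mulVec (gram M.γ (ψ ω) t)⁻¹ (ψ ω t)) = u t ω := rfl
    rw [e2, e3, e1]
    congr 1
    ring
  set H : (ℝ≥0∞ × ℝ × ℝ) × (M.𝕊 × M.𝕎) → ℝ≥0∞ := fun p => p.1.1 *
    ENNReal.ofReal ((√(1 + p.1.2.1))⁻¹ * Real.exp ((2 * (p.2.2 : Vec n) j * p.1.2.2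
      + (p.2.2 : Vec n) j ^ 2 * p.1.2.1 - p.1.2.2 ^ 2) / (2 * (σw : ℝ) ^ 2 * (1 + p.1.2.1))))
    with hH
  have hcoord : Measurable fun w : M.𝕎 => (w : Vec n) j :=
    (measurable_pi_apply j).comp (measurable_ofLp_comp measurable_subtype_coe)
  have hHm : Measurable H := by
    have c1 : Measurable fun p : (ℝ≥0∞ × ℝ × ℝ) × (M.𝕊 × M.𝕎) => p.1.2.1 := by fun_prop
    have c2 : Measurable fun p : (ℝ≥0∞ × ℝ × ℝ) × (M.𝕊 × M.𝕎) => p.1.2.2 := by fun_prop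
    have c3 : Measurable fun p : (ℝ≥0∞ × ℝ × ℝ) × (M.𝕊 × M.𝕎) => (p.2.2 : Vec n) j :=
      hcoord.comp (measurable_snd.comp measurable_snd)
    exact (measurable_fst.comp measurable_fst).mul (ENNReal.measurable_ofReal.comp
      ((c1.const_add 1).sqrt.inv.mul ((((((c3.const_mul 2).mul c2).add ((c3.pow_const 2).mul c1)).sub
        (c2.pow_const 2)).div ((c1.const_add 1).const_mul _)).exp)))
  have hint : ∀ (x : ℝ≥0∞) (a b : ℝ), 0 ≤ a →
      ∫⁻ z, H ((x, a, b), z) ∂(μs.prod μw) ≤ x := by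
    intro x a b ha
    have h1a : 0 < √(1 + a) := Real.sqrt_pos.2 (by linarith)
    rw [h.lintegral_prod_law (H := fun z => H ((x, a, b), z)) (hHm.comp measurable_prodMk_left)]
    simp only [hH]
    simp_rw [ENNReal.ofReal_mul (inv_nonneg.2 h1a.le)]
    have hexpm : Measurable fun ω => ENNReal.ofReal (Real.exp ((2 * (W 0 ω : Vec n) j * b
      + (W 0 ω : Vec n) j ^ 2 * a - b ^ 2) / (2 * (σw : ℝ) ^ 2 * (1 + a)))) := by
      have c := h.measurable_coord 0 j
      exact ENNReal.measurable_ofReal.comp (((((c.const_mul 2).mul_const b).add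
        ((c.pow_const 2).mul_const a)).sub_const _).div_const _).exp
    rw [lintegral_const_mul _ (hexpm.const_mul _), lintegral_const_mul _ hexpm]
    have hb := lintegral_exp_quadratic_le hσ (h.measurable_coord 0 j) (h.subGaussian_coord 0 j) b ha
    calc x * (ENNReal.ofReal (√(1 + a))⁻¹ * _)
        ≤ x * (ENNReal.ofReal (√(1 + a))⁻¹ * ENNReal.ofReal √(1 + a)) := by gcongr
      _ = x := by
        rw [← ENNReal.ofReal_mul (inv_nonneg.2 h1a.le), inv_mul_cancel₀ h1a.ne',
          ENNReal.ofReal_one, mul_one]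
  have hpl : ∀ a b, past W S a b ≤ mΩ := past_le W S h.measurable_W h.measurable_S
  have hstep : ∀ t, ∀ A, MeasurableSet[past W S t (t + 1)] A →
      ∫⁻ ω in A, L (t + 1) ω ∂P ≤ ∫⁻ ω in A, L t ω ∂P := by
    intro t A hA
    have hA' := hpl _ _ _ hA
    rw [← lintegral_indicator hA', ← lintegral_indicator hA']
    -- The indicator of `A` is carried inside the past data, so that `lintegral_past` replaces
    -- conditional expectations.
    set Y : Ω → ℝ≥0∞ × ℝ × ℝ := fun ω => (A.indicator (L t) ω, u t ω, v t ω) with hY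
    have hYm : Measurable[past W S t (t + 1)] Y :=
      ((hLm t).indicator hA).prodMk ((hum t).prodMk (hvm t))
    have e : ∀ ω, A.indicator (L (t + 1)) ω = H (Y ω, (S (t + 1) ω, W t ω)) := by
      intro ω
      by_cases hω : ω ∈ A
      · simp only [hH, hY, Set.indicator_of_mem hω]
        exact hrec t ω
      · simp only [hH, hY, Set.indicator_of_notMem hω, zero_mul]
    simp_rw [e]
    rw [h.lintegral_past hYm hHm]
    exact lintegral_mono fun ω => hint _ _ _ (hu0 t ω)
  have hville := ville_inequality (P := P) (ℱ := fun t => past W S t (t + 1))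
    (fun a b hab => past_mono W S hab (by omega)) (fun t => hpl _ _) hLm hstep
    (ENNReal.ofReal (1 / δ))
  have hL0 : ∀ ω, L 0 ω = 1 := by
    intro ω
    simp only [hL]
    rw [selfNorm_zero, det_gram_zero, div_self (by positivity)]
    simp
  simp_rw [hL0, lintegral_const, measure_univ, mul_one] at hville
  have hsub : P {ω | ∃ t, 2 * (σw : ℝ) ^ 2 * (Real.log (1 / δ) + 1 / 2 *
        Real.log ((gram M.γ (ψ ω) t).det / M.γ ^ d)) < selfNorm M.γ (ψ ω) (η ω) t}
      ≤ P {ω | ∃ t, ENNReal.ofReal (1 / δ) ≤ L t ω} := by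
    refine measure_mono fun ω ⟨t, ht⟩ => ⟨t, ENNReal.ofReal_le_ofReal ?_⟩
    have hdet := gram_det_pos hγ (ψ ω) t
    set D := (gram M.γ (ψ ω) t).det with hD
    have hratio : 0 < D / M.γ ^ d := by positivity
    have h1 : Real.log (1 / δ) + 1 / 2 * Real.log (D / M.γ ^ d)
        ≤ selfNorm M.γ (ψ ω) (η ω) t / (2 * (σw : ℝ) ^ 2) := by
      rw [le_div_iff₀ (by positivity)]
      linarith
    have h2 := Real.exp_le_exp.2 h1
    rw [Real.exp_add, Real.exp_log (by positivity), mul_comm (1 / 2 : ℝ),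
      ← Real.rpow_def_of_pos hratio, ← Real.sqrt_eq_rpow] at h2
    calc 1 / δ = √(M.γ ^ d / D) * (1 / δ * √(D / M.γ ^ d)) := by
          rw [mul_left_comm, ← Real.sqrt_mul (by positivity)]
          have : M.γ ^ d / D * (D / M.γ ^ d) = 1 := by field_simp
          rw [this, Real.sqrt_one, mul_one]
      _ ≤ _ := mul_le_mul_of_nonneg_left h2 (Real.sqrt_nonneg _)
  refine hsub.trans ?_
  have hδ' : ENNReal.ofReal (1 / δ) ≠ 0 := by
    simp only [ne_eq, ENNReal.ofReal_eq_zero, not_le]; positivity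
  have h3 := ENNReal.mul_le_iff_le_inv hδ' ENNReal.ofReal_ne_top |>.1 hville
  rw [mul_one, ← ENNReal.ofReal_inv_of_pos (by positivity)] at h3
  simpa only [one_div, inv_inv] using h3

/-- The self-normalised bound for all coordinates of the process noise. -/
theorem System.IsClosedLoop.measure_sum_selfNorm_gt (hcl : M.IsClosedLoop W S x₀ X U θhat)
    (hM : M.MeasurableMaps) (h : M.NoiseAssumption P W S μw μs σw) (hn : 0 < n) {δ : ℝ}
    (hδ : 0 < δ) :
    P {ω | ∃ t, 2 * n * (σw : ℝ) ^ 2 * (Real.log (n / δ) + 1 / 2 *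
        Real.log ((gram M.γ (fun s => regressor X U s ω) t).det / M.γ ^ d))
      < ∑ j, selfNorm M.γ (fun s => regressor X U s ω) (fun s => (W s ω : Vec n) j) t}
      ≤ ENNReal.ofReal δ := by
  have hn' : (0 : ℝ) < n := by exact_mod_cast hn
  have hj := fun j => hcl.measure_selfNorm_gt hM h j (δ := δ / n) (by positivity)
  refine (measure_mono ?_).trans ((measure_iUnion_fintype_le P _).trans
    ((Finset.sum_le_sum fun j _ => hj j).trans_eq ?_))
  · rintro ω ⟨t, ht⟩
    by_contra hcon
    simp only [Set.mem_iUnion, Set.mem_ofPred_eq, not_exists, not_lt] at hcon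
    refine absurd ht (not_lt.2 ((Finset.sum_le_sum fun j _ => hcon j t).trans_eq ?_))
    rw [Finset.sum_const, Finset.card_univ, Fintype.card_fin, nsmul_eq_mul, one_div_div]
    ring
  · rw [Finset.sum_const, Finset.card_univ, Fintype.card_fin, nsmul_eq_mul,
      ← ENNReal.ofReal_natCast, ← ENNReal.ofReal_mul (by positivity)]
    congr 1
    field_simp

end Noise

/-! ### Certified trajectories: containment, excitation and estimation error -/

section Certified

variable {Ω : Type*} {n m d q : ℕ} {M : System n m d q} {W : ℕ → Ω → M.𝕎} {S : ℕ → Ω → M.𝕊}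
  {x₀ : M.𝕏} {X : ℕ → Ω → M.𝕏} {U : ℕ → Ω → M.𝕌} {θhat : ℕ → Ω → Mat d n}

/-- The event that up to time `r` the noise obeys its bound, and that all the estimates from time
`Tc` on that influence `X 0, …, X r` have an error of at most `ϑbar`. -/
def cert (W : ℕ → Ω → M.𝕎) (θhat : ℕ → Ω → Mat d n) (σw : ℝ≥0) (δ : ℝ) (ϑbar : ℝ≥0) (Tc r : ℕ) :
    Set Ω :=
  {ω | (∀ i < r, ‖(W i ω : Vec n)‖₊ ≤ System.wbar n σw (i + 1) δ) ∧
    ∀ s, Tc ≤ s → s + 1 < r → opNorm (θhat s ω - M.θstar) ≤ ϑbar}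

theorem cert_antitone (σw : ℝ≥0) (δ : ℝ) (ϑbar : ℝ≥0) (Tc : ℕ) :
    Antitone (cert W θhat σw δ ϑbar Tc) := fun _ _ h _ hω =>
  ⟨fun i hi => hω.1 i (hi.trans_le h), fun s hs hs' => hω.2 s hs (hs'.trans_le h)⟩

theorem System.IsClosedLoop.measurableSet_cert (hcl : M.IsClosedLoop W S x₀ X U θhat)
    (hM : M.MeasurableMaps) (σw : ℝ≥0) (δ : ℝ) (ϑbar : ℝ≥0) (Tc r : ℕ) :
    MeasurableSet[past W S r r] (cert W θhat σw δ ϑbar Tc r) := by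
  have e : cert W θhat σw δ ϑbar Tc r
      = (⋂ i ∈ Set.Iio r, {ω | ‖(W i ω : Vec n)‖₊ ≤ System.wbar n σw (i + 1) δ}) ∩
        ⋂ s ∈ {s | Tc ≤ s ∧ s + 1 < r}, {ω | opNorm (θhat s ω - M.θstar) ≤ ϑbar} := by
    ext ω
    simp [cert]
  rw [e]
  refine MeasurableSet.inter ?_ ?_
  · refine MeasurableSet.biInter (Set.to_countable _) fun i hi => ?_
    exact (measurable_nnnorm.comp (measurable_subtype_coe.comp (measurable_W_past W S hi)))
      measurableSet_Iic
  · refine MeasurableSet.biInter (Set.to_countable _) fun s hs => ?_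
    have h1 : s + 1 < r := hs.2
    exact (measurable_opNorm_sub (fun i j => ((hcl.adapted hM s).2.2 i j).mono
      (past_mono W S (by omega) (by omega)) le_rfl) M.θstar) measurableSet_Iic

theorem System.IsClosedLoop.state_eq_φ (hcl : M.IsClosedLoop W S x₀ X U θhat) (ω : Ω) (t : ℕ) :
    X t ω = M.φ x₀ (fun i => U i ω) (fun i => W i ω) t := by
  induction t with
  | zero => exact hcl.init ω
  | succ t ih => rw [hcl.dynamics, ih]; rfl

variable {B : Growth}

theorem System.IsClosedLoop.norm_control_le (hcl : M.IsClosedLoop W S x₀ X U θhat)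
    (hu : M.ConstrainedControls B) (t : ℕ) (ω : Ω) : ‖(U t ω : Vec m)‖₊ ≤ B.umax := by
  rw [hcl.control]; exact hu _ _ _

theorem System.IsClosedLoop.norm_state_le (hcl : M.IsClosedLoop W S x₀ X U θhat) (hn : 0 < n)
    (hB : M.ForwardComplete B) (hu : M.ConstrainedControls B) (σw : ℝ≥0) {δ : ℝ} (hδ : 0 < δ)
    {t : ℕ} {ω : Ω} (hω : ∀ i < t, ‖(W i ω : Vec n)‖₊ ≤ System.wbar n σw (i + 1) δ) :
    ‖(X t ω : Vec n)‖₊ ≤ M.xbar B σw t δ x₀ := by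
  rw [hcl.state_eq_φ ω t]
  refine (hB.bound t x₀ (fun i => U i ω) (fun i => W i ω)).trans ?_
  have h3 := hB.χ₃.1.strictMono.monotone
  have h4 := hB.χ₄.1.strictMono.monotone
  have h5 := hB.σ₁.strictMono.monotone
  have h6 := hB.σ₂.1.strictMono.monotone
  refine add_le_add (add_le_add (add_le_add le_rfl (h3 ?_)) (h4 ?_)) le_rfl
  · calc _ ≤ ∑ _i ∈ Finset.range t, B.σ₁ B.umax :=
          Finset.sum_le_sum fun i _ => h5 (hcl.norm_control_le hu i ω)
      _ = _ := by simp
  · calc _ ≤ ∑ _i ∈ Finset.range t, B.σ₂ (System.wbar n σw t δ) :=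
          Finset.sum_le_sum fun i hi => h6 ((hω i (Finset.mem_range.1 hi)).trans
            (wbar_mono hn σw hδ (Finset.mem_range.1 hi)))
      _ = _ := by simp

/-- Certified trajectories stay in the robustly positive invariant set. -/
theorem System.IsClosedLoop.cert_mem (hcl : M.IsClosedLoop W S x₀ X U θhat) (hn : 0 < n)
    (hB : M.ForwardComplete B) (hu : M.ConstrainedControls B) {σw : ℝ≥0} {δ : ℝ} (hδ : 0 < δ)
    {𝒳 : Set M.𝕏} {ϑbar : ℝ≥0} (hRPI : M.IsRPI 𝒳 ϑbar) {Tc : ℕ}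
    (hcont : ∀ x : M.𝕏, ‖(x : Vec n)‖₊ ≤ M.xbar B σw (Tc + 1) δ x₀ → x ∈ 𝒳) {r : ℕ} {ω : Ω}
    (hω : ω ∈ cert W θhat σw δ ϑbar Tc r) : X r ω ∈ 𝒳 := by
  induction r with
  | zero =>
    exact hcont _ ((hcl.norm_state_le hn hB hu σw hδ hω.1).trans
      (xbar_mono M hn hB σw hδ x₀ (Nat.zero_le _)))
  | succ r ih =>
    -- The control at time `r` uses the estimate at `r - 1`, which is certified only if `r - 1 ≥
    -- Tc`. Hence containment is needed up to time `Tc + 1`, the origin of the `+ 1` in the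
    -- hypothesis on the times.
    rcases Nat.lt_or_ge Tc r with hr | hr
    · rw [hcl.dynamics, hcl.control]
      exact hRPI.2 _ (ih (cert_antitone σw δ ϑbar Tc (Nat.le_succ r) hω)) _ _ _
        (hω.2 (r - 1) (by omega) (by omega))
    · exact hcont _ ((hcl.norm_state_le hn hB hu σw hδ hω.1).trans
        (xbar_mono M hn hB σw hδ x₀ (by omega)))

theorem System.IsClosedLoop.norm_regressor_le (hcl : M.IsClosedLoop W S x₀ X U θhat) (hn : 0 < n)
    (hB : M.ForwardComplete B) (hu : M.ConstrainedControls B) (hψ : M.PolyBasis B) {σw : ℝ≥0}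
    {δ : ℝ} (hδ : 0 < δ) {ϑbar : ℝ≥0} {Tc r s : ℕ} {ω : Ω}
    (hω : ω ∈ cert W θhat σw δ ϑbar Tc r) (hs : s ≤ r) :
    ‖M.ψ (X s ω) (U s ω)‖ ≤ M.zbar B σw (s + 1) δ x₀ := by
  have h1 : ‖M.ψ (X s ω) (U s ω)‖₊ ≤ M.zbar B σw (s + 1) δ x₀ := by
    refine (hψ.bound _ _).trans (hψ.mono ?_)
    rw [NNReal.sqrt_le_sqrt, Nat.add_sub_cancel]
    exact add_le_add (pow_le_pow_left₀ zero_le (hcl.norm_state_le hn hB hu σw hδ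
      fun i hi => hω.1 i (hi.trans_le hs)) 2)
      (pow_le_pow_left₀ zero_le (hcl.norm_control_le hu s ω) 2)
  exact_mod_cast h1

theorem System.IsClosedLoop.sum_regressor_le (hcl : M.IsClosedLoop W S x₀ X U θhat) (hn : 0 < n)
    (hB : M.ForwardComplete B) (hu : M.ConstrainedControls B) (hψ : M.PolyBasis B) {σw : ℝ≥0}
    {δ : ℝ} (hδ : 0 < δ) {ϑbar : ℝ≥0} {Tc r : ℕ} {ω : Ω}
    (hω : ω ∈ cert W θhat σw δ ϑbar Tc r) :
    ∑ s ∈ Finset.range (r + 1), ‖M.ψ (X s ω) (U s ω)‖ ^ 2 ≤ zsum M B σw (r + 1) δ x₀ := by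
  have e : Finset.Icc 1 (r + 1) = Finset.Ico (0 + 1) (r + 1 + 1) := by
    ext i; simp only [Finset.mem_Icc, Finset.mem_Ico]; omega
  rw [zsum, e, ← Finset.sum_Ico_add' (fun i => (M.zbar B σw i δ x₀ : ℝ) ^ 2), ← Finset.range_eq_Ico]
  refine Finset.sum_le_sum fun s hs => pow_le_pow_left₀ (norm_nonneg _) ?_ 2
  exact hcl.norm_regressor_le hn hB hu hψ hδ hω (Nat.lt_succ_iff.1 (Finset.mem_range.1 hs))

variable {mΩ : MeasurableSpace Ω} {P : Measure Ω} [IsProbabilityMeasure P]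
  {μw : Measure M.𝕎} {μs : Measure M.𝕊} {σw : ℝ≥0}

/-- The integral is `1 - ν(E) / 2`, and `1 - p / 2 ≤ exp (-p / 2)`. -/
theorem lintegral_ite_half_le {Z : Type*} [MeasurableSpace Z] {ν : Measure Z}
    [IsProbabilityMeasure ν] {E : Set Z} (hE : MeasurableSet E) {p : ℝ} (hp : p ≤ ν.real E) :
    ∫⁻ z, E.indicator (fun _ => (1 / 2 : ℝ≥0∞)) z + Eᶜ.indicator (fun _ => 1) z ∂ν
      ≤ ENNReal.ofReal (Real.exp (-p / 2)) := by
  rw [lintegral_add_left (measurable_const.indicator hE), lintegral_indicator_const hE,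
    lintegral_indicator_const hE.compl, one_mul]
  have h1 : ν Eᶜ = ENNReal.ofReal (1 - ν.real E) := by
    rw [← probReal_compl_eq_one_sub hE, ofReal_measureReal]
  have h2 : (1 / 2 : ℝ≥0∞) = ENNReal.ofReal (1 / 2) := by
    rw [ENNReal.ofReal_div_of_pos two_pos]; simp
  have h3 : ν.real E ≤ 1 := measureReal_le_one
  rw [h1, h2, ← ofReal_measureReal (μ := ν) (s := E), ← ENNReal.ofReal_mul (by norm_num),
    ← ENNReal.ofReal_add (by positivity) (by linarith)]
  refine ENNReal.ofReal_le_ofReal ?_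
  have := Real.add_one_le_exp (-p / 2)
  linarith

/-- The exponential weight that is halved at each excited time. -/
noncomputable def exciteWeight (X : ℕ → Ω → M.𝕏) (U : ℕ → Ω → M.𝕌) (c : ℝ) (ζ : Vec d) (k : ℕ)
    (ω : Ω) : ℝ≥0∞ :=
  open Classical in ∏ i ∈ Finset.range k,
    if c ≤ |inner ℝ ζ (M.ψ (X (i + 1) ω) (U (i + 1) ω))| ^ 2 then (1 / 2 : ℝ≥0∞) else 1

theorem System.IsClosedLoop.measurable_exciteWeight (hcl : M.IsClosedLoop W S x₀ X U θhat)
    (hM : M.MeasurableMaps) (c : ℝ) (ζ : Vec d) (k : ℕ) :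
    Measurable[past W S k (k + 1)] (exciteWeight X U c ζ k) := by
  classical
  have hψU : ∀ t, Measurable[past W S t (t + 1)] fun ω =>
      |inner ℝ ζ (M.ψ (X t ω) (U t ω))| ^ 2 := by
    intro t
    obtain ⟨h1, h2, -⟩ := hcl.adapted hM t
    have h3 := hM.ψ.comp ((h1.mono (past_mono W S le_rfl (Nat.le_succ t)) le_rfl).prodMk h2)
    exact (((continuous_const.inner continuous_id).abs.pow 2).measurable
      (f := fun v : Vec d => |inner ℝ ζ v| ^ 2)).comp h3
  unfold exciteWeight
  refine Finset.measurable_fun_prod _ fun i hi => ?_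
  have hi' := Finset.mem_range.1 hi
  exact Measurable.ite (((hψU (i + 1)).mono (past_mono W S (by omega) (by omega)) le_rfl)
    measurableSet_Ici) measurable_const measurable_const

/-- Given the past, each step multiplies the expected weight by at most `exp (-p / 2)`. The
indicator of certification makes this legitimate: it depends on the past, it decreases, and it
places `X k` in the invariant set. -/
theorem System.IsClosedLoop.lintegral_exciteWeight_le (hcl : M.IsClosedLoop W S x₀ X U θhat)
    (hM : M.MeasurableMaps) (h : M.NoiseAssumption P W S μw μs σw) (hn : 0 < n)
    (hB : M.ForwardComplete B) (hu : M.ConstrainedControls B) {δ : ℝ} (hδ : 0 < δ)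
    {𝒳 : Set M.𝕏} {ϑbar : ℝ≥0} (hRPI : M.IsRPI 𝒳 ϑbar) {Tc : ℕ}
    (hcont : ∀ x : M.𝕏, ‖(x : Vec n)‖₊ ≤ M.xbar B σw (Tc + 1) δ x₀ → x ∈ 𝒳)
    {XPE : Set (Vec n)} {c p : ℝ} (hexc : M.RegionallyExcited μw μs XPE c p)
    (hreach : M.reach B 𝒳 ⊆ XPE) {ζ : Vec d} (hζ : ‖ζ‖ = 1) (k : ℕ) :
    ∫⁻ ω, (cert W θhat σw δ ϑbar Tc k).indicator (exciteWeight X U c ζ k) ω ∂P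
      ≤ ENNReal.ofReal (Real.exp (-p / 2)) ^ k := by
  classical
  have hpl : ∀ a b, past W S a b ≤ mΩ := past_le W S h.measurable_W h.measurable_S
  have := h.isProbabilityMeasure_prod
  have hwm := fun k => hcl.measurable_exciteWeight hM c ζ k
  induction k with
  | zero =>
    have e : ∀ ω, exciteWeight X U c ζ 0 ω = 1 := fun ω => by simp [exciteWeight]
    refine (lintegral_mono (g := fun _ => 1) fun ω => ?_).trans (by simp)
    exact (Set.indicator_le_self _ _ _).trans (e ω).le
  | succ k ih =>
    set C := cert W θhat σw δ ϑbar Tc with hC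
    obtain ⟨hXm, hUm, hθm⟩ := hcl.adapted hM k
    have hle : past W S k k ≤ past W S k (k + 1) := past_mono W S le_rfl (Nat.le_succ k)
    set Y : Ω → ℝ≥0∞ × M.𝕏 × M.𝕌 × (Fin d → Fin n → ℝ) := fun ω =>
      ((C k).indicator (exciteWeight X U c ζ k) ω, X k ω, U k ω, fun i j => θhat k ω i j) with hY
    have hYm : Measurable[past W S k (k + 1)] Y :=
      ((hwm k).indicator (hle _ (hcl.measurableSet_cert hM σw δ ϑbar Tc k))).prodMk
        ((hXm.mono hle le_rfl).prodMk (hUm.prodMk (@measurable_pi_lambda _ _ _ (past W S k (k + 1))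
          _ _ fun i => @measurable_pi_lambda _ _ _ (past W S k (k + 1)) _ _ fun j =>
            (hθm i j).mono hle le_rfl)))
    set φ : (ℝ≥0∞ × M.𝕏 × M.𝕌 × (Fin d → Fin n → ℝ)) × (M.𝕊 × M.𝕎) → ℝ := fun p =>
      |inner ℝ ζ (M.ψ (M.g p.1.2.1 p.1.2.2.1 p.2.2)
        (M.α (M.g p.1.2.1 p.1.2.2.1 p.2.2) p.2.1 (Matrix.of p.1.2.2.2)))| ^ 2 with hφ
    have hφm : Measurable φ := by
      have hg : Measurable fun p : (ℝ≥0∞ × M.𝕏 × M.𝕌 × (Fin d → Fin n → ℝ)) × (M.𝕊 × M.𝕎) =>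
          M.g p.1.2.1 p.1.2.2.1 p.2.2 :=
        hM.g.comp (((measurable_fst.comp (measurable_snd.comp measurable_fst)).prodMk
          (measurable_fst.comp (measurable_snd.comp (measurable_snd.comp measurable_fst)))).prodMk
          (measurable_snd.comp measurable_snd))
      have ha : Measurable fun p : (ℝ≥0∞ × M.𝕏 × M.𝕌 × (Fin d → Fin n → ℝ)) × (M.𝕊 × M.𝕎) =>
          M.α (M.g p.1.2.1 p.1.2.2.1 p.2.2) p.2.1 (Matrix.of p.1.2.2.2) :=
        hM.α.comp (hg.prodMk ((measurable_fst.comp measurable_snd).prodMk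
          (measurable_snd.comp (measurable_snd.comp (measurable_snd.comp measurable_fst)))))
      exact (((continuous_const.inner continuous_id).abs.pow 2).measurable
        (f := fun v : Vec d => |inner ℝ ζ v| ^ 2)).comp (hM.ψ.comp (hg.prodMk ha))
    set E := {p | c ≤ φ p} with hE
    have hEm : MeasurableSet E := hφm measurableSet_Ici
    set F : (ℝ≥0∞ × M.𝕏 × M.𝕌 × (Fin d → Fin n → ℝ)) × (M.𝕊 × M.𝕎) → ℝ≥0∞ := fun p =>
      E.indicator (fun _ => (1 / 2 : ℝ≥0∞)) p + Eᶜ.indicator (fun _ => 1) p with hF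
    have hFm : Measurable F :=
      (measurable_const.indicator hEm).add (measurable_const.indicator hEm.compl)
    have hφY : ∀ ω, φ (Y ω, (S (k + 1) ω, W k ω))
        = |inner ℝ ζ (M.ψ (X (k + 1) ω) (U (k + 1) ω))| ^ 2 := by
      intro ω
      rw [hcl.control (k + 1) ω, hcl.dynamics k ω]
      rfl
    have hstep : ∀ ω, (C (k + 1)).indicator (exciteWeight X U c ζ (k + 1)) ω
        ≤ (Y ω).1 * F (Y ω, (S (k + 1) ω, W k ω)) := by
      intro ω
      by_cases hω : ω ∈ C (k + 1)
      · have hωk : ω ∈ C k := cert_antitone σw δ ϑbar Tc (Nat.le_succ k) hω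
        have e1 : F (Y ω, (S (k + 1) ω, W k ω))
            = if c ≤ |inner ℝ ζ (M.ψ (X (k + 1) ω) (U (k + 1) ω))| ^ 2
              then (1 / 2 : ℝ≥0∞) else 1 := by
          rw [← hφY ω]
          by_cases hc : c ≤ φ (Y ω, (S (k + 1) ω, W k ω)) <;> simp [hF, hE, hc]
        rw [Set.indicator_of_mem hω, e1]
        simp only [hY]
        rw [Set.indicator_of_mem hωk, exciteWeight, Finset.prod_range_succ, exciteWeight]
      · rw [Set.indicator_of_notMem hω]; exact zero_le
    calc ∫⁻ ω, (C (k + 1)).indicator (exciteWeight X U c ζ (k + 1)) ω ∂P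
        ≤ ∫⁻ ω, (Y ω).1 * F (Y ω, (S (k + 1) ω, W k ω)) ∂P := lintegral_mono hstep
      _ = ∫⁻ ω, ∫⁻ z, (Y ω).1 * F (Y ω, z) ∂(μs.prod μw) ∂P :=
          h.lintegral_past (H := fun p => p.1.1 * F p) hYm
            ((measurable_fst.comp measurable_fst).mul hFm)
      -- On `C k` the prediction from `X k` lies in the excited region, where the excitation
      -- probability holds for every parameter; accuracy of `θhat k` plays no role here. Off `C k`
      -- the first factor is zero.
      _ ≤ ∫⁻ ω, (Y ω).1 * ENNReal.ofReal (Real.exp (-p / 2)) ∂P := by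
          refine lintegral_mono fun ω => ?_
          have hFs : Measurable fun z => F (Y ω, z) := hFm.comp measurable_prodMk_left
          rw [lintegral_const_mul _ hFs]
          by_cases hω : ω ∈ C k
          · gcongr
            have hmem := hcl.cert_mem hn hB hu hδ hRPI hcont hω
            have hsec : MeasurableSet {z | c ≤ φ (Y ω, z)} :=
              (hφm.comp measurable_prodMk_left) measurableSet_Ici
            have hpE : p ≤ (μs.prod μw).real {z | c ≤ φ (Y ω, z)} := by
              refine (hexc (θhat k ω) (M.pred (X k ω) (U k ω))
                (hreach ⟨_, hmem, _, hcl.norm_control_le hu k ω, rfl⟩) ζ hζ).trans_eq ?_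
              congr 1
              ext z
              constructor
              · rintro ⟨_, hz⟩; exact hz
              · intro hz; exact ⟨M.maps_to _ _ _, hz⟩
            exact lintegral_ite_half_le hsec hpE
          · have : (Y ω).1 = 0 := Set.indicator_of_notMem hω _
            rw [this, zero_mul, zero_mul]
      _ = (∫⁻ ω, (C k).indicator (exciteWeight X U c ζ k) ω ∂P)
            * ENNReal.ofReal (Real.exp (-p / 2)) :=
          lintegral_mul_const _ (((hwm k).mono (hpl _ _) le_rfl).indicator
            (hpl _ _ _ (hcl.measurableSet_cert hM σw δ ϑbar Tc k)))
      _ ≤ ENNReal.ofReal (Real.exp (-p / 2)) ^ (k + 1) := by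
          rw [pow_succ]
          gcongr

end Certified

/-! ### Persistent excitation in all directions. -/

section Excitation

variable {Ω : Type*} {n m d q : ℕ} {M : System n m d q} {W : ℕ → Ω → M.𝕎} {S : ℕ → Ω → M.𝕊}
  {x₀ : M.𝕏} {X : ℕ → Ω → M.𝕏} {U : ℕ → Ω → M.𝕌} {θhat : ℕ → Ω → Mat d n} {B : Growth}

/-- The energy of the regressors at the times `1, …, k` in the direction `ζ`. -/
noncomputable def energy (X : ℕ → Ω → M.𝕏) (U : ℕ → Ω → M.𝕌) (ζ : Vec d) (k : ℕ) (ω : Ω) : ℝ :=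
  ∑ i ∈ Finset.range k, (inner ℝ ζ (M.ψ (X (i + 1) ω) (U (i + 1) ω)) : ℝ) ^ 2

/-- An excited time contributes at least `c` to the energy, hence a factor of at most `1 / 2` on the
left; every other factor is at most one. -/
theorem exp_energy_le_exciteWeight {c : ℝ} (hc : 0 < c) (ζ : Vec d) (k : ℕ) (ω : Ω) :
    ENNReal.ofReal (Real.exp (-(Real.log 2 / c * energy X U ζ k ω))) ≤ exciteWeight X U c ζ k ω := by
  classical
  have hl : 0 < Real.log 2 := Real.log_pos one_lt_two
  rw [exciteWeight, energy, Finset.mul_sum, ← Finset.sum_neg_distrib, Real.exp_sum,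
    ENNReal.ofReal_prod_of_nonneg fun _ _ => (Real.exp_pos _).le]
  refine Finset.prod_le_prod' fun i _ => ?_
  split_ifs with h
  · have h2 : (1 / 2 : ℝ≥0∞) = ENNReal.ofReal (Real.exp (-Real.log 2)) := by
      rw [Real.exp_neg, Real.exp_log two_pos, ENNReal.ofReal_inv_of_pos two_pos]; simp
    rw [h2]
    refine ENNReal.ofReal_le_ofReal (Real.exp_le_exp.2 (neg_le_neg ?_))
    rw [sq_abs] at h
    calc Real.log 2 = Real.log 2 / c * c := by field_simp
      _ ≤ _ := by gcongr
  · rw [← ENNReal.ofReal_one]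
    refine ENNReal.ofReal_le_ofReal (Real.exp_le_one_iff.2 ?_)
    have : 0 ≤ Real.log 2 / c *
        (inner ℝ ζ (M.ψ (X (i + 1) ω) (U (i + 1) ω)) : ℝ) ^ 2 := by positivity
    linarith

/-- A difference of squares: `⟨ζ - z, v⟩` and `⟨ζ + z, v⟩` are at most `‖ζ - z‖ ‖v‖` and `2 ‖v‖` in
absolute value. -/
theorem energy_le_add {ζ z : Vec d} (hζ : ‖ζ‖ = 1) (hz : ‖z‖ = 1) (k : ℕ) (ω : Ω) :
    energy X U z k ω ≤ energy X U ζ k ω + 2 * ‖ζ - z‖ *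
      ∑ i ∈ Finset.range k, ‖M.ψ (X (i + 1) ω) (U (i + 1) ω)‖ ^ 2 := by
  rw [energy, energy, Finset.mul_sum, ← Finset.sum_add_distrib]
  refine Finset.sum_le_sum fun i _ => ?_
  set v := M.ψ (X (i + 1) ω) (U (i + 1) ω)
  have h1 : (inner ℝ z v : ℝ) ^ 2 - (inner ℝ ζ v : ℝ) ^ 2
      = -(inner ℝ (ζ - z) v : ℝ) * inner ℝ (ζ + z) v := by
    rw [inner_sub_left, inner_add_left]; ring
  have h2 : |(inner ℝ (ζ - z) v : ℝ)| ≤ ‖ζ - z‖ * ‖v‖ := abs_real_inner_le_norm _ _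
  have h3 : |(inner ℝ (ζ + z) v : ℝ)| ≤ 2 * ‖v‖ := by
    refine (abs_real_inner_le_norm _ _).trans ?_
    gcongr
    calc ‖ζ + z‖ ≤ ‖ζ‖ + ‖z‖ := norm_add_le _ _
      _ = 2 := by rw [hζ, hz]; norm_num
  have h4 : -(inner ℝ (ζ - z) v : ℝ) * inner ℝ (ζ + z) v ≤ ‖ζ - z‖ * ‖v‖ * (2 * ‖v‖) := by
    refine (le_abs_self _).trans ?_
    rw [abs_mul, abs_neg]
    gcongr
  nlinarith

/-- The event that the regressors of a certified trajectory are insufficiently excited. -/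
def poorlyExcited (W : ℕ → Ω → M.𝕎) (X : ℕ → Ω → M.𝕏) (U : ℕ → Ω → M.𝕌) (θhat : ℕ → Ω → Mat d n)
    (σw : ℝ≥0) (δ : ℝ) (ϑbar : ℝ≥0) (Tc : ℕ) (l : ℝ) (k : ℕ) : Set Ω :=
  {ω | ω ∈ cert W θhat σw δ ϑbar Tc k ∧ ∃ ζ : Vec d, ‖ζ‖ = 1 ∧ energy X U ζ k ω < l}

variable {mΩ : MeasurableSpace Ω} {P : Measure Ω} [IsProbabilityMeasure P]
  {μw : Measure M.𝕎} {μs : Measure M.𝕊} {σw : ℝ≥0}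

/-- A Chernoff bound: the mean weight is at most `exp (-p k / 2)`, while low energy forces the
weight above `exp (-log 2 * p k / 2)`. -/
theorem System.IsClosedLoop.measure_energy_lt (hcl : M.IsClosedLoop W S x₀ X U θhat)
    (hM : M.MeasurableMaps) (h : M.NoiseAssumption P W S μw μs σw) (hn : 0 < n)
    (hB : M.ForwardComplete B) (hu : M.ConstrainedControls B) {δ : ℝ} (hδ : 0 < δ)
    {𝒳 : Set M.𝕏} {ϑbar : ℝ≥0} (hRPI : M.IsRPI 𝒳 ϑbar) {Tc : ℕ}
    (hcont : ∀ x : M.𝕏, ‖(x : Vec n)‖₊ ≤ M.xbar B σw (Tc + 1) δ x₀ → x ∈ 𝒳)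
    {XPE : Set (Vec n)} {c p : ℝ} (hc : 0 < c) (hexc : M.RegionallyExcited μw μs XPE c p)
    (hreach : M.reach B 𝒳 ⊆ XPE) {ζ : Vec d} (hζ : ‖ζ‖ = 1) (k : ℕ) :
    P {ω | ω ∈ cert W θhat σw δ ϑbar Tc k ∧ energy X U ζ k ω ≤ c * p * k / 2}
      ≤ ENNReal.ofReal (Real.exp (-((1 - Real.log 2) * p * k / 2))) := by
  have hl : 0 < Real.log 2 := Real.log_pos one_lt_two
  have h1 := hcl.lintegral_exciteWeight_le hM h hn hB hu hδ hRPI hcont hexc hreach hζ k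
  set a := ENNReal.ofReal (Real.exp (-(Real.log 2 * p * k / 2))) with ha
  have hsub : {ω | ω ∈ cert W θhat σw δ ϑbar Tc k ∧ energy X U ζ k ω ≤ c * p * k / 2}
      ⊆ {ω | a ≤ (cert W θhat σw δ ϑbar Tc k).indicator (exciteWeight X U c ζ k) ω} := by
    rintro ω ⟨hω, hE⟩
    rw [Set.mem_ofPred_eq, Set.indicator_of_mem hω]
    refine le_trans (ENNReal.ofReal_le_ofReal (Real.exp_le_exp.2 (neg_le_neg ?_)))
      (exp_energy_le_exciteWeight hc ζ k ω)
    calc Real.log 2 / c * energy X U ζ k ω ≤ Real.log 2 / c * (c * p * k / 2) := by gcongr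
      _ = Real.log 2 * p * k / 2 := by field_simp
  have hle := past_le W S h.measurable_W h.measurable_S
  have hm : Measurable ((cert W θhat σw δ ϑbar Tc k).indicator (exciteWeight X U c ζ k)) :=
    ((hcl.measurable_exciteWeight hM c ζ k).mono (hle _ _) le_rfl).indicator
      (hle _ _ _ (hcl.measurableSet_cert hM σw δ ϑbar Tc k))
  have h2 := (mul_meas_ge_le_lintegral (μ := P) hm a).trans h1
  have ha0 : a ≠ 0 := by
    simp only [ha, ne_eq, ENNReal.ofReal_eq_zero, not_le]; positivity
  refine (measure_mono hsub).trans ((ENNReal.mul_le_iff_le_inv ha0 ENNReal.ofReal_ne_top |>.1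
    h2).trans_eq ?_)
  rw [ha, ← ENNReal.ofReal_inv_of_pos (Real.exp_pos _), ← Real.exp_neg,
    ← ENNReal.ofReal_pow (Real.exp_pos _).le, ← ENNReal.ofReal_mul (Real.exp_pos _).le,
    ← Real.exp_nat_mul, ← Real.exp_add]
  congr 2
  ring

/-- The probability of insufficient excitation at a time past the burn-in. -/
theorem System.IsClosedLoop.measure_poorlyExcited (hcl : M.IsClosedLoop W S x₀ X U θhat)
    (hM : M.MeasurableMaps) (h : M.NoiseAssumption P W S μw μs σw) (hn : 0 < n) (hd : 0 < d)
    (hB : M.ForwardComplete B) (hu : M.ConstrainedControls B) (hψ : M.PolyBasis B)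
    {δ : ℝ} (hδ : 0 < δ) {𝒳 : Set M.𝕏} {ϑbar : ℝ≥0} (hRPI : M.IsRPI 𝒳 ϑbar) {Tc : ℕ}
    (hcont : ∀ x : M.𝕏, ‖(x : Vec n)‖₊ ≤ M.xbar B σw (Tc + 1) δ x₀ → x ∈ 𝒳)
    {XPE : Set (Vec n)} {c p : ℝ} (hc : 0 < c) (hp : 0 < p)
    (hexc : M.RegionallyExcited μw μs XPE c p) (hreach : M.reach B 𝒳 ⊆ XPE) {k : ℕ}
    {ρ : ℝ} (hρ : 0 < ρ)
    (hburn : 2 / ((1 - Real.log 2) * p) *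
        (d * Real.log (1 + 16 * zsum M B σw (k + 1) δ x₀ / (c * p * k)) + Real.log (1 / ρ))
        ≤ (k : ℝ)) :
    P (poorlyExcited W X U θhat σw δ ϑbar Tc (c * p * k / 4) k) ≤ ENNReal.ofReal ρ := by
  -- At `k = 0` the event is empty because energies are not negative. This case occurs when the
  -- burn-in time is 1.
  rcases Nat.eq_zero_or_pos k with rfl | hk
  · have : poorlyExcited W X U θhat σw δ ϑbar Tc (c * p * (0 : ℕ) / 4) 0 = ∅ := by
      ext ω
      simp [poorlyExcited, energy]
    rw [this, measure_empty]; exact zero_le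
  have hk' : (0 : ℝ) < k := by exact_mod_cast hk
  have hlog2 : 0 < 1 - Real.log 2 := by linarith [Real.log_two_lt_d9]
  set Z := zsum M B σw (k + 1) δ x₀ with hZ
  have hZ0 : 0 ≤ Z := zsum_nonneg ..
  -- Moving to a net point at distance at most `2 / R` changes the energy by at most `4 Z / R = c p
  -- k / 4`, so energy below `c p k / 4` becomes energy below `c p k / 2`.
  set R := 16 * Z / (c * p * k) with hR
  have hR0 : 0 ≤ R := by positivity
  obtain ⟨N, hNc, hN1, hNcov⟩ := exists_sphere_net hd hR0
  have hsub : poorlyExcited W X U θhat σw δ ϑbar Tc (c * p * k / 4) k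
      ⊆ ⋃ z ∈ N, {ω | ω ∈ cert W θhat σw δ ϑbar Tc k ∧ energy X U z k ω ≤ c * p * k / 2} := by
    rintro ω ⟨hω, ζ, hζ, hE⟩
    obtain ⟨z, hz, hzR⟩ := hNcov ζ hζ
    simp only [Set.mem_iUnion]
    refine ⟨z, hz, hω, ?_⟩
    have h1 := energy_le_add (X := X) (U := U) hζ (hN1 z hz) k ω
    have h2 : ∑ i ∈ Finset.range k, ‖M.ψ (X (i + 1) ω) (U (i + 1) ω)‖ ^ 2 ≤ Z := by
      refine le_trans ?_ (hcl.sum_regressor_le hn hB hu hψ hδ hω)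
      rw [Finset.sum_range_succ']
      exact le_add_of_nonneg_right (sq_nonneg _)
    have h3 : 2 * ‖ζ - z‖ * Z ≤ c * p * k / 4 := by
      rw [hR, div_mul_eq_mul_div, div_le_iff₀ (by positivity)] at hzR
      linarith
    have h4 : 2 * ‖ζ - z‖ * ∑ i ∈ Finset.range k, ‖M.ψ (X (i + 1) ω) (U (i + 1) ω)‖ ^ 2
        ≤ 2 * ‖ζ - z‖ * Z := by gcongr
    linarith
  refine (measure_mono hsub).trans ((measure_biUnion_finset_le _ _).trans ?_)
  refine (Finset.sum_le_sum fun z hz => hcl.measure_energy_lt hM h hn hB hu hδ hRPI hcont hc hexc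
    hreach (hN1 z hz) k).trans ?_
  rw [Finset.sum_const, nsmul_eq_mul, ← ENNReal.ofReal_natCast,
    ← ENNReal.ofReal_mul (by positivity)]
  refine ENNReal.ofReal_le_ofReal ?_
  have h1R : 0 < 1 + R := by linarith
  have h5 : d * Real.log (1 + R) + Real.log (1 / ρ) ≤ (1 - Real.log 2) * p * k / 2 := by
    rw [div_mul_eq_mul_div, div_le_iff₀ (by positivity)] at hburn
    linarith
  calc (N.card : ℝ) * Real.exp (-((1 - Real.log 2) * p * k / 2))
      ≤ (1 + R) ^ d * Real.exp (-(d * Real.log (1 + R) + Real.log (1 / ρ))) := by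
        gcongr
    _ = ρ := by
        rw [neg_add, Real.exp_add, Real.exp_neg, Real.exp_nat_mul, Real.exp_log h1R, one_div,
          Real.log_inv, neg_neg, Real.exp_log hρ]
        field_simp

end Excitation

/-! ### The estimation error and the probability of certification. -/

section ErrorBound

variable {Ω : Type*} {n m d q : ℕ} {M : System n m d q} {W : ℕ → Ω → M.𝕎} {S : ℕ → Ω → M.𝕊}
  {x₀ : M.𝕏} {X : ℕ → Ω → M.𝕏} {U : ℕ → Ω → M.𝕌} {θhat : ℕ → Ω → Mat d n} {B : Growth}

theorem energy_smul (v : Vec d) (k : ℕ) (ω : Ω) (a : ℝ) :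
    energy X U (a • v) k ω = a ^ 2 * energy X U v k ω := by
  simp only [energy, inner_smul_left, mul_pow, Finset.mul_sum, RCLike.conj_to_real]

/-- On a certified, excited trajectory the Gram matrix is bounded below. -/
theorem le_gram_of_excited {l : ℝ} {k : ℕ} {ω : Ω}
    (hE : ∀ ζ : Vec d, ‖ζ‖ = 1 → l ≤ energy X U ζ k ω) (γ : ℝ) (v : Fin d → ℝ) :
    (l + γ) * (v ⬝ᵥ v)
      ≤ v ⬝ᵥ (Matrix.mulVec (gram γ (fun s => regressor X U s ω) (k + 1)) v) := by
  set w : Vec d := WithLp.toLp 2 v with hw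
  have hww : v ⬝ᵥ v = ‖w‖ ^ 2 := by
    rw [EuclideanSpace.real_norm_sq_eq]
    simp [dotProduct, sq, hw]
  have hen : energy X U w k ω ≤ ∑ s ∈ Finset.range (k + 1),
      (regressor X U s ω ⬝ᵥ v) * (regressor X U s ω ⬝ᵥ v) := by
    -- The regressor at time 0 is absent from the energy, since `X 0` is not perturbed by noise; it
    -- adds a nonnegative term to the Gram form.
    rw [Finset.sum_range_succ', energy]
    refine le_add_of_le_of_nonneg (Finset.sum_le_sum fun i _ => le_of_eq ?_) (mul_self_nonneg _)
    rw [sq]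
    have : (inner ℝ w (M.ψ (X (i + 1) ω) (U (i + 1) ω)) : ℝ) = regressor X U (i + 1) ω ⬝ᵥ v := by
      simp [PiLp.inner_apply, regressor, dotProduct, hw]
    rw [this]
  rw [dotProduct_gram_mulVec, hww, add_mul, add_comm]
  refine add_le_add le_rfl (le_trans ?_ hen)
  rcases eq_or_ne w 0 with h0 | h0
  · rw [h0]
    simp [energy]
  · have hn : ‖w‖ ≠ 0 := norm_ne_zero_iff.2 h0
    have h1 := hE (‖w‖⁻¹ • w) (by rw [norm_smul, norm_inv, norm_norm, inv_mul_cancel₀ hn])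
    rw [energy_smul, inv_pow, ← div_eq_inv_mul, le_div_iff₀ (by positivity)] at h1
    exact h1

theorem System.IsClosedLoop.normal_equations_noise (hcl : M.IsClosedLoop W S x₀ X U θhat) {t : ℕ}
    (ht : 1 ≤ t) (ω : Ω) (j : Fin n) :
    Matrix.mulVec (gram M.γ (fun s => regressor X U s ω) t) (fun i => θhat t ω i j)
      = ∑ s ∈ Finset.range t, ((regressor X U s ω ⬝ᵥ fun i => M.θstar i j)
        + (W s ω : Vec n) j) • regressor X U s ω := by
  refine (normal_equations M _ _ t _ (hcl.estimate t ht ω) j).trans ?_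
  refine Finset.sum_congr rfl fun s _ => ?_
  have : (X (s + 1) ω : Vec n) = M.f (X s ω) (U s ω) + transMul M.θstar (M.ψ (X s ω) (U s ω))
      + (W s ω : Vec n) := by rw [hcl.dynamics]; rfl
  have e : (X (s + 1) ω : Vec n) j - M.f (X s ω) (U s ω) j
      = (regressor X U s ω ⬝ᵥ fun i => M.θstar i j) + (W s ω : Vec n) j := by
    rw [this]
    simp only [PiLp.add_apply, transMul_apply, regressor]
    ring
  rw [e]
  rfl

/-- The estimation error bound on a certified, excited trajectory. -/
theorem System.IsClosedLoop.opNorm_error_le (hcl : M.IsClosedLoop W S x₀ X U θhat) (hn : 0 < n)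
    (hB : M.ForwardComplete B) (hu : M.ConstrainedControls B) (hψ : M.PolyBasis B)
    {σw ϑbar : ℝ≥0} {δ : ℝ} (hδ : 0 < δ) {c p : ℝ} (hc : 0 < c) (hp : 0 < p) {Tc k : ℕ} {ω : Ω}
    (hω : ω ∈ cert W θhat σw (δ / 3) ϑbar Tc k)
    (hE : ∀ ζ : Vec d, ‖ζ‖ = 1 → c * p * k / 4 ≤ energy X U ζ k ω)
    (hQ : ∑ j, selfNorm M.γ (fun s => regressor X U s ω) (fun s => (W s ω : Vec n) j) (k + 1)
      ≤ 2 * n * (σw : ℝ) ^ 2 * (Real.log (n / (δ / 3)) + 1 / 2 *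
        Real.log ((gram M.γ (fun s => regressor X U s ω) (k + 1)).det / M.γ ^ d))) :
    (opNorm (θhat (k + 1) ω - M.θstar) : ℝ) ≤ M.errBound B σw c p (k + 1) δ x₀ := by
  have hγ := M.γ_pos
  have hl : 0 < c * p * k / 4 + M.γ := by positivity
  have h1 := frobNorm_error_le hγ (fun s => regressor X U s ω) (fun s j => (W s ω : Vec n) j)
    (k + 1) (θhat (k + 1) ω) M.θstar (hcl.normal_equations_noise (Nat.le_add_left 1 k) ω) hl.le
    (le_gram_of_excited hE M.γ)
  have hdet := gram_det_pos hγ (fun s => regressor X U s ω) (k + 1)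
  have hβ : (gram M.γ (fun s => regressor X U s ω) (k + 1)).det
      ≤ M.βmax B σw (k + 1) (δ / 3) x₀ ^ d := by
    refine (det_gram_le hγ _ _).trans (pow_le_pow_left₀ ?_ ?_ d)
    · exact add_nonneg (Finset.sum_nonneg fun _ _ => dotProduct_self_nonneg' _) hγ.le
    · rw [System.βmax]
      refine add_le_add (le_trans (le_of_eq (Finset.sum_congr rfl fun s _ => ?_))
        (hcl.sum_regressor_le hn hB hu hψ (by positivity) hω)) le_rfl
      rw [EuclideanSpace.real_norm_sq_eq]
      simp [dotProduct, sq, regressor]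
  have hβ0 : 0 < M.βmax B σw (k + 1) (δ / 3) x₀ :=
    add_pos_of_nonneg_of_pos (Finset.sum_nonneg fun _ _ => sq_nonneg _) hγ
  have hlog : Real.log ((gram M.γ (fun s => regressor X U s ω) (k + 1)).det / M.γ ^ d)
      ≤ d * Real.log (M.βmax B σw (k + 1) (δ / 3) x₀ * M.γ⁻¹) := by
    rw [← Real.log_pow, mul_pow, inv_pow, ← div_eq_mul_inv]
    exact Real.log_le_log (by positivity) (by gcongr)
  have hQ2 : √(∑ j, selfNorm M.γ (fun s => regressor X U s ω)
        (fun s => (W s ω : Vec n) j) (k + 1))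
      ≤ σw * √(2 * n * (Real.log (3 * n / δ)
        + (d : ℝ) / 2 * Real.log (M.βmax B σw (k + 1) (δ / 3) x₀ * M.γ⁻¹))) := by
    rw [← Real.sqrt_sq (NNReal.coe_nonneg σw), ← Real.sqrt_mul (sq_nonneg _)]
    refine Real.sqrt_le_sqrt (hQ.trans ?_)
    have e : (n : ℝ) / (δ / 3) = 3 * n / δ := by field_simp
    rw [e]
    calc 2 * n * (σw : ℝ) ^ 2 * (Real.log (3 * n / δ) + 1 / 2 * _)
        ≤ 2 * n * (σw : ℝ) ^ 2 * (Real.log (3 * n / δ) + 1 / 2 *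
          (d * Real.log (M.βmax B σw (k + 1) (δ / 3) x₀ * M.γ⁻¹))) := by gcongr
      _ = _ := by ring
  have e2 : c * p / 4 * (((k + 1 : ℕ) : ℝ) - 1) + M.γ = c * p * k / 4 + M.γ := by
    push_cast; ring
  rw [System.errBound, e2, one_div, le_inv_mul_iff₀ (Real.sqrt_pos.2 hl)]
  calc √(c * p * k / 4 + M.γ) * (opNorm (θhat (k + 1) ω - M.θstar) : ℝ)
      ≤ √(c * p * k / 4 + M.γ) * frobNorm (θhat (k + 1) ω - M.θstar) := by
        gcongr; exact opNorm_le_frobNorm _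
    _ ≤ _ := h1.trans (add_le_add le_rfl hQ2)

variable {mΩ : MeasurableSpace Ω} {P : Measure Ω} [IsProbabilityMeasure P]
  {μw : Measure M.𝕎} {μs : Measure M.𝕊} {σw : ℝ≥0}

/-- With probability `1 - δ`, the trajectory is certified at all times. -/
theorem System.IsClosedLoop.measure_not_cert (hcl : M.IsClosedLoop W S x₀ X U θhat)
    (hM : M.MeasurableMaps) (h : M.NoiseAssumption P W S μw μs σw) (hn : 0 < n) (hd : 0 < d)
    (hB : M.ForwardComplete B) (hu : M.ConstrainedControls B) (hψ : M.PolyBasis B)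
    {δ : ℝ} (hδ : 0 < δ) (hδ1 : δ ≤ 1) {𝒳 : Set M.𝕏} {ϑbar : ℝ≥0} (hRPI : M.IsRPI 𝒳 ϑbar)
    {Tb Tc : ℕ} (hTb1 : 1 ≤ Tb) (hTbc : Tb ≤ Tc)
    {XPE : Set (Vec n)} {c p : ℝ} (hc : 0 < c) (hp : 0 < p)
    (hburn : ∀ t : ℕ, Tb ≤ t → 2 / ((1 - Real.log 2) * p) *
        (d * Real.log (1 + 16 * zsum M B σw t (δ / 3) x₀ / (c * p * ((t : ℝ) - 1)))
          + Real.log (Real.pi ^ 2 * ((t : ℝ) - Tb + 1) ^ 2 / (2 * δ))) + 1 ≤ (t : ℝ))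
    (herr : ∀ t : ℕ, Tc ≤ t → M.errBound B σw c p t δ x₀ ≤ ϑbar)
    (hcont : ∀ x : M.𝕏, ‖(x : Vec n)‖₊ ≤ M.xbar B σw (Tc + 1) (δ / 3) x₀ → x ∈ 𝒳)
    (hexc : M.RegionallyExcited μw μs XPE c p) (hreach : M.reach B 𝒳 ⊆ XPE) :
    P {ω | ∃ r, ω ∉ cert W θhat σw (δ / 3) ϑbar Tc r} ≤ ENNReal.ofReal δ := by
  have hδ3 : 0 < δ / 3 := by positivity
  set E1 := {ω | ∃ t, System.wbar n σw (t + 1) (δ / 3) < ‖(W t ω : Vec n)‖₊} with hE1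
  set E2 := {ω | ∃ t, 2 * n * (σw : ℝ) ^ 2 * (Real.log (n / (δ / 3)) + 1 / 2 *
        Real.log ((gram M.γ (fun s => regressor X U s ω) t).det / M.γ ^ d))
      < ∑ j, selfNorm M.γ (fun s => regressor X U s ω) (fun s => (W s ω : Vec n) j) t} with hE2
  -- The energy up to `k = Tb - 1 + i` controls the Gram matrix at time `k + 1 = Tb + i`; the index
  -- `i` carries the weight `6 / (π² (i + 1)²)` of the union bound.
  set E3 := ⋃ i : ℕ, poorlyExcited W X U θhat σw (δ / 3) ϑbar Tc
    (c * p * ((Tb - 1 + i : ℕ) : ℝ) / 4) (Tb - 1 + i) with hE3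
  have hP1 : P E1 ≤ ENNReal.ofReal (δ / 3) := h.measure_noise_gt hn hδ3 (by linarith)
  have hP2 : P E2 ≤ ENNReal.ofReal (δ / 3) := hcl.measure_sum_selfNorm_gt hM h hn hδ3
  have hP3 : P E3 ≤ ENNReal.ofReal (δ / 3) := by
    refine measure_exists_le_of_basel hδ3.le fun i => ?_
    refine hcl.measure_poorlyExcited hM h hn hd hB hu hψ hδ3 hRPI hcont hc hp hexc hreach
      (by positivity) ?_
    have h1 := hburn (Tb - 1 + i + 1) (by omega)
    have e1 : (((Tb - 1 + i + 1 : ℕ) : ℝ) - 1) = ((Tb - 1 + i : ℕ) : ℝ) := by push_cast; ring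
    have e2 : ((Tb - 1 + i + 1 : ℕ) : ℝ) - Tb + 1 = (i : ℝ) + 1 := by
      have : Tb - 1 + i + 1 = Tb + i := by omega
      rw [this]; push_cast; ring
    have e3 : 1 / (6 * (δ / 3) / (Real.pi ^ 2 * ((i : ℝ) + 1) ^ 2))
        = Real.pi ^ 2 * ((i : ℝ) + 1) ^ 2 / (2 * δ) := by
      have := Real.pi_ne_zero
      field_simp
      ring
    rw [e1, e2] at h1
    rw [e3]
    linarith
  have hsub : {ω | ∃ r, ω ∉ cert W θhat σw (δ / 3) ϑbar Tc r} ⊆ E1 ∪ E2 ∪ E3 := by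
    rintro ω ⟨r, hr⟩
    by_contra hcon
    simp only [Set.mem_union, not_or] at hcon
    obtain ⟨⟨hn1, hn2⟩, hn3⟩ := hcon
    simp only [hE1, hE2, Set.mem_ofPred_eq, not_exists, not_lt] at hn1 hn2
    refine hr ?_
    clear hr
    -- Not circular: accuracy at time `k + 1` uses certification up to `k` only.
    induction r with
    | zero => exact ⟨fun i hi => absurd hi (Nat.not_lt_zero i), fun s _ hs => by omega⟩
    | succ r ih =>
      refine ⟨fun i _ => hn1 i, fun s hs hs' => ?_⟩
      rcases Nat.lt_or_ge (s + 1) r with hlt | hge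
      · exact ih.2 s hs hlt
      obtain ⟨i, rfl⟩ : ∃ i, s = Tb - 1 + i + 1 := ⟨s - Tb, by omega⟩
      have hck : ω ∈ cert W θhat σw (δ / 3) ϑbar Tc (Tb - 1 + i) :=
        cert_antitone σw (δ / 3) ϑbar Tc (by omega) ih
      have hexk : ∀ ζ : Vec d, ‖ζ‖ = 1 →
          c * p * ((Tb - 1 + i : ℕ) : ℝ) / 4 ≤ energy X U ζ (Tb - 1 + i) ω := by
        intro ζ hζ
        by_contra! hlt
        exact hn3 (Set.mem_iUnion.2 ⟨i, hck, ζ, hζ, hlt⟩)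
      have := (hcl.opNorm_error_le hn hB hu hψ hδ hc hp hck hexk (hn2 _)).trans (herr _ hs)
      exact_mod_cast this
  refine (measure_mono hsub).trans ((measure_union_le _ _).trans
    ((add_le_add (measure_union_le _ _) le_rfl).trans
      ((add_le_add (add_le_add hP1 hP2) hP3).trans_eq ?_)))
  rw [← ENNReal.ofReal_add (by positivity) (by positivity),
    ← ENNReal.ofReal_add (by positivity) (by positivity)]
  congr 1
  ring

end ErrorBound

/-! ### Stochastic stability -/

/-- A convex function of class `𝒦_∞` is bounded below by an affine function of positive slope. -/
theorem ClassKInf.exists_affine_le {a : ℝ≥0 → ℝ≥0} (ha : ClassKInf a)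
    (hc : ConvexOn ℝ≥0 Set.univ a) :
    ∃ b : ℝ, 0 < b ∧ b ≤ 1 ∧ ∀ r : ℝ≥0, b * (r - 1) ≤ a r := by
  have h1 : 0 < a 1 := by
    rw [← ha.map_zero]; exact ha.strictMono zero_lt_one
  have h1' : (0 : ℝ) < a 1 := h1
  refine ⟨min (a 1) 1, lt_min h1' one_pos, min_le_right _ _, fun r => ?_⟩
  rcases le_total r 1 with hr | hr
  · have hr' : (r : ℝ) ≤ 1 := by exact_mod_cast hr
    have : min (a 1 : ℝ) 1 * (r - 1) ≤ 0 :=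
      mul_nonpos_of_nonneg_of_nonpos (by positivity) (by linarith)
    exact this.trans (NNReal.coe_nonneg _)
  · have hr0 : r ≠ 0 := (zero_lt_one.trans_le hr).ne'
    have hinv : r⁻¹ ≤ 1 := inv_le_one_of_one_le₀ hr
    -- Convexity on the segment from `0` to `r`, evaluated at `1`, gives `a 1 ≤ a r / r`.
    have h2 : a (r⁻¹ • r + (1 - r⁻¹) • 0) ≤ r⁻¹ • a r + (1 - r⁻¹) • a 0 :=
      hc.2 (Set.mem_univ r) (Set.mem_univ 0) zero_le zero_le (add_tsub_cancel_of_le hinv)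
    simp only [smul_eq_mul, mul_zero, add_zero, ha.map_zero, inv_mul_cancel₀ hr0] at h2
    have h3 : r * a 1 ≤ a r :=
      calc r * a 1 ≤ r * (r⁻¹ * a r) := by gcongr
        _ = a r := by rw [← mul_assoc, mul_inv_cancel₀ hr0, one_mul]
    have h3' : (r : ℝ) * a 1 ≤ a r := by exact_mod_cast h3
    have hr' : (1 : ℝ) ≤ r := by exact_mod_cast hr
    calc min (a 1 : ℝ) 1 * (r - 1) ≤ a 1 * r := by
          gcongr
          · exact min_le_left _ _
          · linarith
      _ ≤ a r := by linarith

/-- An affine contraction recursion with values in `[0, ∞]`. -/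
theorem eventually_le_of_contraction {v : ℕ → ℝ≥0∞} {a D : ℝ} (ha : 0 < a) (ha1 : a ≤ 1)
    (hD : 0 ≤ D) {T₀ : ℕ} (hfin : v T₀ ≠ ∞)
    (hstep : ∀ t, T₀ ≤ t → v (t + 1) ≤ ENNReal.ofReal (1 - a) * v t + ENNReal.ofReal D) :
    ∃ T₁, ∀ t, T₁ ≤ t → v t ≤ ENNReal.ofReal (D / a + 1) := by
  have h1a : 0 ≤ 1 - a := by linarith
  -- `D / a` is the fixed point of the recursion; the initial value decays geometrically.
  have hind : ∀ k, v (T₀ + k) ≤ ENNReal.ofReal ((1 - a) ^ k * (v T₀).toReal + D / a) := by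
    intro k
    induction k with
    | zero =>
      rw [Nat.add_zero, pow_zero, one_mul]
      refine (ENNReal.ofReal_toReal hfin).symm.le.trans (ENNReal.ofReal_le_ofReal ?_)
      have : 0 ≤ D / a := by positivity
      linarith
    | succ k ih =>
      refine (hstep (T₀ + k) (Nat.le_add_right _ _)).trans ?_
      refine (add_le_add (mul_le_mul_right ih _) le_rfl).trans ?_
      have : 0 ≤ (v T₀).toReal := ENNReal.toReal_nonneg
      rw [← ENNReal.ofReal_mul h1a, ← ENNReal.ofReal_add (by positivity) hD]
      refine ENNReal.ofReal_le_ofReal (le_of_eq ?_)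
      field_simp
      ring
  have hlim : Tendsto (fun k => (1 - a) ^ k * (v T₀).toReal) atTop (𝓝 0) := by
    simpa using (tendsto_pow_atTop_nhds_zero_of_lt_one h1a (by linarith)).mul_const (v T₀).toReal
  obtain ⟨k₀, hk₀⟩ := eventually_atTop.1 (hlim.eventually (ge_mem_nhds one_pos))
  refine ⟨T₀ + k₀, fun t ht => ?_⟩
  obtain ⟨k, rfl⟩ := Nat.exists_eq_add_of_le (le_trans (Nat.le_add_right _ _) ht)
  refine (hind k).trans (ENNReal.ofReal_le_ofReal ?_)
  have := hk₀ k (by omega)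
  linarith

/-! ### Lyapunov drift on certified trajectories. -/

section Drift

variable {n m d q : ℕ} {M : System n m d q}

/-- A measurable Lyapunov function that agrees with `V` on the invariant set and satisfies an affine
drift condition uniformly over the small estimation errors. -/
theorem System.IsStochLyapunov.exists_drift {μw : Measure M.𝕎} {μs : Measure M.𝕊} {𝒳 : Set M.𝕏}
    {ϑbar : ℝ≥0} {V : M.𝕏 → ℝ≥0} (hV : M.IsStochLyapunov μw μs 𝒳 ϑbar V) :
    ∃ (V' : M.𝕏 → ℝ≥0) (α₁ α₂ : ℝ≥0 → ℝ≥0) (a D : ℝ), Measurable V' ∧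
      ClassKInf α₁ ∧ ClassKInf α₂ ∧ 0 < a ∧ a ≤ 1 ∧ 0 ≤ D ∧
      (∀ x ∈ 𝒳, α₁ ‖(x : Vec n)‖₊ ≤ V' x ∧ V' x ≤ α₂ ‖(x : Vec n)‖₊) ∧
      ∀ x ∈ 𝒳, ∀ ϑ : Mat d n, opNorm (ϑ - M.θstar) ≤ ϑbar →
        ∫⁻ p, (V' (M.g x (M.α x p.1 ϑ) p.2) : ℝ≥0∞) ∂(μs.prod μw)
          ≤ ENNReal.ofReal (1 - a) * V' x + ENNReal.ofReal D := by
  obtain ⟨hVm, hRPI, α₁, α₂, α₃, σ₃, dtil, h1, h2, h3, hσ, hbd, hdrift, αv, hαv, hconv, hle⟩ := hV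
  -- `V` is measurable on `𝒳` only and `𝒳` need not be measurable, so `V` is replaced by a
  -- measurable extension of its restriction.
  obtain ⟨V', hV'm, hV'⟩ := Measurable.exists_eq_measurable_comp (f := (Subtype.val : 𝒳 → M.𝕏))
    (g := fun x : 𝒳 => V x) hVm
  have heq : ∀ x ∈ 𝒳, V' x = V x := fun x hx => (congrFun hV' ⟨x, hx⟩).symm
  obtain ⟨a, ha, ha1, haff⟩ := hαv.exists_affine_le hconv
  refine ⟨V', α₁, α₂, a, a + dtil + σ₃ ϑbar, hV'm, h1, h2, ha, ha1, by positivity,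
    fun x hx => (heq x hx).symm ▸ hbd x hx, fun x hx ϑ hϑ => ?_⟩
  obtain ⟨hint, hineq⟩ := hdrift x hx (ϑ - M.θstar) hϑ
  rw [sub_add_cancel] at hint hineq
  have e : ∀ p : M.𝕊 × M.𝕎, (V' (M.g x (M.α x p.1 ϑ) p.2) : ℝ≥0∞)
      = ENNReal.ofReal (V (M.g x (M.α x p.1 ϑ) p.2) : ℝ) := by
    intro p
    rw [heq _ (hRPI.2 x hx _ _ _ hϑ), ENNReal.ofReal_coe_nnreal]
  simp_rw [e]
  rw [← ofReal_integral_eq_lintegral_ofReal hint (ae_of_all _ fun _ => NNReal.coe_nonneg _),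
    heq x hx, ← ENNReal.ofReal_coe_nnreal (p := V x), ← ENNReal.ofReal_mul (by linarith),
    ← ENNReal.ofReal_add (mul_nonneg (by linarith) (NNReal.coe_nonneg _)) (by positivity)]
  refine ENNReal.ofReal_le_ofReal ?_
  have h4 : (αv (V x) : ℝ) ≤ α₃ ‖(x : Vec n)‖₊ := by
    refine NNReal.coe_le_coe.2 ((hαv.strictMono.monotone (hbd x hx).2).trans
      ((hle _).trans_eq ?_))
    rw [Function.leftInverse_invFun h2.strictMono.injective]
  have h5 : (σ₃ (opNorm (ϑ - M.θstar)) : ℝ) ≤ σ₃ ϑbar :=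
    NNReal.coe_le_coe.2 (hσ.strictMono.monotone hϑ)
  have h6 := haff (V x)
  linarith

variable {Ω : Type*} {W : ℕ → Ω → M.𝕎} {S : ℕ → Ω → M.𝕊}
  {x₀ : M.𝕏} {X : ℕ → Ω → M.𝕏} {U : ℕ → Ω → M.𝕌} {θhat : ℕ → Ω → Mat d n} {B : Growth}
  {mΩ : MeasurableSpace Ω} {P : Measure Ω} [IsProbabilityMeasure P]
  {μw : Measure M.𝕎} {μs : Measure M.𝕊} {σw : ℝ≥0}

/-- The drift holds with the estimate frozen at its past value, the noises `S t` and `W t` being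
fresh. The condition `Tc + 1 ≤ t` makes the estimate at `t - 1` a certified one. -/
theorem System.IsClosedLoop.lintegral_drift (hcl : M.IsClosedLoop W S x₀ X U θhat)
    (hM : M.MeasurableMaps) (h : M.NoiseAssumption P W S μw μs σw) {δ : ℝ} {ϑbar : ℝ≥0} {Tc : ℕ}
    {𝒳 : Set M.𝕏} (hmem : ∀ r, ∀ ω ∈ cert W θhat σw δ ϑbar Tc r, X r ω ∈ 𝒳)
    {V : M.𝕏 → ℝ≥0} (hV : Measurable V) {a D : ℝ}
    (hdrift : ∀ x ∈ 𝒳, ∀ ϑ : Mat d n, opNorm (ϑ - M.θstar) ≤ ϑbar →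
        ∫⁻ p, (V (M.g x (M.α x p.1 ϑ) p.2) : ℝ≥0∞) ∂(μs.prod μw)
          ≤ ENNReal.ofReal (1 - a) * V x + ENNReal.ofReal D)
    {t : ℕ} (ht : Tc + 1 ≤ t) :
    ∫⁻ ω, (cert W θhat σw δ ϑbar Tc (t + 1)).indicator (fun ω => (V (X (t + 1) ω) : ℝ≥0∞)) ω ∂P
      ≤ ENNReal.ofReal (1 - a)
          * ∫⁻ ω, (cert W θhat σw δ ϑbar Tc t).indicator (fun ω => (V (X t ω) : ℝ≥0∞)) ω ∂P
        + ENNReal.ofReal D := by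
  have hpl : ∀ a b, past W S a b ≤ mΩ := past_le W S h.measurable_W h.measurable_S
  set C := cert W θhat σw δ ϑbar Tc with hC
  have hCm := hcl.measurableSet_cert hM σw δ ϑbar Tc
  have hθm : ∀ i j, Measurable[past W S t t] fun ω => θhat (t - 1) ω i j := fun i j =>
    ((hcl.adapted hM (t - 1)).2.2 i j).mono (past_mono W S (by omega) (by omega)) le_rfl
  -- `C t` says nothing about the estimate at `t - 1`, and `C (t + 1)` also constrains the fresh
  -- noise `W t`. The set `G` lies between them, belongs to the past and contains the needed
  -- accuracy.
  set G : Set Ω := C t ∩ {ω | opNorm (θhat (t - 1) ω - M.θstar) ≤ ϑbar} with hG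
  have hGm : MeasurableSet[past W S t t] G :=
    MeasurableSet.inter (hCm t) ((measurable_opNorm_sub hθm M.θstar) measurableSet_Iic)
  have hsub : C (t + 1) ⊆ G := fun ω hω =>
    ⟨cert_antitone σw δ ϑbar Tc (Nat.le_succ t) hω, hω.2 (t - 1) (by omega) (by omega)⟩
  set Y : Ω → ℝ≥0∞ × M.𝕏 × (Fin d → Fin n → ℝ) := fun ω =>
    (G.indicator (fun _ => 1) ω, X t ω, fun i j => θhat (t - 1) ω i j) with hY
  have hYm : Measurable[past W S t t] Y :=
    (Measurable.indicator measurable_const hGm).prodMk ((hcl.adapted hM t).1.prodMk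
      (@measurable_pi_lambda _ _ _ (past W S t t) _ _ fun i =>
        @measurable_pi_lambda _ _ _ (past W S t t) _ _ fun j => hθm i j))
  set F : (ℝ≥0∞ × M.𝕏 × (Fin d → Fin n → ℝ)) × (M.𝕊 × M.𝕎) → ℝ≥0∞ := fun p =>
    V (M.g p.1.2.1 (M.α p.1.2.1 p.2.1 (Matrix.of p.1.2.2)) p.2.2) with hF
  have hFm : Measurable F := by
    have hx : Measurable fun p : (ℝ≥0∞ × M.𝕏 × (Fin d → Fin n → ℝ)) × (M.𝕊 × M.𝕎) => p.1.2.1 :=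
      measurable_fst.comp (measurable_snd.comp measurable_fst)
    have ha : Measurable fun p : (ℝ≥0∞ × M.𝕏 × (Fin d → Fin n → ℝ)) × (M.𝕊 × M.𝕎) =>
        M.α p.1.2.1 p.2.1 (Matrix.of p.1.2.2) :=
      hM.α.comp (hx.prodMk ((measurable_fst.comp measurable_snd).prodMk
        (measurable_snd.comp (measurable_snd.comp measurable_fst))))
    exact (hV.comp (hM.g.comp ((hx.prodMk ha).prodMk
      (measurable_snd.comp measurable_snd)))).coe_nnreal_ennreal
  have hXV : Measurable fun ω => (V (X t ω) : ℝ≥0∞) :=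
    (hV.comp ((hcl.adapted hM t).1.mono (hpl _ _) le_rfl)).coe_nnreal_ennreal
  calc ∫⁻ ω, (C (t + 1)).indicator (fun ω => (V (X (t + 1) ω) : ℝ≥0∞)) ω ∂P
      ≤ ∫⁻ ω, (Y ω).1 * F (Y ω, (S t ω, W t ω)) ∂P := by
        refine lintegral_mono fun ω => ?_
        by_cases hω : ω ∈ C (t + 1)
        · simp only [hY, hF]
          rw [Set.indicator_of_mem hω, Set.indicator_of_mem (hsub hω), one_mul, hcl.dynamics,
            hcl.control]
          exact le_rfl
        · rw [Set.indicator_of_notMem hω]; exact zero_le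
    _ = ∫⁻ ω, ∫⁻ z, (Y ω).1 * F (Y ω, z) ∂(μs.prod μw) ∂P :=
        h.lintegral_past (H := fun p => p.1.1 * F p) hYm
          ((measurable_fst.comp measurable_fst).mul hFm)
    _ ≤ ∫⁻ ω, ENNReal.ofReal (1 - a) * (C t).indicator (fun ω => (V (X t ω) : ℝ≥0∞)) ω
          + ENNReal.ofReal D ∂P := by
        refine lintegral_mono fun ω => ?_
        have hFs : Measurable fun z => F (Y ω, z) := hFm.comp measurable_prodMk_left
        rw [lintegral_const_mul _ hFs]
        by_cases hω : ω ∈ G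
        · have e : (Y ω).1 = 1 := Set.indicator_of_mem hω fun _ => 1
          rw [e, one_mul, Set.indicator_of_mem hω.1]
          exact hdrift _ (hmem t ω hω.1) (θhat (t - 1) ω) hω.2
        · have e : (Y ω).1 = 0 := Set.indicator_of_notMem hω fun _ => 1
          rw [e, zero_mul]; exact zero_le
    _ = _ := by
        rw [lintegral_add_right _ measurable_const, lintegral_const, measure_univ, mul_one,
          lintegral_const_mul _ (hXV.indicator (hpl _ _ _ (hCm t)))]

theorem one_sub_le_measureReal {s : Set Ω} {δ : ℝ} (hδ : 0 ≤ δ) (h : P sᶜ ≤ ENNReal.ofReal δ) :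
    1 - δ ≤ P.real s := by
  have h1 : 1 ≤ P.real s + P.real sᶜ := by
    rw [← probReal_univ (μ := P), ← Set.union_compl_self s]
    exact measureReal_union_le _ _
  have h2 : P.real sᶜ ≤ δ := ENNReal.toReal_le_of_le_ofReal hδ h
  linarith

end Drift

end AdaptiveControl

/-! ### The stability theorem. -/

theorem theorem2 {n m d q : ℕ} (hn : 0 < n) (hd : 0 < d)
    (Sys : AdaptiveControl.System n m d q) (B : AdaptiveControl.Growth)
    {Ω : Type*} [MeasurableSpace Ω] (P : Measure Ω) [IsProbabilityMeasure P]
    (W : ℕ → Ω → Sys.𝕎) (S : ℕ → Ω → Sys.𝕊)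
    (μw : Measure Sys.𝕎) (μs : Measure Sys.𝕊) (σw : ℝ≥0)
    (h_meas : Sys.MeasurableMaps)
    (h_noise : Sys.NoiseAssumption P W S μw μs σw)
    (h_forward : Sys.ForwardComplete B)
    (h_control : Sys.ConstrainedControls B)
    (h_basis : Sys.PolyBasis B)
    (XPE : Set (AdaptiveControl.Vec n)) (hXPE : XPE ⊆ Sys.𝕏)
    (cPE pPE : ℝ) (hcPE : 0 < cPE) (hpPE : 0 < pPE)
    (h_excited : Sys.RegionallyExcited μw μs XPE cPE pPE)
    (XRPI : Set Sys.𝕏) (h_reach : Sys.reach B XRPI ⊆ XPE)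
    (ϑbar : ℝ≥0) (V : Sys.𝕏 → ℝ≥0)
    (h_lyap : Sys.IsStochLyapunov μw μs XRPI ϑbar V) :
    ∀ δ ∈ Set.Ioo (0 : ℝ) 1, ∃ c₂ : ℝ≥0, ∀ x₀ ∈ XRPI,
      Sys.Tconverge B σw cPE pPE ϑbar (δ / 2) x₀ + 1 ≤ Sys.Tcontained B σw XRPI (δ / 2) x₀ →
      ∀ (X : ℕ → Ω → Sys.𝕏) (U : ℕ → Ω → Sys.𝕌) (θhat : ℕ → Ω → AdaptiveControl.Mat d n),
        Sys.IsClosedLoop W S x₀ X U θhat →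
        ∃ η : ℕ → ℝ≥0, AdaptiveControl.ClassL η ∧
          ∀ t : ℕ, 1 - δ ≤
            P.real {ω | ‖(X t ω : AdaptiveControl.Vec n)‖ ≤ (η t : ℝ) + (c₂ : ℝ)} := by
  rintro δ ⟨hδ0, hδ1⟩
  have hRPI := h_lyap.2.1
  obtain ⟨V', α₁, α₂, a, D, hV'm, hα₁, hα₂, ha, ha1, hD, hbd, hdrift⟩ := h_lyap.exists_drift
  -- The Markov threshold: an expectation of at most `D / a + 1` exceeds `K` with probability at
  -- most `δ / 2`. Neither `K` nor `c₂` depends on `x₀`.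
  set K : ℝ := (D / a + 1) * (2 / δ) with hK
  have hK0 : 0 < K := by positivity
  obtain ⟨c₂, hc₂⟩ := (hα₁.unbounded.eventually_ge_atTop K.toNNReal).exists
  refine ⟨c₂, fun x₀ _ hT X U θhat hcl => ?_⟩
  have hδ2 : 0 < δ / 2 := by positivity
  have hδ6 : 0 < δ / 2 / 3 := by positivity
  obtain ⟨Tb, Tc, hTb1, hTbc, hburn, herr, hcont⟩ := AdaptiveControl.exists_times Sys hn h_forward
    h_basis σw hcPE hpPE hRPI.1 hδ2 x₀ XRPI hT
  have hcert := hcl.measure_not_cert h_meas h_noise hn hd h_forward h_control h_basis hδ2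
    (by linarith) hRPI hTb1 hTbc hcPE hpPE hburn herr hcont h_excited h_reach
  set C := AdaptiveControl.cert W θhat σw (δ / 2 / 3) ϑbar Tc with hC
  have hmem : ∀ r, ∀ ω ∈ C r, X r ω ∈ XRPI := fun r ω hω =>
    hcl.cert_mem hn h_forward h_control hδ6 hRPI hcont hω
  have hXle : ∀ r, ∀ ω ∈ C r, ‖(X r ω : AdaptiveControl.Vec n)‖₊
      ≤ Sys.xbar B σw r (δ / 2 / 3) x₀ := fun r ω hω =>
    hcl.norm_state_le hn h_forward h_control σw hδ6 hω.1
  set v : ℕ → ℝ≥0∞ := fun t => ∫⁻ ω, (C t).indicator (fun ω => (V' (X t ω) : ℝ≥0∞)) ω ∂P with hv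
  -- The recursion starts at `Tc + 1`, where the a priori state bound gives a finite value.
  have hfin : v (Tc + 1) ≠ ∞ := by
    refine ne_top_of_le_ne_top (b := (α₂ (Sys.xbar B σw (Tc + 1) (δ / 2 / 3) x₀) : ℝ≥0∞))
      ENNReal.coe_ne_top ?_
    calc v (Tc + 1) ≤ ∫⁻ _, (α₂ (Sys.xbar B σw (Tc + 1) (δ / 2 / 3) x₀) : ℝ≥0∞) ∂P := by
          refine lintegral_mono fun ω => Set.indicator_apply_le' (fun hω => ?_) fun _ => ?_
          · exact ENNReal.coe_le_coe.2 ((hbd _ (hmem _ ω hω)).2.trans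
              (hα₂.strictMono.monotone (hXle _ ω hω)))
          · exact zero_le
      _ = _ := by rw [lintegral_const, measure_univ, mul_one]
  obtain ⟨T₁, hT₁⟩ := AdaptiveControl.eventually_le_of_contraction ha ha1 hD hfin
    fun t ht => hcl.lintegral_drift h_meas h_noise hmem hV'm hdrift ht
  set R := Sys.xbar B σw T₁ (δ / 2 / 3) x₀ with hR
  -- `R` dominates the certified states before `T₁`; afterwards the constant `c₂` suffices alone.
  refine ⟨fun t => if t < T₁ then R else 0, ⟨?_, ?_⟩, fun t => ?_⟩
  · intro s t hst
    by_cases ht : t < T₁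
    · simp [ht, lt_of_le_of_lt hst ht]
    · simp only [if_neg ht]; exact zero_le
  · refine tendsto_const_nhds.congr' ?_
    filter_upwards [eventually_ge_atTop T₁] with t ht
    simp [not_lt.2 ht]
  · refine AdaptiveControl.one_sub_le_measureReal hδ0.le ?_
    by_cases ht : t < T₁
    · refine (measure_mono fun ω hω => ?_).trans
        (hcert.trans (ENNReal.ofReal_le_ofReal (by linarith)))
      refine ⟨t, fun hmem' => hω ?_⟩
      have h1 := (hXle t ω hmem').trans
        (AdaptiveControl.xbar_mono Sys hn h_forward σw hδ6 x₀ ht.le)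
      have h2 : ‖(X t ω : AdaptiveControl.Vec n)‖ ≤ R := by exact_mod_cast h1
      simp only [Set.mem_ofPred_eq, if_pos ht]
      exact h2.trans (le_add_of_nonneg_right (NNReal.coe_nonneg _))
    · have hle := AdaptiveControl.past_le W S h_noise.measurable_W h_noise.measurable_S
      have hm : Measurable ((C t).indicator fun ω => (V' (X t ω) : ℝ≥0∞)) :=
        (hV'm.comp ((hcl.adapted h_meas t).1.mono (hle _ _) le_rfl)).coe_nnreal_ennreal.indicator
          (hle _ _ _ (hcl.measurableSet_cert h_meas σw _ ϑbar Tc t))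
      have hmarkov : P {ω | ENNReal.ofReal K ≤ (C t).indicator (fun ω => (V' (X t ω) : ℝ≥0∞)) ω}
          ≤ ENNReal.ofReal (δ / 2) := by
        have hK' : ENNReal.ofReal K ≠ 0 := by
          simpa only [ne_eq, ENNReal.ofReal_eq_zero, not_le] using hK0
        have h1 := (mul_meas_ge_le_lintegral (μ := P) hm (ENNReal.ofReal K)).trans
          (hT₁ t (not_lt.1 ht))
        refine (ENNReal.mul_le_iff_le_inv hK' ENNReal.ofReal_ne_top |>.1 h1).trans_eq ?_
        rw [← ENNReal.ofReal_inv_of_pos hK0, ← ENNReal.ofReal_mul (by positivity)]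
        congr 1
        rw [hK]
        have : D / a + 1 ≠ 0 := by positivity
        field_simp
      refine (measure_mono (t := {ω | ∃ r, ω ∉ C r} ∪ {ω | ENNReal.ofReal K ≤
        (C t).indicator (fun ω => (V' (X t ω) : ℝ≥0∞)) ω}) fun ω hω => ?_).trans
        ((measure_union_le _ _).trans ((add_le_add hcert hmarkov).trans_eq ?_))
      · by_cases hωC : ω ∈ C t
        · right
          rw [Set.mem_ofPred_eq, Set.indicator_of_mem hωC]
          have h1 : c₂ < ‖(X t ω : AdaptiveControl.Vec n)‖₊ := by
            by_contra hcon
            refine hω ?_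
            have h2 : ‖(X t ω : AdaptiveControl.Vec n)‖ ≤ c₂ := by
              exact_mod_cast not_lt.1 hcon
            simpa [ht] using h2
          have h3 := (hα₁.strictMono h1).le.trans (hbd _ (hmem t ω hωC)).1
          exact ENNReal.coe_le_coe.2 (hc₂.trans h3)
        · exact Or.inl ⟨t, hωC⟩
      · rw [← ENNReal.ofReal_add hδ2.le hδ2.le, add_halves]
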